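/- Let $\rho$ run over the nontrivial zeros of the Riemann zeta function $\zeta$ with $\operatorname{Im}\rho>0$, counted with multiplicity, and write $\rho=\tfrac12+i\tau_k$, $k=1,2,\dots$, with $\operatorname{Re}\tau_k>0$ (the Riemann Hypothesis is not assumed; the $\tau_k$ may be complex). Put $$\mathcal Z(\sigma)=\sum_{k}\tau_k^{-2\sigma}\quad(\operatorname{Re}\sigma>\tfrac12),\qquad \mathbf Z(s)=\sum_{k=1}^{\infty}\bigl(\tfrac12+2k\bigr)^{-s}\quad(\operatorname{Re}s>1),$$ with principal powers. Both series converge absolutely in the indicated half-planes, and both functions have a unique meromorphic continuation to $\mathbb C$, denoted by the same letter. For every $m=0,1,2,\dots$, $\mathcal Z$ is analytic at $-m$, $\mathbf Z$ is analytic at $-2m$, and $$\mathcal Z(-m)=\frac{(-1)^m}{2}\Bigl[-\mathbf Z(-2m)+2^{-2m}\Bigr]=(-1)^m\,2^{-2m}\Bigl(1-\frac{E_{2m}}{8}\Bigr),$$ where $E_n$ are the Euler numbers, defined by $1/\cosh t=\sum_{n\ge0}E_n t^n/n!$. -/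

import Mathlib

open Complex

noncomputable section

/-- The nontrivial zeros `ρ` of the Riemann zeta function with `Im ρ > 0`. Since `ζ` has no zero in
the real interval `(0, 1)`, exactly one element of every pair `{ρ, 1 - ρ}` of nontrivial zeros
lies in this set. -/
def upperZetaZeros : Set ℂ :=
  {ρ : ℂ | riemannZeta ρ = 0 ∧ 0 < ρ.re ∧ ρ.re < 1 ∧ 0 < ρ.im}

/-- The parameter `τ` with `ρ = 1/2 + i τ`; one has `Re τ = Im ρ`. -/
def zeroParam (ρ : ℂ) : ℂ := (ρ - 1 / 2) / I

/-- One term of the Dirichlet series `∑ τ_k ^ (-2σ)`: a zero `ρ` counts with its multiplicity.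
The power is the principal one, and `Re τ > 0` on `upperZetaZeros`. -/
def zeroTerm (σ : ℂ) (ρ : upperZetaZeros) : ℂ :=
  (analyticOrderNatAt riemannZeta (ρ : ℂ) : ℂ) * zeroParam (ρ : ℂ) ^ (-2 * σ)

/-- The Dirichlet series `∑ τ_k ^ (-2σ)` over the Riemann zeros. -/
def zeroSeries (σ : ℂ) : ℂ := ∑' ρ : upperZetaZeros, zeroTerm σ ρ

/-- One term of `∑_{k ≥ 1} (1/2 + 2k) ^ (-s)`; the index `k : ℕ` stands for `k + 1`. -/
def shadowTerm (s : ℂ) (k : ℕ) : ℂ := (1 / 2 + 2 * ((k : ℂ) + 1)) ^ (-s)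

/-- The Dirichlet series `∑_{k ≥ 1} (1/2 + 2k) ^ (-s)` over the shifted trivial zeros. -/
def shadowSeries (s : ℂ) : ℂ := ∑' k : ℕ, shadowTerm s k

/-- `F` is the meromorphic continuation to `ℂ` of the function `f` on `U`. Normal form means that
`F` takes its limit value at each point where it is regular (and, by convention, `0` at each pole),
so that a value `F a` at a regular point is the value of the continuation. -/
def IsMeromorphicContinuation (f : ℂ → ℂ) (U : Set ℂ) (F : ℂ → ℂ) : Prop :=
  MeromorphicNFOn F Set.univ ∧ Set.EqOn F f U

/-- The formal power series of `cosh`. -/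
def coshSeries : PowerSeries ℚ :=
  PowerSeries.mk fun n => if Even n then 1 / (n.factorial : ℚ) else 0

/-- The Euler numbers, `1 / cosh t = ∑ E_n t ^ n / n!`. -/
def eulerNumber (n : ℕ) : ℚ := (n.factorial : ℚ) * PowerSeries.coeff n coshSeries⁻¹

end

/-! The entire function `ξ(1/2 + z)` is even, of order one, and its zeros are `±iτ_k`. Its second
logarithmic derivative therefore has the partial fraction expansion `-(ξ'/ξ)'(1/2 + t) = ∑ m_a / (t
+ a)²`, with `a` running over `±iτ_k` and `m_a` the multiplicity (`hasSum_xiMult_div_sq`). The proof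
takes the Mellin transform of `(ξ'/ξ)'(1/2 + t)` at `u = 2 - 2σ`, for `1/2 < Re σ < 1`, in two ways.

On the side of the zeros, a double pole contributes `a^(-2σ) Γ(2-2σ) Γ(2σ)`, and `(iτ)^(-2σ) +
(-iτ)^(-2σ) = 2 cos(πσ) τ^(-2σ)`, which produces `𝒵(σ)` (`mellin_deriv_logDeriv_riemannXi`). On the
other side, for `t > 1/2` the product formula for `ξ` gives `(ξ'/ξ)' = -1/(t - 1/2)² + ∑ 1/(t + 1/2
+ 2k)² + (ζ'/ζ)'`. The sum over the trivial zeros contributes `𝐙(2σ)` with the same Gamma factor.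
The double pole, kept only for `t > 1`, contributes the explicit series `P(σ) = ∑ (n+1) 2^(-n) / (n
+ 2σ)`. What is left is bounded near `0`, because `ξ` has no real zeros, and exponentially small at
infinity, so its transform `M(σ)` is holomorphic for `Re σ < 1`.

Solving for `𝒵` with the reflection formula gives `𝒵(σ) = -𝐙(2σ) / (2 cos πσ) + sin(πσ) (P(σ) -
M(σ)) / (π (1 - 2σ))` (`zeroSeries_eq_zeroContinuation`), which continues `𝒵` to the left. At `σ =
-m` the sine kills `M` and every term of `P` except `n = 2m`, whose pole leaves `(-1)^m 2^(-2m) / 2`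
(`tendsto_zeroExtension`).

Finally `𝐙` is a Hurwitz zeta function with parameter `1/4`, up to a power of `2` and one removed
term. Its values at `-2m` are Bernoulli polynomials at `1/4`, hence Euler numbers
(`bernoulli_eval_quarter`, `shadowZeta_neg_two_mul`). -/

section

open Complex Filter Topology Metric

/-! ### Factoring zeros out of an entire function. -/

/-- An entire function splits off the full power of `z - a` at a point of finite order. -/
lemma Differentiable.exists_eq_pow_mul {f : ℂ → ℂ} (hf : Differentiable ℂ f) {a : ℂ}
    (ha : analyticOrderAt f a ≠ ⊤) :
    ∃ h : ℂ → ℂ, Differentiable ℂ h ∧ h a ≠ 0 ∧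
      ∀ z, f z = (z - a) ^ analyticOrderNatAt f a * h z := by
  obtain ⟨g, hg, hga, hfg⟩ := ((hf.analyticAt a).analyticOrderNatAt_eq_iff ha).1 rfl
  set n := analyticOrderNatAt f a
  let h : ℂ → ℂ := Function.update (fun z => f z / (z - a) ^ n) a (g a)
  have hne : ∀ z, z ≠ a → h z = f z / (z - a) ^ n := fun z hz => by simp [h, hz]
  have hh : h =ᶠ[𝓝 a] g := by
    filter_upwards [hfg] with z hz
    rcases eq_or_ne z a with rfl | hza
    · simp [h]
    · rw [hne z hza, hz, smul_eq_mul, mul_div_cancel_left₀ _ (pow_ne_zero _ (sub_ne_zero.2 hza))]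
  refine ⟨h, fun z => ?_, by simpa [h] using hga, fun z => ?_⟩
  · rcases eq_or_ne z a with rfl | hza
    · exact (hg.congr hh.symm).differentiableAt
    · have : (fun z => f z / (z - a) ^ n) =ᶠ[𝓝 z] h := by
        filter_upwards [isOpen_ne.mem_nhds hza] with w hw using (hne w hw).symm
      refine DifferentiableAt.congr_of_eventuallyEq ?_ this.symm
      exact (hf z).div (by fun_prop) (pow_ne_zero _ (sub_ne_zero.2 hza))
  · rcases eq_or_ne z a with rfl | hza
    · simpa [h] using hfg.self_of_nhds
    · rw [hne z hza, mul_div_cancel₀ _ (pow_ne_zero _ (sub_ne_zero.2 hza))]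

lemma Differentiable.analyticOrderAt_ne_top {f : ℂ → ℂ} (hf : Differentiable ℂ f) {b : ℂ}
    (hb : f b ≠ 0) (a : ℂ) : analyticOrderAt f a ≠ ⊤ := by
  have hA : AnalyticOnNhd ℂ f Set.univ := fun z _ => hf.analyticAt z
  refine hA.analyticOrderAt_ne_top_of_isPreconnected isPreconnected_univ (Set.mem_univ b)
    (Set.mem_univ a) ?_
  rw [(hf.analyticAt b).analyticOrderAt_eq_zero.2 hb]
  exact ENat.zero_ne_top

lemma Differentiable.analyticOrderNatAt_eq_zero_iff {f : ℂ → ℂ} (hf : Differentiable ℂ f) {b : ℂ}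
    (hb : f b ≠ 0) (a : ℂ) : analyticOrderNatAt f a = 0 ↔ f a ≠ 0 := by
  rw [← (hf.analyticAt a).analyticOrderAt_eq_zero,
    ← Nat.cast_analyticOrderNatAt (hf.analyticOrderAt_ne_top hb a)]
  simp

/-- An entire function splits off its zeros in a finite set. -/
lemma Differentiable.exists_eq_prod_mul {f : ℂ → ℂ} (hf : Differentiable ℂ f) {b : ℂ}
    (hb : f b ≠ 0) (s : Finset ℂ) :
    ∃ h : ℂ → ℂ, Differentiable ℂ h ∧ (∀ a ∈ s, h a ≠ 0) ∧
      ∀ z, f z = (∏ a ∈ s, (z - a) ^ analyticOrderNatAt f a) * h z := by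
  classical
  induction s using Finset.induction_on with
  | empty => exact ⟨f, hf, by simp, by simp⟩
  | insert a s has ih =>
    obtain ⟨h, hh, hs, heq⟩ := ih
    have hP : AnalyticAt ℂ (fun z => ∏ c ∈ s, (z - c) ^ analyticOrderNatAt f c) a :=
      Differentiable.analyticAt (by fun_prop) a
    have hPa : (∏ c ∈ s, (a - c) ^ analyticOrderNatAt f c) ≠ 0 :=
      Finset.prod_ne_zero_iff.2 fun c hc =>
        pow_ne_zero _ (sub_ne_zero.2 fun h => has (h ▸ hc))
    have hord : analyticOrderAt f a = analyticOrderAt h a := by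
      have : f = (fun z => ∏ c ∈ s, (z - c) ^ analyticOrderNatAt f c) * h := funext heq
      conv_lhs => rw [this]
      rw [analyticOrderAt_mul hP (hh.analyticAt a), hP.analyticOrderAt_eq_zero.2 hPa, zero_add]
    obtain ⟨k, hk, hka, hkeq⟩ :=
      hh.exists_eq_pow_mul (hord ▸ hf.analyticOrderAt_ne_top hb a)
    have hn : analyticOrderNatAt h a = analyticOrderNatAt f a := by
      simp only [analyticOrderNatAt, hord]
    refine ⟨k, hk, ?_, fun z => ?_⟩
    · intro c hc
      rcases Finset.mem_insert.1 hc with rfl | hc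
      · exact hka
      · intro h0
        exact hs c hc (by rw [hkeq, h0, mul_zero])
    · rw [Finset.prod_insert has, heq, hkeq, hn]
      ring

/-- The cofactor of the zeros in `closedBall 0 R` is small compared with its value at `0`. -/
lemma norm_cofactor_le {f h : ℂ → ℂ} (hh : Differentiable ℂ h) (hf0 : f 0 ≠ 0)
    {s : Finset ℂ} {n : ℂ → ℕ} (heq : ∀ z, f z = (∏ a ∈ s, (z - a) ^ n a) * h z)
    {R M : ℝ} (hR : 0 < R) (hs : ∀ a ∈ s, ‖a‖ ≤ R) (hM : ∀ z, ‖z‖ = 4 * R → ‖f z‖ ≤ M)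
    {z : ℂ} (hz : ‖z‖ ≤ 4 * R) :
    3 ^ (∑ a ∈ s, n a) * ‖h z‖ ≤ M / ‖f 0‖ * ‖h 0‖ := by
  set N := ∑ a ∈ s, n a
  -- On `‖w‖ = 4R` each factor satisfies `‖w - a‖ ≥ 3R`, whereas at `0` it is at most `R`. The
  -- quotient of the two bounds is the gain `3 ^ N`.
  have h1 : ∀ w ∈ frontier (ball (0 : ℂ) (4 * R)), ‖h w‖ ≤ M / (3 * R) ^ N := by
    intro w hw
    rw [frontier_ball _ (by positivity), mem_sphere_zero_iff_norm] at hw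
    have hp : (3 * R) ^ N ≤ ‖∏ a ∈ s, (w - a) ^ n a‖ := by
      rw [norm_prod, ← Finset.prod_pow_eq_pow_sum]
      refine Finset.prod_le_prod (fun _ _ => by positivity) fun a ha => ?_
      rw [norm_pow]
      gcongr
      have := norm_sub_norm_le w a
      linarith [hs a ha]
    rw [le_div_iff₀ (by positivity)]
    calc ‖h w‖ * (3 * R) ^ N ≤ ‖h w‖ * ‖∏ a ∈ s, (w - a) ^ n a‖ := by gcongr
      _ = ‖f w‖ := by rw [heq, norm_mul, mul_comm]
      _ ≤ M := hM w hw
  have h2 : ‖h z‖ ≤ M / (3 * R) ^ N :=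
    norm_le_of_forall_mem_frontier_norm_le isBounded_ball hh.diffContOnCl h1
      (by rw [closure_ball _ (by positivity)]; simpa using hz)
  have h3 : ‖f 0‖ ≤ R ^ N * ‖h 0‖ := by
    rw [heq 0, norm_mul, norm_prod, ← Finset.prod_pow_eq_pow_sum]
    gcongr with a ha
    rw [norm_pow, zero_sub, norm_neg]
    gcongr
    exact hs a ha
  have h0 : 0 < ‖f 0‖ := norm_pos_iff.2 hf0
  have hM0 : 0 ≤ M := by
    have := h2
    by_contra! hneg
    have : M / (3 * R) ^ N < 0 := div_neg_of_neg_of_pos hneg (by positivity)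
    linarith [norm_nonneg (h z)]
  calc 3 ^ N * ‖h z‖ ≤ 3 ^ N * (M / (3 * R) ^ N) := by gcongr
    _ = M / R ^ N := by rw [mul_pow]; field_simp
    _ ≤ M / ‖f 0‖ * ‖h 0‖ := by
      rw [div_mul_eq_mul_div, div_le_div_iff₀ (by positivity) h0]
      calc M * ‖f 0‖ ≤ M * (R ^ N * ‖h 0‖) := by gcongr
        _ = _ := by ring

/-- The number of zeros in `closedBall 0 R` is bounded by the growth of the function. -/
lemma Differentiable.three_pow_sum_order_le {f : ℂ → ℂ} (hf : Differentiable ℂ f) (hf0 : f 0 ≠ 0)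
    {s : Finset ℂ} {R M : ℝ} (hR : 0 < R) (hs : ∀ a ∈ s, ‖a‖ ≤ R)
    (hM : ∀ z, ‖z‖ = 4 * R → ‖f z‖ ≤ M) :
    3 ^ (∑ a ∈ s, analyticOrderNatAt f a) ≤ M / ‖f 0‖ := by
  obtain ⟨h, hh, -, heq⟩ := hf.exists_eq_prod_mul hf0 s
  have h0 : 0 < ‖h 0‖ := norm_pos_iff.2 fun h0 => hf0 (by rw [heq, h0, mul_zero])
  exact le_of_mul_le_mul_right
    (norm_cofactor_le hh hf0 heq hR hs hM (z := 0) (by simp; positivity)) h0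

/-- The second logarithmic derivative is approximated by the contribution of the zeros in a disk. -/
lemma norm_deriv_logDeriv_add_sum_order_le {f : ℂ → ℂ} (hf : Differentiable ℂ f)
    (hf0 : f 0 ≠ 0) {s : Finset ℂ} {R B : ℝ} (hR : 0 < R) (hs : ∀ a ∈ s, ‖a‖ ≤ R)
    (hs' : ∀ a, ‖a‖ ≤ R → f a = 0 → a ∈ s) (hB : 0 < B)
    (hM : ∀ z, ‖z‖ = 4 * R → ‖f z‖ ≤ Real.exp B * ‖f 0‖) {z : ℂ} (hz : ‖z‖ ≤ R / 4)
    (hfz : f z ≠ 0) :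
    ‖deriv (logDeriv f) z + ∑ a ∈ s, (analyticOrderNatAt f a : ℂ) / (z - a) ^ 2‖
      ≤ 64 * B / R ^ 2 := by
  obtain ⟨h, hh, hsne, heq⟩ := hf.exists_eq_prod_mul hf0 s
  have h0 : h 0 ≠ 0 := fun h0 => hf0 (by rw [heq, h0, mul_zero])
  have hne : ∀ w ∈ ball (0 : ℂ) R, h w ≠ 0 := by
    intro w hw hw0
    exact hsne w (hs' w (by simpa using (mem_ball_zero_iff.1 hw).le) (by rw [heq, hw0, mul_zero]))
      hw0
  have hb : ∀ w, ‖w‖ ≤ 4 * R → ‖h w‖ ≤ Real.exp B * ‖h 0‖ := by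
    intro w hw
    have := norm_cofactor_le hh hf0 heq hR hs hM hw
    rw [mul_div_cancel_right₀ _ (norm_ne_zero_iff.2 hf0)] at this
    refine le_trans ?_ this
    have : (1 : ℝ) ≤ 3 ^ (∑ a ∈ s, analyticOrderNatAt f a) := one_le_pow₀ (by norm_num)
    nlinarith [norm_nonneg (h w)]
  have hld : DifferentiableOn ℂ (logDeriv h) (ball 0 R) := fun w hw =>
    ((hh.deriv w).div (hh w) (hne w hw)).differentiableWithinAt
  -- The cofactor has no zeros in the disk, so it is `h 0 * exp φ`. The growth bound becomes `re φ ≤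
  -- B`, to which Borel–Carathéodory applies.
  obtain ⟨φ, hφ0, hφ⟩ := hld.isExactOn_ball.with_val_at 0 0
  have hφd : DifferentiableOn ℂ φ (ball 0 R) := fun w hw =>
    (hφ w hw).differentiableAt.differentiableWithinAt
  have hexp : ∀ w ∈ ball (0 : ℂ) R, h w = h 0 * exp (φ w) := by
    intro w hw
    have hconst : ∀ v ∈ ball (0 : ℂ) R, HasDerivAt (fun v => h v * exp (-φ v)) 0 v := by
      intro v hv
      have := (hh v).hasDerivAt.mul ((hφ v hv).neg.cexp)
      refine this.congr_deriv ?_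
      have := hne v hv
      rw [logDeriv_apply]
      field_simp
      simp
    have := (convex_ball (0 : ℂ) R).is_const_of_fderivWithin_eq_zero (𝕜 := ℂ)
      (f := fun v => h v * exp (-φ v))
      (fun v hv => (hconst v hv).differentiableAt.differentiableWithinAt)
      (fun v hv => by
        rw [fderivWithin_of_isOpen isOpen_ball hv]
        ext
        simp [(hconst v hv).deriv]) hw (mem_ball_self hR)
    simp only [hφ0, neg_zero, exp_zero, mul_one] at this
    rw [← this, mul_assoc, ← exp_add]
    simp
  have hre : Set.MapsTo φ (ball 0 R) {w | w.re ≤ B} := by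
    intro w hw
    have h1 := hb w (by have := mem_ball_zero_iff.1 hw; linarith)
    rw [hexp w hw, norm_mul, norm_exp, mul_comm] at h1
    exact Real.exp_le_exp.1 (le_of_mul_le_mul_right h1 (norm_pos_iff.2 h0))
  have hφb : ∀ w ∈ sphere z (R / 4), ‖φ w‖ ≤ 2 * B := by
    intro w hw
    have hw' : ‖w‖ ≤ R / 2 := by
      have h1 : ‖w - z‖ = R / 4 := by simpa [dist_eq_norm] using hw
      have h2 := norm_le_norm_add_norm_sub' w z
      linarith
    have hbc := borelCaratheodory_zero hB hφd hre hR (z := w)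
      (by rw [mem_ball_zero_iff]; linarith) hφ0
    refine hbc.trans ?_
    rw [div_le_iff₀ (by linarith)]
    nlinarith
  have hsub : closedBall z (R / 4) ⊆ ball 0 R := by
    intro w hw
    have h1 : ‖w - z‖ ≤ R / 4 := by simpa [dist_eq_norm] using hw
    have h2 := norm_le_norm_add_norm_sub' w z
    rw [mem_ball_zero_iff]; linarith
  -- Cauchy's estimate on the circle of radius `R / 4` gives `2! * 2B / (R/4)² = 64 B / R²`.
  have hcauchy := norm_iteratedDeriv_le_of_forall_mem_sphere_norm_le 2 (by positivity)
    (((hφd.mono hsub).diffContOnCl_ball subset_rfl)) hφb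
  have hzb : z ∈ ball (0 : ℂ) R := by rw [mem_ball_zero_iff]; linarith
  have hderivφ : deriv φ =ᶠ[𝓝 z] logDeriv h := by
    filter_upwards [isOpen_ball.mem_nhds hzb] with w hw using (hφ w hw).deriv
  have hit : iteratedDeriv 2 φ z = deriv (logDeriv h) z := by
    rw [iteratedDeriv_succ, iteratedDeriv_one, hderivφ.deriv_eq]
  have hld2 : logDeriv f =ᶠ[𝓝 z]
      fun w => (∑ a ∈ s, (analyticOrderNatAt f a : ℂ) / (w - a)) + logDeriv h w := by
    filter_upwards [hf.continuous.continuousAt.eventually_ne hfz] with w hw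
    have hprod : ∀ a ∈ s, (w - a) ^ analyticOrderNatAt f a ≠ 0 := by
      have := hw
      rw [heq, mul_ne_zero_iff, Finset.prod_ne_zero_iff] at this
      exact this.1
    have hhw : h w ≠ 0 := fun h0 => hw (by rw [heq, h0, mul_zero])
    rw [show f = fun z => (∏ a ∈ s, (z - a) ^ analyticOrderNatAt f a) * h z from funext heq,
      logDeriv_mul w (Finset.prod_ne_zero_iff.2 hprod) hhw (by fun_prop) (hh w),
      logDeriv_prod hprod (by fun_prop)]
    rw [← show f = fun z => (∏ a ∈ s, (z - a) ^ analyticOrderNatAt f a) * h z from funext heq]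
    congr 1
    refine Finset.sum_congr rfl fun a _ => ?_
    rw [logDeriv_fun_pow (by fun_prop), logDeriv_apply]
    simp [div_eq_mul_inv]
  have hzne : ∀ a ∈ s, analyticOrderNatAt f a ≠ 0 → z - a ≠ 0 := by
    intro a _ hn hza
    rw [sub_eq_zero] at hza
    exact hn ((hf.analyticOrderNatAt_eq_zero_iff hf0 a).2 (hza ▸ hfz))
  have hsum : HasDerivAt (fun w => ∑ a ∈ s, (analyticOrderNatAt f a : ℂ) / (w - a))
      (∑ a ∈ s, -((analyticOrderNatAt f a : ℂ) / (z - a) ^ 2)) z := by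
    refine HasDerivAt.fun_sum fun a ha => ?_
    by_cases hn : analyticOrderNatAt f a = 0
    · simpa [hn] using hasDerivAt_const z (0 : ℂ)
    · have := ((hasDerivAt_id z).sub_const a).fun_inv (hzne a ha hn)
      have := this.const_mul (analyticOrderNatAt f a : ℂ)
      refine this.congr_deriv ?_
      simp only [id]; ring
  have hderiv : deriv (logDeriv f) z =
      (∑ a ∈ s, -((analyticOrderNatAt f a : ℂ) / (z - a) ^ 2)) + deriv (logDeriv h) z := by
    rw [hld2.deriv_eq]
    exact (hsum.add (hld.differentiableAt (isOpen_ball.mem_nhds hzb)).hasDerivAt).deriv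
  rw [hderiv, Finset.sum_neg_distrib, neg_add_eq_sub, sub_add_cancel, ← hit]
  refine hcauchy.trans_eq ?_
  norm_num [Nat.factorial]
  field_simp
  norm_num

/-! ### Entire functions of finite order: zero counting and partial fractions. -/

lemma Differentiable.finite_zeros_closedBall {f : ℂ → ℂ} (hf : Differentiable ℂ f) {b : ℂ}
    (hb : f b ≠ 0) (R : ℝ) : {a : ℂ | f a = 0 ∧ ‖a‖ ≤ R}.Finite := by
  have hA : AnalyticOnNhd ℂ f Set.univ := fun z _ => hf.analyticAt z
  have hc := mem_codiscrete'.1 (hA.preimage_zero_mem_codiscrete hb)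
  simp only [Set.preimage_compl, compl_compl] at hc
  have := (isCompact_closedBall (0 : ℂ) R).inter_right
    ((isClosed_singleton (x := (0 : ℂ))).preimage hf.continuous) |>.finite
    (hc.2.mono Set.inter_subset_right)
  refine this.subset fun a ha => ⟨by simpa using ha.2, by simpa using ha.1⟩

/-- Number of zeros in a disk for a function of finite order. -/
lemma Differentiable.exists_sum_order_le {f : ℂ → ℂ} (hf : Differentiable ℂ f) (hf0 : f 0 ≠ 0)
    {C β : ℝ} (hβ : 0 ≤ β) (hM : ∀ z, ‖f z‖ ≤ Real.exp (C * (1 + ‖z‖) ^ β)) :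
    ∃ D : ℝ, 0 ≤ D ∧ ∀ (s : Finset ℂ) (R : ℝ), 1 ≤ R → (∀ a ∈ s, ‖a‖ ≤ R) →
      ((∑ a ∈ s, analyticOrderNatAt f a : ℕ) : ℝ) ≤ D * R ^ β := by
  -- The growth bound is used on the circle of radius `4R`, where `1 + 4R ≤ 5R`; dividing by `log 3`
  -- undoes the `3 ^ N` of the counting bound.
  refine ⟨(max C 0 * 5 ^ β + |Real.log ‖f 0‖|) / Real.log 3,
    div_nonneg (by positivity) (Real.log_nonneg (by norm_num)), fun s R hR hs => ?_⟩
  have h0 : 0 < ‖f 0‖ := norm_pos_iff.2 hf0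
  have h := hf.three_pow_sum_order_le hf0 (s := s) (R := R) (M := Real.exp (max C 0 * (5 * R) ^ β))
    (by linarith) hs fun z hz => (hM z).trans (Real.exp_le_exp.2 (by
      gcongr
      · exact le_max_left _ _
      · linarith))
  rw [le_div_iff₀ h0] at h
  have h2 := Real.log_le_log (by positivity) h
  rw [Real.log_exp, Real.log_mul (by positivity) h0.ne', Real.log_pow] at h2
  have h3 : 0 < Real.log 3 := Real.log_pos (by norm_num)
  rw [div_mul_eq_mul_div, le_div_iff₀ h3]
  have h4 : (1 : ℝ) ≤ R ^ β := Real.one_le_rpow hR hβ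
  rw [Real.mul_rpow (by norm_num) (by linarith)] at h2
  have h5 : -Real.log ‖f 0‖ ≤ |Real.log ‖f 0‖| := neg_le_abs _
  have h6 : 0 ≤ |Real.log ‖f 0‖| := abs_nonneg _
  nlinarith

/-- The exponent of convergence of the zeros does not exceed the order. -/
lemma Differentiable.summable_order_mul_rpow {f : ℂ → ℂ} (hf : Differentiable ℂ f) (hf0 : f 0 ≠ 0)
    {C β α : ℝ} (hβ : 0 ≤ β) (hM : ∀ z, ‖f z‖ ≤ Real.exp (C * (1 + ‖z‖) ^ β)) (hα : β < α) :
    Summable fun a : ℂ => (analyticOrderNatAt f a : ℝ) * ‖a‖ ^ (-α) := by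
  obtain ⟨D, hD, hN⟩ := hf.exists_sum_order_le hf0 hβ hM
  -- Dyadic shells: `‖a‖` is replaced by the power `2 ^ l a` above it. Shell `k` then contributes at
  -- most `D * 2^(kβ) * 2^(-kα)`, a geometric term. The comparison `hl'` needs `‖a‖ > 1`; only
  -- finitely many zeros violate this.
  let l : ℂ → ℕ := fun a => Nat.clog 2 ⌈‖a‖⌉₊
  have hl : ∀ a, ‖a‖ ≤ 2 ^ l a := fun a =>
    (Nat.le_ceil _).trans (by exact_mod_cast Nat.le_pow_clog (by norm_num) _)
  have hl' : ∀ a, 1 < ‖a‖ → (2 : ℝ) ^ l a ≤ 2 * ‖a‖ := by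
    intro a ha
    have h1 : 1 < ⌈‖a‖⌉₊ := Nat.lt_ceil.2 (by simpa using ha)
    have h2 : 0 < l a := Nat.clog_pos (by norm_num) h1
    have h3 := Nat.pow_pred_clog_lt_self (b := 2) (by norm_num) h1
    rw [Nat.lt_ceil] at h3
    push_cast at h3
    calc (2 : ℝ) ^ l a = 2 * 2 ^ (l a).pred := by
          rw [← pow_succ', ← Nat.succ_eq_add_one, Nat.succ_pred_eq_of_pos h2]
      _ ≤ _ := by gcongr
  set q : ℝ := 2 ^ (β - α)
  have hq0 : 0 ≤ q := by positivity
  have hq1 : q < 1 := Real.rpow_lt_one_of_one_lt_of_neg (by norm_num) (by linarith)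
  have hS : Summable fun a : ℂ => (analyticOrderNatAt f a : ℝ) * ((2 : ℝ) ^ l a) ^ (-α) := by
    refine summable_of_sum_le (c := ∑' k : ℕ, D * q ^ k) (fun a => by positivity) fun s => ?_
    have hsum : Summable fun k : ℕ => D * q ^ k :=
      (summable_geometric_of_lt_one hq0 hq1).mul_left D
    classical
    rw [← Finset.sum_fiberwise_of_maps_to (t := s.image l) (g := l)
      (fun a ha => Finset.mem_image_of_mem l ha)]
    refine le_trans (Finset.sum_le_sum fun k _ => ?_)
      (hsum.sum_le_tsum (s.image l) fun k _ => by positivity)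
    have h1 : ∑ a ∈ s with l a = k, (analyticOrderNatAt f a : ℝ) * ((2 : ℝ) ^ l a) ^ (-α)
        = (∑ a ∈ s with l a = k, (analyticOrderNatAt f a : ℝ)) * ((2 : ℝ) ^ k) ^ (-α) := by
      rw [Finset.sum_mul]
      refine Finset.sum_congr rfl fun a ha => ?_
      rw [(Finset.mem_filter.1 ha).2]
    have h2 := hN {a ∈ s | l a = k} (2 ^ k) (one_le_pow₀ (by norm_num)) fun a ha => by
      rw [← (Finset.mem_filter.1 ha).2]; exact hl a
    push_cast at h2
    rw [h1]
    calc _ ≤ D * ((2 : ℝ) ^ k) ^ β * ((2 : ℝ) ^ k) ^ (-α) := by gcongr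
      _ = D * q ^ k := by
        rw [mul_assoc, ← Real.rpow_add (by positivity), ← Real.rpow_natCast_mul (by norm_num),
          ← Real.rpow_mul_natCast (by norm_num), sub_eq_add_neg, mul_comm (k : ℝ)]
  refine (hS.mul_left (2 ^ α)).of_norm_bounded_eventually ?_
  refine (hf.finite_zeros_closedBall hf0 1).subset fun a ha => ?_
  by_contra hcon
  refine ha ?_
  by_cases h0 : f a = 0
  · have h1 : 1 < ‖a‖ := by
      by_contra! h1
      exact hcon ⟨h0, h1⟩
    rw [Set.mem_ofPred_eq, Real.norm_of_nonneg (by positivity)]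
    have h2 : ‖a‖ ^ (-α) ≤ 2 ^ α * ((2 : ℝ) ^ l a) ^ (-α) := by
      rw [Real.rpow_neg (by positivity), Real.rpow_neg (by positivity), ← div_eq_mul_inv,
        le_div_iff₀ (by positivity), inv_mul_le_iff₀ (by positivity),
        ← Real.mul_rpow (by positivity) (by positivity), mul_comm]
      have := hl' a h1
      have := hβ.trans hα.le
      gcongr
    calc _ ≤ (analyticOrderNatAt f a : ℝ) * (2 ^ α * ((2 : ℝ) ^ l a) ^ (-α)) := by gcongr
      _ = _ := by ring
  · rw [Set.mem_ofPred_eq, (hf.analyticOrderNatAt_eq_zero_iff hf0 a).2 h0]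
    simp

/-- The partial fraction expansion of `(f' / f)'` for an entire function of order less than `2`. -/
lemma hasSum_order_div_sub_sq {f : ℂ → ℂ} (hf : Differentiable ℂ f) (hf0 : f 0 ≠ 0)
    {C β : ℝ} (hβ : 0 ≤ β) (hM : ∀ z, ‖f z‖ ≤ Real.exp (C * (1 + ‖z‖) ^ β)) (hβ2 : β < 2)
    {z : ℂ} (hz : f z ≠ 0) :
    HasSum (fun a : ℂ => (analyticOrderNatAt f a : ℂ) / (z - a) ^ 2) (-deriv (logDeriv f) z) := by
  have hsum : Summable fun a : ℂ => (analyticOrderNatAt f a : ℂ) / (z - a) ^ 2 := by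
    refine ((hf.summable_order_mul_rpow hf0 hβ hM hβ2).mul_left 4).of_norm_bounded_eventually ?_
    refine (hf.finite_zeros_closedBall hf0 (2 * ‖z‖)).subset fun a ha => ?_
    by_contra hcon
    refine ha ?_
    by_cases h0 : f a = 0
    · have h1 : 2 * ‖z‖ < ‖a‖ := by
        by_contra! h1
        exact hcon ⟨h0, h1⟩
      have ha0 : 0 < ‖a‖ := by linarith [norm_nonneg z]
      have h2 : ‖a‖ / 2 ≤ ‖z - a‖ := by
        have := norm_sub_norm_le a z
        rw [norm_sub_rev] at this
        linarith
      rw [Set.mem_ofPred_eq, norm_div, norm_pow, norm_natCast, Real.rpow_neg ha0.le, Real.rpow_two]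
      calc _ ≤ (analyticOrderNatAt f a : ℝ) / (‖a‖ / 2) ^ 2 := by gcongr
        _ = _ := by field_simp; norm_num
    · rw [Set.mem_ofPred_eq, (hf.analyticOrderNatAt_eq_zero_iff hf0 a).2 h0]
      simp
  have hfin := hf.finite_zeros_closedBall hf0
  let S : ℕ → Finset ℂ := fun n => (hfin n).toFinset
  have hmem : ∀ n a, a ∈ S n ↔ f a = 0 ∧ ‖a‖ ≤ n := fun n a => by simp [S]
  set T := ∑' a : ℂ, (analyticOrderNatAt f a : ℂ) / (z - a) ^ 2
  have hT : HasSum (fun a : ℂ => (analyticOrderNatAt f a : ℂ) / (z - a) ^ 2) T := hsum.hasSum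
  have hlim : Tendsto (fun n => ∑ a ∈ S n, (analyticOrderNatAt f a : ℂ) / (z - a) ^ 2)
      atTop (𝓝 T) := by
    have hsub : HasSum (fun a : {a : ℂ | f a = 0} => (analyticOrderNatAt f a : ℂ) / (z - a) ^ 2)
        T := by
      refine (hasSum_subtype_iff_of_support_subset
        (f := fun a : ℂ => (analyticOrderNatAt f a : ℂ) / (z - a) ^ 2) fun a ha => ?_).2 hT
      by_contra h0
      exact ha (by simp [(hf.analyticOrderNatAt_eq_zero_iff hf0 a).2 h0])
    classical
    have ht : Tendsto (fun n => (S n).subtype (· ∈ {a : ℂ | f a = 0})) atTop atTop := by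
      refine tendsto_atTop_finset_of_monotone (fun m n hmn a ha => ?_) fun a => ?_
      · rw [Finset.mem_subtype, hmem] at ha ⊢
        exact ⟨ha.1, ha.2.trans (by exact_mod_cast hmn)⟩
      · obtain ⟨n, hn⟩ := exists_nat_ge ‖(a : ℂ)‖
        exact ⟨n, by rw [Finset.mem_subtype, hmem]; exact ⟨a.2, hn⟩⟩
    refine (hsub.comp ht).congr fun n => ?_
    refine Finset.sum_subtype_of_mem
      (fun a : ℂ => (analyticOrderNatAt f a : ℂ) / (z - a) ^ 2) fun a ha => ((hmem n a).1 ha).1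
  have h0 : 0 < ‖f 0‖ := norm_pos_iff.2 hf0
  set A : ℝ := max C 0 * 5 ^ β + |Real.log ‖f 0‖| + 1
  have hA : 0 < A := by positivity
  -- With `R = n` and `B = A * n ^ β` the error `64 B / R²` is of size `n ^ (β - 2)`, which tends to
  -- `0` because `β < 2`.
  have hbound : ∀ᶠ n : ℕ in atTop,
      ‖deriv (logDeriv f) z + ∑ a ∈ S n, (analyticOrderNatAt f a : ℂ) / (z - a) ^ 2‖
        ≤ 64 * A * (n : ℝ) ^ (-(2 - β)) := by
    filter_upwards [eventually_ge_atTop (max 1 ⌈4 * ‖z‖⌉₊)] with n hn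
    have hn1 : (1 : ℝ) ≤ n := by exact_mod_cast (le_max_left _ _).trans hn
    have hn2 : 4 * ‖z‖ ≤ n := (Nat.le_ceil _).trans (by exact_mod_cast (le_max_right _ _).trans hn)
    have hn0 : (0 : ℝ) < n := by linarith
    have h4 : (1 : ℝ) ≤ (n : ℝ) ^ β := Real.one_le_rpow hn1 hβ
    have key := norm_deriv_logDeriv_add_sum_order_le hf hf0 (s := S n) (B := A * n ^ β) hn0
      (fun a ha => ((hmem n a).1 ha).2) (fun a h1 h2 => (hmem n a).2 ⟨h2, h1⟩) (by positivity)
      (fun w hw => by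
        refine (hM w).trans ?_
        conv_rhs => rw [← Real.exp_log h0, ← Real.exp_add]
        refine Real.exp_le_exp.2 ?_
        have h1 : C * (1 + ‖w‖) ^ β ≤ max C 0 * (5 * n) ^ β := by
          gcongr
          · exact le_max_left _ _
          · linarith
        rw [Real.mul_rpow (by norm_num) hn0.le] at h1
        have h5 : -Real.log ‖f 0‖ ≤ |Real.log ‖f 0‖| := neg_le_abs _
        have h6 : 0 ≤ |Real.log ‖f 0‖| := abs_nonneg _
        simp only [A]
        nlinarith) (by linarith) hz
    refine key.trans_eq ?_
    rw [neg_sub, Real.rpow_sub hn0, Real.rpow_two]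
    ring
  have hzero : Tendsto (fun n : ℕ => 64 * A * (n : ℝ) ^ (-(2 - β))) atTop (𝓝 0) := by
    simpa using ((tendsto_rpow_neg_atTop (by linarith : 0 < 2 - β)).comp
      tendsto_natCast_atTop_atTop).const_mul (64 * A)
  have hfinal := squeeze_zero_norm' hbound hzero
  have : deriv (logDeriv f) z + T = 0 :=
    tendsto_nhds_unique (hlim.const_add _) hfinal
  rwa [← eq_neg_of_add_eq_zero_right this]

end

section

open Complex Filter Topology MeasureTheory

/-! ### The function `ξ`: its zeros and their multiplicities. -/

/-- Riemann's `ξ` function, normalised by `ξ 0 = 1`. -/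
noncomputable def riemannXi (s : ℂ) : ℂ := s * (s - 1) * completedRiemannZeta₀ s + 1

@[fun_prop]
lemma differentiable_riemannXi : Differentiable ℂ riemannXi := by
  have := differentiable_completedZeta₀
  unfold riemannXi
  fun_prop

lemma riemannXi_one_sub (s : ℂ) : riemannXi (1 - s) = riemannXi s := by
  rw [riemannXi, riemannXi, completedRiemannZeta₀_one_sub]
  ring

lemma riemannXi_eq_mul_completedRiemannZeta {s : ℂ} (h0 : s ≠ 0) (h1 : s ≠ 1) :
    riemannXi s = s * (s - 1) * completedRiemannZeta s := by
  have h2 : 1 - s ≠ 0 := sub_ne_zero.2 h1.symm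
  rw [riemannXi, completedRiemannZeta_eq]
  field_simp
  ring

lemma riemannXi_eq_mul_riemannZeta {s : ℂ} (h0 : 0 < s.re) (h1 : s ≠ 1) :
    riemannXi s = s * (s - 1) * Gammaℝ s * riemannZeta s := by
  have hs : s ≠ 0 := fun h => by simp [h] at h0
  rw [riemannXi_eq_mul_completedRiemannZeta hs h1, riemannZeta_def_of_ne_zero hs]
  have := Gammaℝ_ne_zero_of_re_pos h0
  field_simp

lemma riemannXi_ne_zero_of_one_le_re {s : ℂ} (hs : 1 ≤ s.re) : riemannXi s ≠ 0 := by
  have h0 : 0 < s.re := by linarith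
  rcases eq_or_ne s 1 with rfl | h1
  · simp [riemannXi]
  · rw [riemannXi_eq_mul_riemannZeta h0 h1]
    have hs0 : s ≠ 0 := fun h => by simp [h] at h0
    exact mul_ne_zero (mul_ne_zero (mul_ne_zero hs0 (sub_ne_zero.2 h1))
      (Gammaℝ_ne_zero_of_re_pos h0)) (riemannZeta_ne_zero_of_one_le_re hs)

/-- `ζ` does not vanish on `re s ≥ 1`, and the functional equation reflects `re s ≤ 0` into that
half-plane. -/
lemma riemannXi_eq_zero_iff {s : ℂ} :
    riemannXi s = 0 ↔ riemannZeta s = 0 ∧ 0 < s.re ∧ s.re < 1 := by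
  constructor
  · intro h
    have h1 : s.re < 1 := by
      by_contra! h1
      exact riemannXi_ne_zero_of_one_le_re h1 h
    have h0 : 0 < s.re := by
      by_contra! h0
      exact riemannXi_ne_zero_of_one_le_re (s := 1 - s) (by simpa using h0)
        (by rw [riemannXi_one_sub, h])
    have hs1 : s ≠ 1 := fun h => by simp [h] at h1
    have hs0 : s ≠ 0 := fun h => by simp [h] at h0
    rw [riemannXi_eq_mul_riemannZeta h0 hs1] at h
    simpa [hs0, sub_ne_zero.2 hs1, Gammaℝ_ne_zero_of_re_pos h0, h0, h1] using h
  · rintro ⟨h, h0, h1⟩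
    have hs1 : s ≠ 1 := fun h => by simp [h] at h1
    rw [riemannXi_eq_mul_riemannZeta h0 hs1, h, mul_zero]

lemma analyticAt_Gammaℝ {s : ℂ} (h0 : 0 < s.re) : AnalyticAt ℂ Gammaℝ s := by
  have := (differentiable_Gammaℝ_inv.analyticAt s).inv (inv_ne_zero (Gammaℝ_ne_zero_of_re_pos h0))
  refine this.congr (Eventually.of_forall fun z => ?_)
  simp

lemma analyticOrderNatAt_riemannXi {s : ℂ} (h0 : 0 < s.re) (h1 : s ≠ 1) :
    analyticOrderNatAt riemannXi s = analyticOrderNatAt riemannZeta s := by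
  have hs0 : s ≠ 0 := fun h => by simp [h] at h0
  let u : ℂ → ℂ := fun z => z * (z - 1) * Gammaℝ z
  have hu : AnalyticAt ℂ u s :=
    AnalyticAt.mul (by fun_prop) (analyticAt_Gammaℝ h0)
  have hu0 : u s ≠ 0 :=
    mul_ne_zero (mul_ne_zero hs0 (sub_ne_zero.2 h1)) (Gammaℝ_ne_zero_of_re_pos h0)
  have heq : riemannXi =ᶠ[𝓝 s] u * riemannZeta := by
    filter_upwards [isOpen_ne.mem_nhds h1, (continuous_re.isOpen_preimage _ isOpen_Ioi).mem_nhds h0]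
      with z hz hz0 using riemannXi_eq_mul_riemannZeta hz0 hz
  rw [analyticOrderNatAt, analyticOrderNatAt, analyticOrderAt_congr heq,
    analyticOrderAt_mul hu (analyticOn_riemannZeta s h1), hu.analyticOrderAt_eq_zero.2 hu0, zero_add]

/-! ### Positivity of the theta kernel and absence of real zeros of `ξ`. -/

open HurwitzZeta in
/-- The kernel of which `completedRiemannZeta₀` is the Mellin transform. -/
noncomputable def xiKernel : ℝ → ℂ := (hurwitzEvenFEPair 0).f_modif

-- The kernel is nonnegative. For `t > 1` the theta series exceeds its `n = 0` term `1`; the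
-- functional equation transfers this to `t < 1`; at `t = 1` the kernel is `0` by definition.
open HurwitzZeta in
lemma xiKernel_eq_norm {t : ℝ} (ht : 0 < t) : xiKernel t = (‖xiKernel t‖ : ℂ) := by
  have hker : ∀ x : ℝ, 0 < x → 1 ≤ evenKernel 0 x := by
    intro x hx
    have := hasSum_int_evenKernel 0 hx
    have h2 := this.summable.sum_le_tsum {0} (fun _ _ => (Real.exp_pos _).le)
    rw [this.tsum_eq] at h2
    simpa using h2
  suffices ∃ r : ℝ, 0 ≤ r ∧ xiKernel t = r by
    obtain ⟨r, hr, h⟩ := this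
    rw [h, norm_real, Real.norm_of_nonneg hr]
  rcases lt_trichotomy 1 t with h | h | h
  · refine ⟨evenKernel 0 t - 1, by linarith [hker t ht], ?_⟩
    simp [xiKernel, WeakFEPair.f_modif, hurwitzEvenFEPair, h, h.le]
  · exact ⟨0, le_rfl, by simp [xiKernel, WeakFEPair.f_modif, h.symm]⟩
  · have h1 : 1 ≤ 1 / t := by rw [le_div_iff₀ ht]; linarith
    have hk := evenKernel_functional_equation 0 t
    rw [← evenKernel_eq_cosKernel_of_zero] at hk
    refine ⟨evenKernel 0 t - t ^ (-(1 / 2 : ℝ)), ?_, ?_⟩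
    · rw [hk, Real.rpow_neg ht.le, ← one_div, sub_nonneg]
      exact le_mul_of_one_le_right (by positivity) (hker _ (by positivity))
    · simp [xiKernel, WeakFEPair.f_modif, hurwitzEvenFEPair, h, h.le, ht]

lemma xiKernel_mellinConvergent (s : ℂ) : MellinConvergent xiKernel s :=
  ((HurwitzZeta.hurwitzEvenFEPair 0).isStrongFEPair_toStrongFEPair.hasMellin s).1

lemma completedRiemannZeta₀_eq_mellin (s : ℂ) :
    completedRiemannZeta₀ s = mellin xiKernel (s / 2) / 2 := by
  rfl

/-- The Mellin transform of `‖xiKernel‖`, normalised as `completedRiemannZeta₀`. -/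
noncomputable def xiMellin (x : ℝ) : ℝ :=
  (∫ t in Set.Ioi (0 : ℝ), t ^ (x / 2 - 1) * ‖xiKernel t‖) / 2

lemma integrableOn_xiMellin (x : ℝ) :
    IntegrableOn (fun t : ℝ => t ^ (x / 2 - 1) * ‖xiKernel t‖) (Set.Ioi 0) := by
  have : IntegrableOn (fun t : ℝ => ‖(t : ℂ) ^ ((x / 2 : ℂ) - 1) • xiKernel t‖) (Set.Ioi 0) :=
    (xiKernel_mellinConvergent (x / 2 : ℂ)).norm
  refine this.congr_fun (fun t ht => ?_) measurableSet_Ioi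
  simp only [norm_smul]
  rw [norm_cpow_eq_rpow_re_of_pos ht]
  simp

lemma norm_completedRiemannZeta₀_le (s : ℂ) : ‖completedRiemannZeta₀ s‖ ≤ xiMellin s.re := by
  rw [completedRiemannZeta₀_eq_mellin, norm_div, xiMellin, Complex.norm_ofNat, mellin]
  gcongr
  refine (norm_integral_le_integral_norm _).trans_eq ?_
  refine setIntegral_congr_fun measurableSet_Ioi fun t ht => ?_
  simp only [norm_smul]
  rw [norm_cpow_eq_rpow_re_of_pos ht]
  simp

lemma completedRiemannZeta₀_ofReal (x : ℝ) : completedRiemannZeta₀ x = xiMellin x := by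
  rw [completedRiemannZeta₀_eq_mellin, xiMellin, mellin]
  push_cast
  congr 1
  rw [← integral_complex_ofReal]
  refine setIntegral_congr_fun measurableSet_Ioi fun t ht => ?_
  simp only [smul_eq_mul]
  rw [xiKernel_eq_norm ht]
  push_cast
  rw [ofReal_cpow (le_of_lt ht)]
  simp

lemma xiMellin_nonneg (x : ℝ) : 0 ≤ xiMellin x :=
  (norm_nonneg _).trans (norm_completedRiemannZeta₀_le x)

/-- Convexity of the Mellin transform: weighted AM–GM applied to `t^(x/2) = 1^(1-x) * (t^(1/2))^x`
under the integral. -/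
lemma xiMellin_le_of_mem_Icc {x : ℝ} (hx : x ∈ Set.Icc (0 : ℝ) 1) :
    xiMellin x ≤ (1 - x) * xiMellin 0 + x * xiMellin 1 := by
  simp only [xiMellin]
  rw [← mul_div_assoc, ← mul_div_assoc, ← add_div, ← integral_const_mul, ← integral_const_mul,
    ← integral_add ((integrableOn_xiMellin 0).const_mul _) ((integrableOn_xiMellin 1).const_mul _)]
  gcongr 1
  refine setIntegral_mono_on (integrableOn_xiMellin x)
    (((integrableOn_xiMellin 0).const_mul _).add ((integrableOn_xiMellin 1).const_mul _))
    measurableSet_Ioi fun t (ht : 0 < t) => ?_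
  have h := Real.geom_mean_le_arith_mean2_weighted (w₁ := 1 - x) (w₂ := x) (p₁ := 1)
    (p₂ := t ^ (1 / 2 : ℝ)) (by linarith [hx.2]) hx.1 zero_le_one (by positivity) (by ring)
  rw [Real.one_rpow, one_mul, ← Real.rpow_mul ht.le] at h
  have e1 : t ^ (x / 2 - 1) = t ^ (1 / 2 * x) * t⁻¹ := by
    rw [Real.rpow_sub_one ht.ne', div_eq_mul_inv, div_eq_inv_mul, one_div]
  have e2 : t ^ ((0 : ℝ) / 2 - 1) = t⁻¹ := by
    rw [zero_div, zero_sub, Real.rpow_neg_one]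
  have e3 : t ^ ((1 : ℝ) / 2 - 1) = t ^ (1 / 2 : ℝ) * t⁻¹ := by
    rw [Real.rpow_sub_one ht.ne', div_eq_mul_inv]
  rw [e1, e2, e3]
  have h2 : 0 ≤ t⁻¹ * ‖xiKernel t‖ := by positivity
  nlinarith [mul_le_mul_of_nonneg_right h h2]

lemma xiMellin_le_add {x : ℝ} (h0 : 1 / 2 ≤ x) (h1 : x ≤ 2) :
    xiMellin x ≤ xiMellin (1 / 2) + xiMellin 2 := by
  simp only [xiMellin]
  rw [← add_div, ← integral_add (integrableOn_xiMellin _) (integrableOn_xiMellin _)]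
  gcongr 1
  refine setIntegral_mono_on (integrableOn_xiMellin x)
    ((integrableOn_xiMellin _).add (integrableOn_xiMellin _))
    measurableSet_Ioi fun t (ht : 0 < t) => ?_
  rw [← add_mul]
  gcongr
  rcases le_total t 1 with h | h
  · have := Real.rpow_le_rpow_of_exponent_ge ht h (show (1 / 2 : ℝ) / 2 - 1 ≤ x / 2 - 1 by linarith)
    exact le_add_of_le_of_nonneg this (by positivity)
  · have := Real.rpow_le_rpow_of_exponent_le h (show x / 2 - 1 ≤ (2 : ℝ) / 2 - 1 by linarith)
    exact le_add_of_nonneg_of_le (by positivity) this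

/-- The value at `1` is explicit, `(γ - log 4π) / 2 + 1`, and crude bounds on `γ` and `π` suffice.
-/
lemma xiMellin_one_lt : xiMellin 1 < 2 := by
  have h : ((xiMellin 1 : ℝ) : ℂ) =
      (((Real.eulerMascheroniConstant - Real.log (4 * Real.pi)) / 2 + 1 : ℝ) : ℂ) := by
    rw [← completedRiemannZeta₀_ofReal, ofReal_one, completedRiemannZeta₀_one]
    push_cast
    rw [ofReal_log (by positivity)]
    push_cast
    rfl
  rw [ofReal_inj.1 h]
  have h1 := Real.eulerMascheroniConstant_lt_two_thirds
  have h2 : 0 ≤ Real.log (4 * Real.pi) := Real.log_nonneg (by linarith [Real.pi_gt_three])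
  linarith

lemma xiMellin_zero : xiMellin 0 = xiMellin 1 := by
  rw [← ofReal_inj, ← completedRiemannZeta₀_ofReal, ← completedRiemannZeta₀_ofReal, ofReal_zero,
    ofReal_one, ← completedRiemannZeta₀_one_sub, sub_zero]

/-- `ξ` has no real zeros; equivalently `ζ` has no zeros in `(0, 1)`. -/
lemma riemannXi_ofReal_ne_zero (x : ℝ) : riemannXi x ≠ 0 := by
  intro h
  obtain ⟨-, h0, h1⟩ := riemannXi_eq_zero_iff.1 h
  rw [ofReal_re] at h0 h1
  rw [riemannXi, completedRiemannZeta₀_ofReal] at h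
  have h' : x * (x - 1) * xiMellin x + 1 = 0 := by exact_mod_cast h
  have h2 := xiMellin_le_of_mem_Icc (x := x) ⟨h0.le, h1.le⟩
  rw [xiMellin_zero] at h2
  have h3 := xiMellin_one_lt
  have h4 := xiMellin_nonneg x
  -- Since `x * (1 - x) ≤ 1/4` and `xiMellin x < 2`, the product cannot reach `-1`.
  nlinarith [sq_nonneg (x - 1 / 2)]

/-! ### Growth of `ξ`. -/

/-- A weak form of Stirling: by convexity `Γ y ≤ n! ≤ n ^ n` with `n = ⌈y⌉`, and `log n ≤ n ^ ε /
ε`. -/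
lemma Real.Gamma_le_exp_rpow {y ε : ℝ} (hy : 1 ≤ y) (hε : 0 < ε) :
    Real.Gamma y ≤ Real.exp ((y + 1) ^ (1 + ε) / ε) := by
  set n := ⌈y⌉₊
  have hn : y ≤ n := Nat.le_ceil y
  have hn' : (n : ℝ) ≤ y + 1 := (Nat.ceil_lt_add_one (by linarith)).le
  have hn0 : (0 : ℝ) < n := by linarith
  have h1 := Real.convexOn_Gamma.le_max_of_mem_Icc (x := 1) (y := (n : ℝ) + 1) (z := y)
    (by simp) (by simp only [Set.mem_Ioi]; positivity) ⟨hy, by linarith⟩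
  rw [Real.Gamma_one, Real.Gamma_nat_eq_factorial,
    max_eq_right (by exact_mod_cast Nat.one_le_iff_ne_zero.2 (Nat.factorial_ne_zero n))] at h1
  refine h1.trans ?_
  have h2 : ((n.factorial : ℕ) : ℝ) ≤ (n : ℝ) ^ n := by exact_mod_cast Nat.factorial_le_pow n
  refine h2.trans ?_
  rw [← Real.rpow_natCast, Real.rpow_def_of_pos hn0, mul_comm]
  refine Real.exp_le_exp.2 ?_
  have h3 := Real.log_le_rpow_div hn0.le hε
  calc (n : ℝ) * Real.log n ≤ n * ((n : ℝ) ^ ε / ε) := by gcongr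
    _ = (n : ℝ) ^ (1 + ε) / ε := by rw [Real.rpow_add hn0, Real.rpow_one]; ring
    _ ≤ _ := by gcongr

/-- On `[1/2, 2]` the two endpoints dominate. Beyond `2` the value is `π^(-x/2) Γ(x/2) ζ(x)` plus
the polar terms `1/x + 1/(1-x)`, so only the Gamma factor grows. -/
lemma exists_xiMellin_le {ε : ℝ} (hε : 0 < ε) :
    ∃ c : ℝ, 0 ≤ c ∧ ∀ x : ℝ, 1 / 2 ≤ x → xiMellin x ≤ c * Real.exp ((x + 1) ^ (1 + ε) / ε) := by
  set c2 : ℝ := ∑' n : ℕ, 1 / (n : ℝ) ^ (2 : ℝ)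
  have hs2 : Summable fun n : ℕ => 1 / (n : ℝ) ^ (2 : ℝ) := Real.summable_one_div_nat_rpow.2 (by norm_num)
  have hc2 : 0 ≤ c2 := tsum_nonneg fun n => by positivity
  have hA := xiMellin_nonneg (1 / 2)
  have hB := xiMellin_nonneg 2
  refine ⟨xiMellin (1 / 2) + xiMellin 2 + c2 + 2, by positivity, fun x hx => ?_⟩
  have hexp : 1 ≤ Real.exp ((x + 1) ^ (1 + ε) / ε) := Real.one_le_exp (by positivity)
  rcases le_total x 2 with h | h
  · have := xiMellin_le_add hx h
    nlinarith
  · have hx0 : (x : ℂ) ≠ 0 := by exact_mod_cast (by linarith : x ≠ 0)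
    have h1 : ‖completedRiemannZeta x‖ ≤ Real.Gamma (x / 2) * c2 := by
      rw [completedZeta_eq_tsum_of_one_lt_re (by rw [ofReal_re]; linarith), norm_mul, norm_mul]
      have e1 : ‖(Real.pi : ℂ) ^ (-(x : ℂ) / 2)‖ ≤ 1 := by
        rw [norm_cpow_eq_rpow_re_of_pos Real.pi_pos]
        refine Real.rpow_le_one_of_one_le_of_nonpos (by linarith [Real.pi_gt_three]) ?_
        rw [← ofReal_neg, ← ofReal_ofNat, ← ofReal_div, ofReal_re]
        linarith
      have e2 : ‖Gamma ((x : ℂ) / 2)‖ = Real.Gamma (x / 2) := by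
        rw [← ofReal_ofNat, ← ofReal_div, Gamma_ofReal, norm_real,
          Real.norm_of_nonneg (Real.Gamma_nonneg_of_nonneg (by linarith))]
      have e3 : ‖∑' n : ℕ, 1 / (n : ℂ) ^ (x : ℂ)‖ ≤ c2 := by
        refine tsum_of_norm_bounded hs2.hasSum fun n => ?_
        rcases Nat.eq_zero_or_pos n with rfl | hn
        · simp [hx0]
        · rw [norm_div, norm_one, norm_natCast_cpow_of_pos hn, ofReal_re]
          have : (1 : ℝ) ≤ n := by exact_mod_cast hn
          gcongr
      rw [e2]
      have := Real.Gamma_nonneg_of_nonneg (show 0 ≤ x / 2 by linarith)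
      calc _ ≤ 1 * Real.Gamma (x / 2) * c2 := by gcongr
        _ = _ := by ring
    have h2 : xiMellin x ≤ Real.Gamma (x / 2) * c2 + 2 := by
      have e := completedRiemannZeta_eq x
      have e' : ((xiMellin x : ℝ) : ℂ) = completedRiemannZeta x + ((1 / x + 1 / (1 - x) : ℝ) : ℂ) := by
        rw [← completedRiemannZeta₀_ofReal, e]; push_cast; ring
      have e3 : ‖((xiMellin x : ℝ) : ℂ)‖ = xiMellin x := by
        rw [norm_real, Real.norm_of_nonneg (xiMellin_nonneg x)]
      rw [← e3, e']
      refine (norm_add_le _ _).trans (add_le_add h1 ?_)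
      rw [norm_real, Real.norm_eq_abs, abs_le]
      have e4 : 1 / x ≤ 1 := by rw [div_le_one (by linarith)]; linarith
      have e5 : 0 < 1 / x := by positivity
      have e6 : 1 / (1 - x) = -(1 / (x - 1)) := by rw [← neg_sub, div_neg]
      have e7 : 1 / (x - 1) ≤ 1 := by rw [div_le_one (by linarith)]; linarith
      have e8 : 0 < 1 / (x - 1) := one_div_pos.2 (by linarith)
      constructor <;> linarith
    have h3 : Real.Gamma (x / 2) ≤ Real.exp ((x + 1) ^ (1 + ε) / ε) := by
      refine (Real.Gamma_le_exp_rpow (by linarith) hε).trans (Real.exp_le_exp.2 ?_)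
      have : x / 2 + 1 ≤ x + 1 := by linarith
      gcongr
    nlinarith

/-- `ξ` has order one. -/
lemma exists_norm_riemannXi_le {β : ℝ} (hβ : 1 < β) :
    ∃ C : ℝ, ∀ z : ℂ, ‖riemannXi (1 / 2 + z)‖ ≤ Real.exp (C * (1 + ‖z‖) ^ β) := by
  obtain ⟨c, hc, hbound⟩ := exists_xiMellin_le (ε := β - 1) (by linarith)
  rw [add_sub_cancel] at hbound
  -- The half-plane `re z ≥ 0` suffices, as `ξ(1/2 + z)` is even. There the values on a vertical
  -- line are dominated by the real point, and `1/2 + re z + 1 ≤ 2 (1 + ‖z‖)`.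
  have key : ∀ z : ℂ, 0 ≤ z.re → ‖riemannXi (1 / 2 + z)‖ ≤
      Real.exp ((Real.log (c + 1) + 2 + 2 ^ β / (β - 1)) * (1 + ‖z‖) ^ β) := by
    intro z hz
    set r := 1 + ‖z‖
    have hr : 1 ≤ r := by simp [r]
    have hre : (1 / 2 + z).re = 1 / 2 + z.re := by simp
    have h1 : ‖completedRiemannZeta₀ (1 / 2 + z)‖ ≤ c * Real.exp ((2 * r) ^ β / (β - 1)) := by
      refine (norm_completedRiemannZeta₀_le _).trans ?_
      rw [hre]
      refine (hbound _ (by linarith)).trans ?_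
      have := re_le_norm z
      have : 0 < β - 1 := by linarith
      gcongr
      simp only [r]
      linarith [norm_nonneg z]
    have h2 : ‖(1 / 2 + z)‖ ≤ r := by
      refine (norm_add_le _ _).trans ?_
      norm_num [r]
    have h3 : ‖(1 / 2 + z - 1)‖ ≤ r := by
      rw [show 1 / 2 + z - 1 = -(1 / 2) + z by ring]
      refine (norm_add_le _ _).trans ?_
      norm_num [r]
    have hE : 1 ≤ Real.exp ((2 * r) ^ β / (β - 1)) :=
      Real.one_le_exp (div_nonneg (by positivity) (by linarith))
    have h4 : ‖riemannXi (1 / 2 + z)‖ ≤ (c + 1) * (r ^ 2 * Real.exp ((2 * r) ^ β / (β - 1))) := by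
      rw [riemannXi]
      refine (norm_add_le _ _).trans ?_
      rw [norm_mul, norm_mul, norm_one]
      have : ‖(1 / 2 + z)‖ * ‖(1 / 2 + z - 1)‖ * ‖completedRiemannZeta₀ (1 / 2 + z)‖ ≤
          r * r * (c * Real.exp ((2 * r) ^ β / (β - 1))) := by gcongr
      nlinarith [one_le_pow₀ hr (n := 2), mul_le_mul (one_le_pow₀ hr (n := 2)) hE (by norm_num) (by positivity)]
    refine h4.trans ?_
    have hrβ : r ≤ r ^ β := Real.self_le_rpow_of_one_le hr hβ.le
    have hr2 : r ^ 2 ≤ Real.exp (2 * r ^ β) := by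
      have : r ≤ Real.exp (r ^ β) := by linarith [Real.add_one_le_exp (r ^ β)]
      calc r ^ 2 ≤ Real.exp (r ^ β) ^ 2 := by gcongr
        _ = _ := by rw [← Real.exp_nat_mul, Nat.cast_two]
    have hc1 : c + 1 ≤ Real.exp (Real.log (c + 1) * r ^ β) := by
      conv_lhs => rw [← Real.exp_log (by linarith : 0 < c + 1)]
      refine Real.exp_le_exp.2 (le_mul_of_one_le_right (Real.log_nonneg (by linarith)) ?_)
      linarith
    rw [Real.mul_rpow (by norm_num) (by linarith)] at *
    calc _ ≤ Real.exp (Real.log (c + 1) * r ^ β) *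
          (Real.exp (2 * r ^ β) * Real.exp (2 ^ β * r ^ β / (β - 1))) := by gcongr
      _ = _ := by rw [← Real.exp_add, ← Real.exp_add]; ring_nf
  refine ⟨Real.log (c + 1) + 2 + 2 ^ β / (β - 1), fun z => ?_⟩
  rcases le_total 0 z.re with h | h
  · exact key z h
  · have := key (-z) (by simpa using h)
    rw [norm_neg, ← riemannXi_one_sub] at this
    convert this using 3
    ring

/-! ### Mellin transforms of double poles. -/

lemma image_div_add_one_Ioi : (fun t : ℝ => t / (t + 1)) '' Set.Ioi 0 = Set.Ioo 0 1 := by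
  ext x
  constructor
  · rintro ⟨t, ht : 0 < t, rfl⟩
    exact ⟨by positivity, by rw [div_lt_one (by linarith)]; linarith⟩
  · rintro ⟨h0, h1⟩
    have : 0 < 1 - x := by linarith
    refine ⟨x / (1 - x), by simp only [Set.mem_Ioi]; positivity, ?_⟩
    field_simp
    ring

/-- The Beta integral over the half-line. -/
lemma hasMellin_one_div_add_one_sq {u : ℂ} (h0 : 0 < u.re) (h2 : u.re < 2) :
    HasMellin (fun t : ℝ => 1 / ((t : ℂ) + 1) ^ 2) u (Gamma u * Gamma (2 - u)) := by
  have hd : ∀ t ∈ Set.Ioi (0 : ℝ), HasDerivWithinAt (fun t : ℝ => t / (t + 1)) (1 / (t + 1) ^ 2)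
      (Set.Ioi 0) t := by
    intro t (ht : 0 < t)
    have := (hasDerivAt_id t).fun_div ((hasDerivAt_id t).add_const 1) (by simp only [id]; positivity)
    refine (this.congr_deriv ?_).hasDerivWithinAt
    simp only [id]
    congr 1
    ring
  have hinj : Set.InjOn (fun t : ℝ => t / (t + 1)) (Set.Ioi 0) := by
    intro s (hs : 0 < s) t (ht : 0 < t) h
    simp only at h
    field_simp at h
    linarith
  -- Under `x = t / (t + 1)` the integral becomes the Beta integral `B(u, 2 - u)`, whose denominator
  -- is `Γ(2) = 1`.
  let g : ℝ → ℂ := fun x => (x : ℂ) ^ (u - 1) * (1 - (x : ℂ)) ^ ((2 - u) - 1)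
  have hg : Set.EqOn (fun t : ℝ => |1 / (t + 1) ^ 2| • g (t / (t + 1)))
      (fun t : ℝ => (t : ℂ) ^ (u - 1) • (1 / ((t : ℂ) + 1) ^ 2)) (Set.Ioi 0) := by
    intro t (ht : 0 < t)
    have h1 : 0 < t + 1 := by linarith
    have h1c : (t : ℂ) + 1 ≠ 0 := by exact_mod_cast h1.ne'
    have e1 : (1 : ℂ) - ((t / (t + 1) : ℝ) : ℂ) = (((t + 1)⁻¹ : ℝ) : ℂ) := by
      push_cast; field_simp; ring
    simp only [g]
    rw [abs_of_nonneg (by positivity), e1, div_eq_mul_inv t, ofReal_mul,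
      mul_cpow_ofReal_nonneg ht.le (by positivity), real_smul, smul_eq_mul, mul_assoc,
      ← cpow_add _ _ (by exact_mod_cast (inv_pos.2 h1).ne')]
    rw [show u - 1 + (2 - u - 1) = 0 by ring, cpow_zero]
    push_cast
    ring
  have hint : IntegrableOn g (Set.Ioo 0 1) := by
    have := betaIntegral_convergent h0 (v := 2 - u) (by simpa using h2)
    rw [intervalIntegrable_iff_integrableOn_Ioo_of_le zero_le_one] at this
    exact this
  refine ⟨?_, ?_⟩
  · rw [← image_div_add_one_Ioi, integrableOn_image_iff_integrableOn_abs_deriv_smul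
      measurableSet_Ioi hd hinj] at hint
    exact hint.congr_fun hg measurableSet_Ioi
  · have := integral_image_eq_integral_abs_deriv_smul measurableSet_Ioi hd hinj g
    rw [image_div_add_one_Ioi, setIntegral_congr_fun measurableSet_Ioi hg] at this
    rw [mellin, ← this, ← integral_Ioc_eq_integral_Ioo, ← intervalIntegral.integral_of_le zero_le_one]
    have hb := betaIntegral_eq_Gamma_mul_div u (2 - u) h0 (by simpa using h2)
    rw [betaIntegral] at hb
    rw [hb, add_sub_cancel]
    simp

lemma hasMellin_one_div_add_ofReal_sq {u : ℂ} (h0 : 0 < u.re) (h2 : u.re < 2) {a : ℝ}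
    (ha : 0 < a) :
    HasMellin (fun t : ℝ => 1 / ((t : ℂ) + a) ^ 2) u ((a : ℂ) ^ (u - 2) * (Gamma u * Gamma (2 - u))) := by
  have hac : (a : ℂ) ≠ 0 := by exact_mod_cast ha.ne'
  have h1 := hasMellin_one_div_add_one_sq h0 h2
  have e : (fun t : ℝ => 1 / ((t : ℂ) + a) ^ 2) =
      fun t : ℝ => ((a : ℂ) ^ 2)⁻¹ • (fun t : ℝ => 1 / ((t : ℂ) + 1) ^ 2) (a⁻¹ * t) := by
    ext t
    simp only [smul_eq_mul]
    rw [one_div, one_div, ← mul_inv, ← mul_pow]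
    push_cast
    congr 2
    field_simp
  have hc : MellinConvergent (fun t : ℝ => (fun t : ℝ => 1 / ((t : ℂ) + 1) ^ 2) (a⁻¹ * t)) u :=
    (MellinConvergent.comp_mul_left (inv_pos.2 ha)).2 h1.1
  have h3 := hasMellin_const_smul hc (((a : ℂ) ^ 2)⁻¹)
  rw [← e, mellin_comp_mul_left (fun t : ℝ => 1 / ((t : ℂ) + 1) ^ 2) _ (inv_pos.2 ha), h1.2] at h3
  convert h3 using 1
  have e2 : ((a⁻¹ : ℝ) : ℂ) ^ (-u) = (a : ℂ) ^ u := by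
    rw [ofReal_inv, inv_cpow _ _ (by rw [arg_ofReal_of_nonneg ha.le]; exact Real.pi_pos.ne),
      cpow_neg, inv_inv]
  rw [e2, smul_eq_mul, smul_eq_mul, cpow_sub _ _ hac, cpow_ofNat]
  ring

lemma integral_rpow_div_add_sq {x r : ℝ} (h0 : 0 < x) (h2 : x < 2) (hr : 0 < r) :
    IntegrableOn (fun t : ℝ => t ^ (x - 1) / (t + r) ^ 2) (Set.Ioi 0) ∧
      ∫ t in Set.Ioi (0 : ℝ), t ^ (x - 1) / (t + r) ^ 2 =
        r ^ (x - 2) * (Real.Gamma x * Real.Gamma (2 - x)) := by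
  have h := hasMellin_one_div_add_ofReal_sq (u := x) (by simpa) (by simpa) hr
  have e : Set.EqOn (fun t : ℝ => (t : ℂ) ^ ((x : ℂ) - 1) • (1 / ((t : ℂ) + r) ^ 2))
      (fun t : ℝ => ((t ^ (x - 1) / (t + r) ^ 2 : ℝ) : ℂ)) (Set.Ioi 0) := by
    intro t (ht : 0 < t)
    simp only [smul_eq_mul]
    push_cast
    rw [ofReal_cpow ht.le, mul_one_div]
    push_cast
    rfl
  constructor
  · have h1 : IntegrableOn (fun t : ℝ => (t : ℂ) ^ ((x : ℂ) - 1) • (1 / ((t : ℂ) + r) ^ 2))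
      (Set.Ioi 0) := h.1
    have h2 : Integrable (fun t : ℝ => ((t ^ (x - 1) / (t + r) ^ 2 : ℝ) : ℂ))
      (volume.restrict (Set.Ioi 0)) := h1.congr_fun e measurableSet_Ioi
    exact h2.re
  · rw [← ofReal_inj, ← integral_complex_ofReal, ← setIntegral_congr_fun measurableSet_Ioi e]
    refine h.2.trans ?_
    push_cast
    rw [ofReal_cpow hr.le, ← Gamma_ofReal, ← Gamma_ofReal]
    push_cast
    rfl

/-- The sine of half the angle between `a` and the negative real axis, squared. -/
noncomputable def slitDist (a : ℂ) : ℝ := (1 + a.re / ‖a‖) / 2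

lemma slitDist_pos {a : ℂ} (ha : a ∈ slitPlane) : 0 < slitDist a := by
  have h0 : 0 < ‖a‖ := norm_pos_iff.2 (slitPlane_ne_zero ha)
  have h1 : -‖a‖ < a.re := by
    rcases ha with h | h
    · linarith
    · have h3 := abs_re_lt_norm.2 h
      linarith [neg_abs_le a.re]
  have : -1 < a.re / ‖a‖ := by rw [lt_div_iff₀ h0]; linarith
  unfold slitDist
  linarith

lemma slitDist_le_one (a : ℂ) : slitDist a ≤ 1 := by
  have : a.re / ‖a‖ ≤ 1 := div_le_one_of_le₀ (re_le_norm a) (norm_nonneg a)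
  unfold slitDist
  linarith

/-- With `δ = slitDist a` one has `‖t + a‖² = δ (t + ‖a‖)² + (1 - δ) (t - ‖a‖)²`, and `δ² ≤ δ`. This
reduces complex `a` to the positive number `‖a‖` at the cost of a factor. -/
lemma slitDist_mul_le_norm_add {a : ℂ} (ha : a ∈ slitPlane) (t : ℝ) :
    slitDist a * (t + ‖a‖) ≤ ‖(t : ℂ) + a‖ := by
  have h0 : 0 < ‖a‖ := norm_pos_iff.2 (slitPlane_ne_zero ha)
  have hd := slitDist_pos ha
  have hd1 := slitDist_le_one a
  have hre : a.re = (2 * slitDist a - 1) * ‖a‖ := by unfold slitDist; field_simp; ring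
  refine le_of_sq_le_sq ?_ (norm_nonneg _)
  have h1 : ‖(t : ℂ) + a‖ ^ 2 = t ^ 2 + 2 * t * a.re + ‖a‖ ^ 2 := by
    rw [Complex.sq_norm, Complex.sq_norm, normSq_apply, normSq_apply]
    simp
    ring
  rw [h1, hre, mul_pow]
  have h2 : slitDist a ^ 2 ≤ slitDist a := by nlinarith
  nlinarith [mul_le_mul_of_nonneg_right h2 (sq_nonneg (t + ‖a‖)),
    mul_nonneg (sub_nonneg.2 hd1) (sq_nonneg (t - ‖a‖))]

lemma ofReal_add_ne_zero_of_mem_slitPlane {a : ℂ} (ha : a ∈ slitPlane) {t : ℝ} (ht : 0 < t) :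
    (t : ℂ) + a ≠ 0 := by
  have h0 : 0 < ‖a‖ := norm_pos_iff.2 (slitPlane_ne_zero ha)
  have := slitDist_mul_le_norm_add ha t
  have h1 := mul_pos (slitDist_pos ha) (add_pos ht h0)
  exact norm_pos_iff.1 (h1.trans_le this)

lemma norm_cpow_div_add_sq_le {u a : ℂ} (ha : a ∈ slitPlane) {t : ℝ} (ht : 0 < t) :
    ‖(t : ℂ) ^ (u - 1) • (1 / ((t : ℂ) + a) ^ 2)‖ ≤
      (slitDist a ^ 2)⁻¹ * (t ^ (u.re - 1) / (t + ‖a‖) ^ 2) := by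
  have h0 : 0 < ‖a‖ := norm_pos_iff.2 (slitPlane_ne_zero ha)
  have hd := slitDist_pos ha
  rw [norm_smul, norm_cpow_eq_rpow_re_of_pos ht, norm_div, norm_one, norm_pow, sub_re, one_re]
  have h := slitDist_mul_le_norm_add ha t
  calc _ ≤ t ^ (u.re - 1) * (1 / (slitDist a * (t + ‖a‖)) ^ 2) := by gcongr
    _ = _ := by rw [mul_pow]; field_simp

lemma continuousOn_cpow_div_add_sq {u a : ℂ} (ha : a ∈ slitPlane) :
    ContinuousOn (fun t : ℝ => (t : ℂ) ^ (u - 1) • (1 / ((t : ℂ) + a) ^ 2)) (Set.Ioi 0) := by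
  intro t (ht : 0 < t)
  refine ContinuousAt.continuousWithinAt (ContinuousAt.fun_smul ?_ ?_)
  · exact continuousAt_ofReal_cpow_const _ _ (Or.inr ht.ne')
  · exact continuousAt_const.div (by fun_prop)
      (pow_ne_zero _ (ofReal_add_ne_zero_of_mem_slitPlane ha ht))

lemma mellinConvergent_one_div_add_sq {u : ℂ} (h0 : 0 < u.re) (h2 : u.re < 2) {a : ℂ}
    (ha : a ∈ slitPlane) : MellinConvergent (fun t : ℝ => 1 / ((t : ℂ) + a) ^ 2) u := by
  have hr : 0 < ‖a‖ := norm_pos_iff.2 (slitPlane_ne_zero ha)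
  refine Integrable.mono' ((integral_rpow_div_add_sq h0 h2 hr).1.const_mul (slitDist a ^ 2)⁻¹)
    ((continuousOn_cpow_div_add_sq ha).aestronglyMeasurable measurableSet_Ioi) ?_
  exact (ae_restrict_iff' measurableSet_Ioi).2 (Eventually.of_forall fun _ ht =>
    norm_cpow_div_add_sq_le ha ht)

lemma integral_norm_cpow_div_add_sq_le {u : ℂ} (h0 : 0 < u.re) (h2 : u.re < 2) {a : ℂ}
    (ha : a ∈ slitPlane) :
    ∫ t in Set.Ioi (0 : ℝ), ‖(t : ℂ) ^ (u - 1) • (1 / ((t : ℂ) + a) ^ 2)‖ ≤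
      (slitDist a ^ 2)⁻¹ * (‖a‖ ^ (u.re - 2) * (Real.Gamma u.re * Real.Gamma (2 - u.re))) := by
  have hr : 0 < ‖a‖ := norm_pos_iff.2 (slitPlane_ne_zero ha)
  have h := integral_rpow_div_add_sq h0 h2 hr
  rw [← h.2, ← integral_const_mul]
  exact setIntegral_mono_on (mellinConvergent_one_div_add_sq h0 h2 ha).norm
    (h.1.const_mul _) measurableSet_Ioi fun _ ht => norm_cpow_div_add_sq_le ha ht

/-- Holomorphy in the pole `a`, needed for the identity theorem. Near `a` both `slitDist` and the
norm stay above half their values at `a`, which gives a uniform integrable bound for the derivative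
in `a`. -/
lemma differentiableAt_mellin_one_div_add_sq {u : ℂ} (h0 : 0 < u.re) (h2 : u.re < 2) {a : ℂ}
    (ha : a ∈ slitPlane) :
    DifferentiableAt ℂ (fun a => mellin (fun t : ℝ => 1 / ((t : ℂ) + a) ^ 2) u) a := by
  have hr : 0 < ‖a‖ := norm_pos_iff.2 (slitPlane_ne_zero ha)
  have hd := slitDist_pos ha
  have hcont : ContinuousAt slitDist a := by
    have : ContinuousAt (fun a : ℂ => (1 + a.re / ‖a‖) / 2) a := by
      have := hr.ne'
      fun_prop (disch := assumption)
    exact this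
  set s : Set ℂ := {b | b ∈ slitPlane ∧ slitDist a / 2 < slitDist b ∧ ‖a‖ / 2 < ‖b‖}
  have hs : s ∈ 𝓝 a := by
    filter_upwards [isOpen_slitPlane.mem_nhds ha, hcont.eventually_const_lt (half_lt_self hd),
      (continuous_norm.continuousAt (x := a)).eventually_const_lt (half_lt_self hr)]
      with b h1 h2 h3 using ⟨h1, h2, h3⟩
  set δ := slitDist a / 2
  set r := ‖a‖ / 2
  have hδ : 0 < δ := by positivity
  have hr' : 0 < r := by positivity
  have key := hasDerivAt_integral_of_dominated_loc_of_deriv_le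
    (μ := volume.restrict (Set.Ioi (0 : ℝ))) (x₀ := a) (s := s)
    (F := fun (a : ℂ) (t : ℝ) => (t : ℂ) ^ (u - 1) • (1 / ((t : ℂ) + a) ^ 2))
    (F' := fun (a : ℂ) (t : ℝ) => (t : ℂ) ^ (u - 1) • (-2 / ((t : ℂ) + a) ^ 3))
    (bound := fun t : ℝ => (2 / (δ ^ 3 * r)) * (t ^ (u.re - 1) / (t + r) ^ 2))
    hs
    (by
      filter_upwards [isOpen_slitPlane.mem_nhds ha] with b hb using
        (continuousOn_cpow_div_add_sq hb).aestronglyMeasurable measurableSet_Ioi)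
    (mellinConvergent_one_div_add_sq h0 h2 ha)
    (by
      refine ContinuousOn.aestronglyMeasurable (fun t (ht : 0 < t) => ?_) measurableSet_Ioi
      refine ContinuousAt.continuousWithinAt (ContinuousAt.fun_smul ?_ ?_)
      · exact continuousAt_ofReal_cpow_const _ _ (Or.inr ht.ne')
      · exact continuousAt_const.div (by fun_prop)
          (pow_ne_zero _ (ofReal_add_ne_zero_of_mem_slitPlane ha ht)))
    ((ae_restrict_iff' measurableSet_Ioi).2 (Eventually.of_forall fun t (ht : 0 < t) b hb => by
      obtain ⟨hb1, hb2, hb3⟩ := hb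
      have h := slitDist_mul_le_norm_add hb1 t
      have hle : δ * (t + r) ≤ ‖(t : ℂ) + b‖ := by
        refine le_trans ?_ h
        have := (slitDist_pos hb1).le
        gcongr
      rw [norm_smul, norm_cpow_eq_rpow_re_of_pos ht, norm_div, norm_neg, Complex.norm_ofNat,
        norm_pow, sub_re, one_re]
      calc _ ≤ t ^ (u.re - 1) * (2 / (δ * (t + r)) ^ 3) := by gcongr
        _ = 2 / δ ^ 3 * (t ^ (u.re - 1) / (t + r) ^ 2) * (1 / (t + r)) := by
          rw [mul_pow]; field_simp
        _ ≤ 2 / δ ^ 3 * (t ^ (u.re - 1) / (t + r) ^ 2) * (1 / r) := by gcongr; linarith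
        _ = _ := by field_simp))
    ((integral_rpow_div_add_sq h0 h2 hr').1.const_mul _)
    ((ae_restrict_iff' measurableSet_Ioi).2 (Eventually.of_forall fun t (ht : 0 < t) b hb => by
      have hne := ofReal_add_ne_zero_of_mem_slitPlane hb.1 ht
      have h1 : HasDerivAt (fun b : ℂ => 1 / ((t : ℂ) + b) ^ 2) (-2 / ((t : ℂ) + b) ^ 3) b := by
        have := (((hasDerivAt_id b).const_add (t : ℂ)).fun_pow 2).fun_inv (pow_ne_zero 2 hne)
        simp only [one_div]
        refine this.congr_deriv ?_
        simp only [id]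
        field_simp
        norm_num
        ring
      exact h1.fun_const_smul _))
  exact key.2.differentiableAt

/-- Both sides are holomorphic in `a` on the connected slit plane and agree for positive real `a`,
in particular at the points `1 + 1/(n+1)`, which accumulate at `1`. -/
lemma hasMellin_one_div_add_sq {u : ℂ} (h0 : 0 < u.re) (h2 : u.re < 2) {a : ℂ}
    (ha : a ∈ slitPlane) :
    HasMellin (fun t : ℝ => 1 / ((t : ℂ) + a) ^ 2) u (a ^ (u - 2) * (Gamma u * Gamma (2 - u))) := by
  refine ⟨mellinConvergent_one_div_add_sq h0 h2 ha, ?_⟩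
  have h1 : AnalyticOnNhd ℂ (fun a => mellin (fun t : ℝ => 1 / ((t : ℂ) + a) ^ 2) u) slitPlane :=
    DifferentiableOn.analyticOnNhd (fun b hb =>
      (differentiableAt_mellin_one_div_add_sq h0 h2 hb).differentiableWithinAt) isOpen_slitPlane
  have h3 : AnalyticOnNhd ℂ (fun a : ℂ => a ^ (u - 2) * (Gamma u * Gamma (2 - u))) slitPlane :=
    DifferentiableOn.analyticOnNhd (fun b hb => by
      have : DifferentiableAt ℂ (fun a : ℂ => a ^ (u - 2)) b :=
        DifferentiableAt.cpow_const differentiableAt_id hb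
      exact (this.mul_const _).differentiableWithinAt) isOpen_slitPlane
  have hconn : IsPreconnected slitPlane := by
    exact (StarConvex.isPathConnected starConvex_one_slitPlane one_mem_slitPlane).isConnected.isPreconnected
  refine h1.eqOn_of_preconnected_of_frequently_eq h3 hconn one_mem_slitPlane ?_ ha
  have ht : Tendsto (fun n : ℕ => ((1 + 1 / ((n : ℝ) + 1) : ℝ) : ℂ)) atTop (𝓝[≠] 1) := by
    rw [tendsto_nhdsWithin_iff]
    constructor
    · have := (tendsto_one_div_add_atTop_nhds_zero_nat (𝕜 := ℝ)).const_add 1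
      rw [add_zero] at this
      have := (continuous_ofReal.tendsto (1 : ℝ)).comp this
      rwa [ofReal_one] at this
    · refine Eventually.of_forall fun n => ?_
      simp only [Set.mem_compl_iff, Set.mem_singleton_iff]
      have : (0 : ℝ) < 1 / ((n : ℝ) + 1) := by positivity
      intro h
      rw [ofReal_eq_one] at h
      linarith
  refine ht.frequently (Frequently.of_forall fun n => ?_)
  exact (hasMellin_one_div_add_ofReal_sq h0 h2 (by positivity)).2

/-- Term by term Mellin transform of a sum of double poles. -/
lemma hasSum_mellin_one_div_add_sq {ι : Type*} [Countable ι] {u : ℂ} (h0 : 0 < u.re)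
    (h2 : u.re < 2) {a : ι → ℂ} (ha : ∀ i, a i ∈ slitPlane) {m : ι → ℕ}
    (hre : ∀ᶠ i in cofinite, -‖a i‖ / 2 ≤ (a i).re)
    (hm : Summable fun i => (m i : ℝ) * ‖a i‖ ^ (u.re - 2)) :
    HasSum (fun i => (m i : ℂ) * a i ^ (u - 2) * (Gamma u * Gamma (2 - u)))
      (mellin (fun t : ℝ => ∑' i, (m i : ℂ) / ((t : ℂ) + a i) ^ 2) u) := by
  have hint := fun i => (hasMellin_one_div_add_sq h0 h2 (ha i)).1.const_smul (m i : ℂ)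
  have key := hasSum_integral_of_summable_integral_norm (μ := volume.restrict (Set.Ioi (0 : ℝ)))
    (F := fun i (t : ℝ) => (t : ℂ) ^ (u - 1) • ((m i : ℂ) • (1 / ((t : ℂ) + a i) ^ 2)))
    hint ?_
  · have e1 : mellin (fun t : ℝ => ∑' i, (m i : ℂ) / ((t : ℂ) + a i) ^ 2) u =
        ∫ t in Set.Ioi (0 : ℝ), ∑' i, (t : ℂ) ^ (u - 1) • ((m i : ℂ) • (1 / ((t : ℂ) + a i) ^ 2)) := by
      unfold mellin
      congr 1
      funext t
      rw [← tsum_const_smul'']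
      simp only [smul_eq_mul, mul_one_div]
    rw [e1]
    refine key.congr_fun fun i => ?_
    have h3 := hasMellin_const_smul (hasMellin_one_div_add_sq h0 h2 (ha i)).1 (m i : ℂ)
    rw [(hasMellin_one_div_add_sq h0 h2 (ha i)).2] at h3
    rw [mul_assoc, ← smul_eq_mul (m i : ℂ), ← h3.2, mellin]
  · set c := Real.Gamma u.re * Real.Gamma (2 - u.re)
    have hc : 0 ≤ c := mul_nonneg (Real.Gamma_nonneg_of_nonneg h0.le)
      (Real.Gamma_nonneg_of_nonneg (by linarith))
    -- The condition `re a ≥ -‖a‖ / 2` forces `slitDist a ≥ 1/4`, so `(slitDist a)⁻² ≤ 16` for all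
    -- but finitely many poles.
    refine (hm.mul_left (16 * c)).of_norm_bounded_eventually ?_
    filter_upwards [hre] with i hi
    have hr : 0 < ‖a i‖ := norm_pos_iff.2 (slitPlane_ne_zero (ha i))
    have hδ : 1 / 4 ≤ slitDist (a i) := by
      have : -(1 / 2) ≤ (a i).re / ‖a i‖ := by rw [le_div_iff₀ hr]; linarith
      unfold slitDist
      linarith
    rw [Real.norm_of_nonneg (integral_nonneg fun _ => norm_nonneg _)]
    have e : ∀ t : ℝ, ‖(t : ℂ) ^ (u - 1) • ((m i : ℂ) • (1 / ((t : ℂ) + a i) ^ 2))‖ =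
        m i * ‖(t : ℂ) ^ (u - 1) • (1 / ((t : ℂ) + a i) ^ 2)‖ := by
      intro t
      rw [smul_comm, norm_smul, Complex.norm_natCast]
    simp only [e]
    rw [integral_const_mul]
    have h4 := integral_norm_cpow_div_add_sq_le h0 h2 (ha i)
    calc _ ≤ (m i : ℝ) * ((slitDist (a i) ^ 2)⁻¹ * (‖a i‖ ^ (u.re - 2) * c)) := by gcongr
      _ ≤ (m i : ℝ) * (((1 / 4 : ℝ) ^ 2)⁻¹ * (‖a i‖ ^ (u.re - 2) * c)) := by gcongr
      _ = _ := by ring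

end

section

open Complex Filter Topology

/-! ### The trigamma series, and decay of `(ζ'/ζ)'`. -/

lemma Real.deriv_log_Gamma_add_one {x : ℝ} (hx : 0 < x) :
    deriv (Real.log ∘ Real.Gamma) (x + 1) = deriv (Real.log ∘ Real.Gamma) x + 1 / x := by
  have hd : ∀ y : ℝ, 0 < y → DifferentiableAt ℝ (Real.log ∘ Real.Gamma) y := fun y hy =>
    (Real.differentiableAt_log (Real.Gamma_pos_of_pos hy).ne').comp y
      (Real.differentiableAt_Gamma fun m h => by
        have : (0 : ℝ) ≤ m := m.cast_nonneg
        linarith)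
  have h1 : (fun y => (Real.log ∘ Real.Gamma) (y + 1)) =ᶠ[𝓝 x]
      fun y => (Real.log ∘ Real.Gamma) y + Real.log y := by
    filter_upwards [isOpen_Ioi.mem_nhds hx] with y (hy : 0 < y)
    simp only [Function.comp_apply]
    rw [Real.Gamma_add_one hy.ne', Real.log_mul hy.ne' (Real.Gamma_pos_of_pos hy).ne', add_comm]
  rw [← deriv_comp_add_const, h1.deriv_eq,
    deriv_fun_add (hd x hx) (Real.differentiableAt_log hx.ne'), Real.deriv_log, one_div]

lemma Real.monotoneOn_deriv_log_Gamma :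
    MonotoneOn (deriv (Real.log ∘ Real.Gamma)) (Set.Ioi 0) := by
  refine Real.convexOn_log_Gamma.monotoneOn_deriv fun y (hy : 0 < y) =>
    (Real.differentiableAt_log (Real.Gamma_pos_of_pos hy).ne').comp y
      (Real.differentiableAt_Gamma fun m h => ?_)
  have : (0 : ℝ) ≤ m := m.cast_nonneg
  linarith

lemma Real.deriv_log_Gamma_add_nat {x : ℝ} (hx : 0 < x) (n : ℕ) :
    deriv (Real.log ∘ Real.Gamma) (x + n) =
      deriv (Real.log ∘ Real.Gamma) x + ∑ k ∈ Finset.range n, 1 / (x + k) := by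
  induction n with
  | zero => simp
  | succ n ih =>
    rw [Nat.cast_succ, ← add_assoc, Real.deriv_log_Gamma_add_one (by positivity), ih,
      Finset.sum_range_succ, add_assoc]

/-- Telescoping `ψ(y+1) = ψ(y) + 1/y` leaves the error `ψ(x+n) - ψ(1+n)`. Log-convexity of `Γ` makes
`ψ` monotone, which squeezes this error to `0`. The condition `x ≥ 1` makes the summands
nonnegative. -/
lemma Real.hasSum_deriv_log_Gamma {x : ℝ} (hx : 1 ≤ x) :
    HasSum (fun k : ℕ => 1 / (1 + (k : ℝ)) - 1 / (x + k))
      (deriv (Real.log ∘ Real.Gamma) x - deriv (Real.log ∘ Real.Gamma) 1) := by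
  set ψ := deriv (Real.log ∘ Real.Gamma) with hψ
  rw [hasSum_iff_tendsto_nat_of_nonneg (fun k => by
    have : 1 / (x + k) ≤ 1 / (1 + (k : ℝ)) := by gcongr
    linarith)]
  obtain ⟨N, hN⟩ := exists_nat_ge x
  have hsum : ∀ n : ℕ, ∑ k ∈ Finset.range n, (1 / (1 + (k : ℝ)) - 1 / (x + k)) =
      (ψ x - ψ 1) - (ψ (x + n) - ψ (1 + n)) := by
    intro n
    rw [hψ, Real.deriv_log_Gamma_add_nat (by linarith), Real.deriv_log_Gamma_add_nat one_pos,
      Finset.sum_sub_distrib]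
    ring
  simp only [hsum]
  suffices Tendsto (fun n : ℕ => ψ (x + n) - ψ (1 + n)) atTop (𝓝 0) by
    simpa using this.const_sub (ψ x - ψ 1)
  have hup : ∀ n : ℕ, ψ (x + n) - ψ (1 + n) ≤ N * (1 / ((n : ℝ) + 1)) := by
    intro n
    have h1 : ψ (x + n) ≤ ψ (1 + n + N) :=
      Real.monotoneOn_deriv_log_Gamma (by simp only [Set.mem_Ioi]; positivity)
        (by simp only [Set.mem_Ioi]; positivity) (by linarith)
    rw [hψ, Real.deriv_log_Gamma_add_nat (x := 1 + (n : ℝ)) (by positivity)] at h1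
    have h2 : ∑ k ∈ Finset.range N, 1 / (1 + (n : ℝ) + k) ≤
        ∑ _k ∈ Finset.range N, 1 / ((n : ℝ) + 1) := by
      refine Finset.sum_le_sum fun k _ => ?_
      have : (0 : ℝ) ≤ k := k.cast_nonneg
      exact one_div_le_one_div_of_le (by positivity) (by linarith)
    rw [Finset.sum_const, Finset.card_range, nsmul_eq_mul] at h2
    linarith
  have hlow : ∀ n : ℕ, 0 ≤ ψ (x + n) - ψ (1 + n) := fun n => sub_nonneg.2 <|
    Real.monotoneOn_deriv_log_Gamma (by simp only [Set.mem_Ioi]; positivity)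
        (by simp only [Set.mem_Ioi]; positivity) (by linarith)
  refine squeeze_zero hlow hup ?_
  simpa using (tendsto_one_div_add_atTop_nhds_zero_nat (𝕜 := ℝ)).const_mul (N : ℝ)

lemma summable_one_div_one_add_nat_sq : Summable fun k : ℕ => 1 / (1 + (k : ℝ)) ^ 2 := by
  have := (summable_nat_add_iff 1).2 (Real.summable_one_div_nat_pow.2 (by norm_num : 1 < 2))
  refine this.congr fun k => ?_
  push_cast
  rw [add_comm]

lemma Real.hasDerivAt_deriv_log_Gamma {x : ℝ} (hx : 1 < x) :
    HasDerivAt (deriv (Real.log ∘ Real.Gamma)) (∑' k : ℕ, 1 / (x + k) ^ 2) x := by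
  have key := hasDerivAt_tsum_of_isPreconnected (𝕜 := ℝ) (t := Set.Ioi (1 : ℝ))
    (g := fun (k : ℕ) (x : ℝ) => 1 / (1 + (k : ℝ)) - 1 / (x + k))
    (g' := fun (k : ℕ) (x : ℝ) => 1 / (x + k) ^ 2) (y₀ := x) (y := x)
    summable_one_div_one_add_nat_sq isOpen_Ioi isPreconnected_Ioi
    (fun k y (hy : 1 < y) => by
      have hne : y + k ≠ 0 := by positivity
      have := (((hasDerivAt_id y).add_const (k : ℝ)).fun_inv hne).const_sub (1 / (1 + (k : ℝ)))
      simp only [one_div] at this ⊢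
      refine this.congr_deriv ?_
      simp only [id]
      ring)
    (fun k y (hy : 1 < y) => by
      rw [Real.norm_of_nonneg (by positivity)]
      gcongr)
    hx (Real.hasSum_deriv_log_Gamma hx.le).summable hx
  have h2 := key.const_add (deriv (Real.log ∘ Real.Gamma) 1)
  refine h2.congr_of_eventuallyEq ?_
  filter_upwards [isOpen_Ioi.mem_nhds hx] with y (hy : 1 < y)
  rw [(Real.hasSum_deriv_log_Gamma hy.le).tsum_eq]
  ring

lemma Complex.ne_neg_nat_of_re_pos {s : ℂ} (hs : 0 < s.re) (m : ℕ) : s ≠ -m := by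
  rintro rfl
  have : (0 : ℝ) ≤ m := m.cast_nonneg
  simp at hs
  linarith

lemma Complex.digamma_ofReal {x : ℝ} (hx : 0 < x) :
    digamma x = (deriv (Real.log ∘ Real.Gamma) x : ℝ) := by
  have hR : DifferentiableAt ℝ Real.Gamma x := Real.differentiableAt_Gamma fun m h => by
    have : (0 : ℝ) ≤ m := m.cast_nonneg
    linarith
  have h1 : HasDerivAt (fun y : ℝ => Gamma (y : ℂ)) (deriv Gamma x) x :=
    (differentiableAt_Gamma x (ne_neg_nat_of_re_pos (by simpa))).hasDerivAt.comp_ofReal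
  have h2 : HasDerivAt (fun y : ℝ => Gamma (y : ℂ)) ((deriv Real.Gamma x : ℝ) : ℂ) x := by
    simp only [Gamma_ofReal]
    exact hR.hasDerivAt.ofReal_comp
  have h3 : deriv (Real.log ∘ Real.Gamma) x = deriv Real.Gamma x / Real.Gamma x := by
    exact (hR.hasDerivAt.log (Real.Gamma_pos_of_pos hx).ne').deriv
  rw [digamma_def, logDeriv_apply, h1.unique h2, h3, Gamma_ofReal, ofReal_div]

lemma Complex.differentiableAt_Gamma_of_re_pos {s : ℂ} (hs : 0 < s.re) :
    DifferentiableAt ℂ Gamma s :=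
  differentiableAt_Gamma s (ne_neg_nat_of_re_pos hs)

lemma Complex.differentiableAt_digamma {s : ℂ} (hs : 0 < s.re) : DifferentiableAt ℂ digamma s := by
  have h : DifferentiableOn ℂ Gamma {z : ℂ | 0 < z.re} := fun z hz =>
    (differentiableAt_Gamma_of_re_pos hz).differentiableWithinAt
  have ho : IsOpen {z : ℂ | 0 < z.re} := continuous_re.isOpen_preimage _ isOpen_Ioi
  exact ((h.deriv ho).differentiableAt (ho.mem_nhds hs)).div (differentiableAt_Gamma_of_re_pos hs)
    (Gamma_ne_zero_of_re_pos hs)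

/-- The trigamma series on the real axis. -/
lemma Complex.hasSum_deriv_digamma {x : ℝ} (hx : 1 < x) :
    HasSum (fun k : ℕ => 1 / ((x : ℂ) + k) ^ 2) (deriv digamma x) := by
  have h1 : HasDerivAt (fun y : ℝ => digamma (y : ℂ)) (deriv digamma x) x :=
    (differentiableAt_digamma (by simp; linarith)).hasDerivAt.comp_ofReal
  have h2 : HasDerivAt (fun y : ℝ => digamma (y : ℂ)) ((∑' k : ℕ, 1 / (x + k) ^ 2 : ℝ) : ℂ) x := by
    refine (Real.hasDerivAt_deriv_log_Gamma hx).ofReal_comp.congr_of_eventuallyEq ?_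
    filter_upwards [isOpen_Ioi.mem_nhds hx] with y (hy : 1 < y)
    exact digamma_ofReal (by linarith)
  rw [h1.unique h2]
  have hs : Summable fun k : ℕ => 1 / (x + k) ^ 2 := by
    refine summable_one_div_one_add_nat_sq.of_nonneg_of_le (fun k => by positivity) fun k => ?_
    gcongr
  have := hasSum_ofReal.2 hs.hasSum
  push_cast at this ⊢
  exact this

open ArithmeticFunction in
/-- The derivative of `ζ' / ζ` decays exponentially. -/
lemma isBigO_deriv_logDeriv_riemannZeta :
    (fun x : ℝ => deriv (logDeriv riemannZeta) x) =O[atTop] fun x : ℝ => (2 : ℝ) ^ (-x) := by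
  set f : ℕ → ℂ := fun n => (vonMangoldt n : ℂ)
  have ha : LSeries.abscissaOfAbsConv f ≤ 1 :=
    LSeries.abscissaOfAbsConv_le_of_forall_lt_LSeriesSummable' fun y hy =>
      LSeriesSummable_vonMangoldt (by exact_mod_cast hy)
  have heq : ∀ x : ℝ, 1 < x → deriv (logDeriv riemannZeta) x = LSeries (LSeries.logMul f) x := by
    intro x hx
    have h1 : logDeriv riemannZeta =ᶠ[𝓝 (x : ℂ)] -LSeries f := by
      have ho : IsOpen {z : ℂ | 1 < z.re} := continuous_re.isOpen_preimage _ isOpen_Ioi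
      filter_upwards [ho.mem_nhds (show 1 < (x : ℂ).re by simpa)] with z hz
      rw [Pi.neg_apply, LSeries_vonMangoldt_eq_deriv_riemannZeta_div hz, logDeriv_apply]
      ring
    rw [h1.deriv_eq, deriv.neg, LSeries_deriv (ha.trans_lt (by exact_mod_cast hx)), neg_neg]
  -- The coefficients `Λ(n) log n` vanish for `n ≤ 1`, so the first term that can be nonzero is at
  -- `2`; hence the rate `2 ^ (-x)`.
  have hlim := LSeries.tendsto_cpow_mul_atTop (f := LSeries.logMul f) (n := 1)
    (fun m hm => by interval_cases m <;> simp [LSeries.logMul])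
    (by rw [LSeries.abscissaOfAbsConv_logMul]; exact ha.trans_lt (EReal.coe_lt_top 1))
  have hO := hlim.isBigO_one ℝ
  have h2 : (fun x : ℝ => deriv (logDeriv riemannZeta) x) =ᶠ[atTop]
      fun x : ℝ => (2 : ℂ) ^ (-(x : ℂ)) *
        ((((1 : ℕ) : ℂ) + 1) ^ (x : ℂ) * LSeries (LSeries.logMul f) x) := by
    filter_upwards [eventually_gt_atTop 1] with x hx
    rw [heq x hx, ← mul_assoc, Nat.cast_one, one_add_one_eq_two, ← cpow_add _ _ two_ne_zero]
    simp
  refine h2.trans_isBigO ?_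
  have h3 : (fun x : ℝ => (2 : ℂ) ^ (-(x : ℂ))) =O[atTop] fun x : ℝ => (2 : ℝ) ^ (-x) := by
    refine Asymptotics.isBigO_of_le _ fun x => ?_
    rw [← ofReal_ofNat, ← ofReal_neg, ← ofReal_cpow (by norm_num), norm_real]
  simpa using h3.mul hO

end

section

open Complex Filter Topology MeasureTheory

/-! ### Decomposition of `(ξ'/ξ)'(1/2 + t)` and Mellin transforms of its parts. -/

/-- The factor `s` is absorbed by `s Γ(s/2) = 2 Γ(s/2 + 1)`. The digamma poles are then exactly the
trivial zeros `-2, -4, …`. -/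
lemma logDeriv_riemannXi {s : ℂ} (hs : 1 < s.re) :
    logDeriv riemannXi s = (s - 1)⁻¹ - Real.log Real.pi / 2 + digamma (s / 2 + 1) / 2 +
      logDeriv riemannZeta s := by
  have h1 : s ≠ 1 := by rintro rfl; simp at hs
  have h10 : s - 1 ≠ 0 := sub_ne_zero.2 h1
  have hπ : (Real.pi : ℂ) ≠ 0 := by exact_mod_cast Real.pi_ne_zero
  have hre : 0 < (s / 2 + 1).re := by simp; linarith
  have hG := differentiableAt_Gamma_of_re_pos hre
  have hG0 := Gamma_ne_zero_of_re_pos hre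
  have e : riemannXi =ᶠ[𝓝 s] fun z => (z - 1) * ((2 * (Real.pi : ℂ) ^ (-z / 2)) *
      (Gamma (z / 2 + 1) * riemannZeta z)) := by
    filter_upwards [(isOpen_lt continuous_const continuous_re).mem_nhds hs] with z hz
    have hz : 1 < z.re := hz
    have hz0 : z ≠ 0 := by rintro rfl; norm_num at hz
    rw [riemannXi_eq_mul_riemannZeta (by linarith) (by rintro rfl; simp at hz), Gammaℝ_def,
      Gamma_add_one _ (div_ne_zero hz0 two_ne_zero)]
    ring
  have hd1 : HasDerivAt (fun z : ℂ => z - 1) 1 s := (hasDerivAt_id s).sub_const 1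
  have hd2 : HasDerivAt (fun z : ℂ => 2 * (Real.pi : ℂ) ^ (-z / 2))
      (2 * ((Real.pi : ℂ) ^ (-s / 2) * Complex.log Real.pi * (-1 / 2))) s :=
    ((((hasDerivAt_id s).neg).div_const 2).const_cpow (Or.inl hπ)).const_mul 2
  have hd3 : HasDerivAt (fun z : ℂ => Gamma (z / 2 + 1)) (deriv Gamma (s / 2 + 1) * (1 / 2)) s :=
    HasDerivAt.comp (h₂ := Gamma) s hG.hasDerivAt (((hasDerivAt_id s).div_const 2).add_const 1)
  have hd4 := differentiableAt_riemannZeta h1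
  have hz0 := riemannZeta_ne_zero_of_one_le_re hs.le
  have hp : (Real.pi : ℂ) ^ (-s / 2) ≠ 0 := by simp [cpow_eq_zero_iff, hπ]
  have e1 : logDeriv riemannXi s = logDeriv (fun z => (z - 1) * ((2 * (Real.pi : ℂ) ^ (-z / 2)) *
      (Gamma (z / 2 + 1) * riemannZeta z))) s := by
    rw [logDeriv_apply, logDeriv_apply, e.deriv_eq, e.eq_of_nhds]
  have hd := hd1.fun_mul (hd2.fun_mul (hd3.fun_mul hd4.hasDerivAt))
  rw [e1, logDeriv_apply, hd.deriv, digamma_def, logDeriv_apply, logDeriv_apply,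
    ofReal_log Real.pi_pos.le]
  generalize deriv Gamma (s / 2 + 1) = G'
  generalize Gamma (s / 2 + 1) = G at hG0
  field_simp
  ring

/-- Second logarithmic derivative of `ξ` to the right of the critical strip. -/
lemma deriv_logDeriv_riemannXi {t : ℝ} (ht : 1 / 2 < t) :
    deriv (logDeriv riemannXi) (1 / 2 + t) = -1 / ((t : ℂ) - 1 / 2) ^ 2 +
      ∑' k : ℕ, 1 / ((t : ℂ) + (1 / 2 + 2 * ((k : ℂ) + 1))) ^ 2 +
      deriv (logDeriv riemannZeta) (1 / 2 + t) := by
  set s : ℂ := 1 / 2 + t with hs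
  have hsre : s.re = 1 / 2 + t := by simp [hs]
  have hs1 : 1 < s.re := by rw [hsre]; linarith
  have h1 : s ≠ 1 := by intro h; rw [h] at hs1; simp at hs1
  have h10 : s - 1 ≠ 0 := sub_ne_zero.2 h1
  have e : logDeriv riemannXi =ᶠ[𝓝 s] fun s => (s - 1)⁻¹ - Real.log Real.pi / 2 +
      digamma (s / 2 + 1) / 2 + logDeriv riemannZeta s := by
    filter_upwards [(isOpen_lt continuous_const continuous_re).mem_nhds hs1] with z hz
    exact logDeriv_riemannXi hz
  have hre : 0 < (s / 2 + 1).re := by simp; linarith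
  have hd1 : HasDerivAt (fun z : ℂ => (z - 1)⁻¹) (-1 / (s - 1) ^ 2) s :=
    ((hasDerivAt_id s).sub_const 1).fun_inv h10
  have hd2 : HasDerivAt (fun z : ℂ => digamma (z / 2 + 1) / 2)
      (deriv digamma (s / 2 + 1) * (1 / 2) / 2) s :=
    (HasDerivAt.comp (h₂ := digamma) s (differentiableAt_digamma hre).hasDerivAt
      (((hasDerivAt_id s).div_const 2).add_const 1)).div_const 2
  have hd3 : DifferentiableAt ℂ (logDeriv riemannZeta) s := by
    have ha : AnalyticAt ℂ riemannZeta s := by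
      refine DifferentiableOn.analyticAt (s := {1}ᶜ) (fun z hz =>
        (differentiableAt_riemannZeta hz).differentiableWithinAt) ?_
      exact isOpen_compl_singleton.mem_nhds h1
    exact (ha.deriv.div ha (riemannZeta_ne_zero_of_one_le_re hs1.le)).differentiableAt
  have hx : (1 : ℝ) < (1 / 2 + t) / 2 + 1 := by linarith
  have hsum := (hasSum_deriv_digamma hx).mul_left (1 / 4 : ℂ)
  have hsx : (((1 / 2 + t) / 2 + 1 : ℝ) : ℂ) = s / 2 + 1 := by rw [hs]; push_cast; ring
  rw [hsx] at hsum
  -- The two chain-rule factors `1/2` rescale the trigamma poles to the trivial zeros seen from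
  -- `1/2`.
  have e2 : (fun k : ℕ => (1 / 4 : ℂ) * (1 / (s / 2 + 1 + k) ^ 2)) =
      fun k : ℕ => 1 / ((t : ℂ) + (1 / 2 + 2 * ((k : ℂ) + 1))) ^ 2 := by
    funext k
    rw [show (t : ℂ) + (1 / 2 + 2 * ((k : ℂ) + 1)) = 2 * (s / 2 + 1 + k) by rw [hs]; ring, mul_pow,
      one_div, one_div, one_div, mul_inv]
    norm_num
  rw [e2] at hsum
  rw [hsum.tsum_eq, e.deriv_eq, (((hd1.sub_const _).fun_add hd2).fun_add hd3.hasDerivAt).deriv,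
    show (t : ℂ) - 1 / 2 = s - 1 by rw [hs]; ring]
  ring

/-- The contribution of the trivial zeros of `ζ`. -/
noncomputable def shadowPoles (t : ℝ) : ℂ :=
  ∑' k : ℕ, 1 / ((t : ℂ) + (1 / 2 + 2 * ((k : ℂ) + 1))) ^ 2

lemma norm_ofReal_add_shadow {t : ℝ} (ht : 0 ≤ t) (k : ℕ) :
    ‖(t : ℂ) + (1 / 2 + 2 * ((k : ℂ) + 1))‖ = t + (1 / 2 + 2 * ((k : ℝ) + 1)) := by
  rw [show (t : ℂ) + (1 / 2 + 2 * ((k : ℂ) + 1)) = ((t + (1 / 2 + 2 * ((k : ℝ) + 1)) : ℝ) : ℂ) by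
    push_cast; rfl, norm_real, Real.norm_of_nonneg (by positivity)]

lemma norm_one_div_shadow_le {t : ℝ} (ht : 0 ≤ t) (k : ℕ) :
    ‖1 / ((t : ℂ) + (1 / 2 + 2 * ((k : ℂ) + 1))) ^ 2‖ ≤ 1 / (1 + (k : ℝ)) ^ 2 := by
  rw [norm_div, norm_pow, norm_one, norm_ofReal_add_shadow ht]
  have hk : (0 : ℝ) ≤ k := Nat.cast_nonneg k
  have : 1 + (k : ℝ) ≤ t + (1 / 2 + 2 * ((k : ℝ) + 1)) := by linarith
  gcongr

lemma continuousOn_shadowPoles : ContinuousOn shadowPoles (Set.Ioi 0) := by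
  refine continuousOn_tsum (fun k t (ht : 0 < t) => ?_) summable_one_div_one_add_nat_sq
    fun k t (ht : 0 < t) => norm_one_div_shadow_le ht.le k
  refine ContinuousAt.continuousWithinAt (continuousAt_const.div (by fun_prop) ?_)
  refine pow_ne_zero 2 (norm_pos_iff.1 ?_)
  rw [norm_ofReal_add_shadow ht.le]
  positivity

lemma shadowPoles_isBigO_zero : shadowPoles =O[𝓝[>] 0] fun t : ℝ => t ^ (-(0 : ℝ)) := by
  refine Asymptotics.IsBigO.of_bound (∑' k : ℕ, 1 / (1 + (k : ℝ)) ^ 2) ?_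
  filter_upwards [self_mem_nhdsWithin] with t (ht : 0 < t)
  rw [neg_zero, Real.rpow_zero, norm_one, mul_one]
  exact tsum_of_norm_bounded summable_one_div_one_add_nat_sq.hasSum
    fun k => norm_one_div_shadow_le ht.le k

/-- Each summand `b⁻²` is split as `b^(-(2-y)) * b^(-y)`: the first factor is summable over `k`
because `y < 1`, the second is at most `t^(-y)`. -/
lemma shadowPoles_isBigO_atTop {y : ℝ} (h0 : 0 ≤ y) (h1 : y < 1) :
    shadowPoles =O[atTop] fun t : ℝ => t ^ (-y) := by
  have hs : Summable fun k : ℕ => (((k : ℝ) + 1) ^ (2 - y))⁻¹ := by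
    have := (Real.summable_nat_rpow_inv (p := 2 - y)).2 (by linarith)
    have := (summable_nat_add_iff 1).2 this
    simpa using this
  refine Asymptotics.IsBigO.of_bound (∑' k : ℕ, (((k : ℝ) + 1) ^ (2 - y))⁻¹) ?_
  filter_upwards [eventually_gt_atTop 0] with t (ht : 0 < t)
  rw [Real.norm_of_nonneg (by positivity)]
  refine tsum_of_norm_bounded (hs.hasSum.mul_right _) fun k => ?_
  rw [norm_div, norm_pow, norm_one, norm_ofReal_add_shadow ht.le, Real.rpow_neg ht.le, ← mul_inv,
    one_div]
  gcongr
  have hk : (0 : ℝ) ≤ k := Nat.cast_nonneg k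
  set b := t + (1 / 2 + 2 * ((k : ℝ) + 1))
  have hb : b ^ 2 = b ^ (2 - y) * b ^ y := by
    rw [← Real.rpow_add (by positivity), sub_add_cancel]
    norm_cast
  rw [hb]
  have h3 : (k : ℝ) + 1 ≤ b := by simp only [b]; linarith
  have h4 : t ≤ b := by simp only [b]; linarith
  have h5 : 0 ≤ 2 - y := by linarith
  gcongr

lemma mellinConvergent_shadowPoles {u : ℂ} (h0 : 0 < u.re) (h1 : u.re < 1) :
    MellinConvergent shadowPoles u := by
  refine mellinConvergent_of_isBigO_rpow (a := (u.re + 1) / 2) (b := 0)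
    (continuousOn_shadowPoles.locallyIntegrableOn measurableSet_Ioi)
    (shadowPoles_isBigO_atTop (by linarith) (by linarith)) (by linarith) shadowPoles_isBigO_zero h0

/-- The pole of `(ξ'/ξ)'(1/2 + t)`, cut off near `t = 1/2`. -/
noncomputable def truncatedPole : ℝ → ℂ :=
  (Set.Ioi (1 : ℝ)).indicator fun t => 1 / ((t : ℂ) - 1 / 2) ^ 2

lemma ofReal_sub_half_ne_zero {t : ℝ} (ht : 1 / 2 < t) : (t : ℂ) - 1 / 2 ≠ 0 := by
  intro h
  have : (t : ℂ) = ((1 / 2 : ℝ) : ℂ) := by push_cast; exact sub_eq_zero.1 h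
  rw [ofReal_inj] at this
  linarith

lemma norm_truncatedPole_le {t : ℝ} (ht : 0 < t) : ‖truncatedPole t‖ ≤ 4 * t ^ (-(2 : ℝ)) := by
  by_cases h : t ∈ Set.Ioi (1 : ℝ)
  · have h1 : 1 < t := h
    rw [truncatedPole, Set.indicator_of_mem h, norm_div, norm_one, norm_pow,
      show (t : ℂ) - 1 / 2 = ((t - 1 / 2 : ℝ) : ℂ) by push_cast; rfl, norm_real,
      Real.norm_of_nonneg (by linarith), Real.rpow_neg ht.le, Real.rpow_ofNat,
      ← div_eq_mul_inv, div_le_div_iff₀ (pow_pos (by linarith) 2) (by positivity)]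
    nlinarith
  · rw [truncatedPole, Set.indicator_of_notMem h, norm_zero]
    positivity

lemma aestronglyMeasurable_truncatedPole : AEStronglyMeasurable truncatedPole := by
  refine (aestronglyMeasurable_indicator_iff measurableSet_Ioi).2
    (ContinuousOn.aestronglyMeasurable (fun t (ht : 1 < t) => ?_) measurableSet_Ioi)
  exact ContinuousAt.continuousWithinAt (continuousAt_const.div (by fun_prop)
    (pow_ne_zero 2 (ofReal_sub_half_ne_zero (by linarith))))

lemma locallyIntegrableOn_truncatedPole : LocallyIntegrableOn truncatedPole (Set.Ioi 0) := by
  have hc : ContinuousOn (fun t : ℝ => 4 * t ^ (-(2 : ℝ))) (Set.Ioi 0) := fun t (ht : 0 < t) =>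
    (continuousAt_const.mul (Real.continuousAt_rpow_const _ _ (Or.inl ht.ne'))).continuousWithinAt
  rw [locallyIntegrableOn_iff isOpen_Ioi.isLocallyClosed]
  intro k hk hkc
  refine Integrable.mono' ((hc.mono hk).integrableOn_compact hkc)
    aestronglyMeasurable_truncatedPole.restrict ?_
  exact (ae_restrict_iff' hkc.measurableSet).2 (Eventually.of_forall fun t ht =>
    norm_truncatedPole_le (hk ht))

lemma truncatedPole_isBigO_zero : truncatedPole =O[𝓝[>] 0] fun t : ℝ => t ^ (-(0 : ℝ)) := by
  refine (Asymptotics.isBigO_zero _ _).congr' ?_ EventuallyEq.rfl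
  filter_upwards [Ioo_mem_nhdsGT (zero_lt_one' ℝ)] with t ht
  rw [truncatedPole, Set.indicator_of_notMem (by simpa using ht.2.le)]

lemma mellinConvergent_truncatedPole {u : ℂ} (h0 : 0 < u.re) (h2 : u.re < 2) :
    MellinConvergent truncatedPole u := by
  refine mellinConvergent_of_isBigO_rpow (a := 2) (b := 0) locallyIntegrableOn_truncatedPole ?_ h2
    truncatedPole_isBigO_zero h0
  refine Asymptotics.IsBigO.of_bound 4 ?_
  filter_upwards [eventually_gt_atTop 0] with t ht
  rw [Real.norm_of_nonneg (by positivity)]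
  exact norm_truncatedPole_le ht

lemma hasSum_succ_mul_half_pow {t : ℝ} (ht : 1 / 2 < t) :
    HasSum (fun n : ℕ => ((n : ℝ) + 1) * (1 / 2) ^ n * t ^ (-(n : ℝ) - 2)) (1 / (t - 1 / 2) ^ 2) := by
  have h0 : 0 < t := by linarith
  have h := (hasSum_choose_mul_geometric_of_norm_lt_one 1 (r := 1 / (2 * t)) (by
    rw [Real.norm_of_nonneg (by positivity), div_lt_one (by positivity)]; linarith)).mul_left
      (1 / t ^ 2)
  have e : 1 / t ^ 2 * (1 / (1 - 1 / (2 * t)) ^ (1 + 1)) = 1 / (t - 1 / 2) ^ 2 := by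
    rw [one_div_mul_one_div, one_add_one_eq_two, ← mul_pow]
    congr 2
    field_simp
  rw [e] at h
  refine h.congr_fun fun n => ?_
  rw [Nat.choose_one_right, Real.rpow_sub h0, Real.rpow_neg h0.le, Real.rpow_natCast,
    Real.rpow_ofNat, one_div_pow, one_div_pow, mul_pow]
  push_cast
  field_simp

lemma summable_succ_mul_half_pow : Summable fun n : ℕ => ((n : ℝ) + 1) * (1 / 2) ^ n := by
  have := (hasSum_succ_mul_half_pow (t := 1) (by norm_num)).summable
  simpa using this

/-- The binomial expansion of `(t - 1/2)⁻²` in powers of `1/t` is integrated term by term over `t >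
1`. The resulting series displays the poles of the continuation at `u = n + 2`. -/
lemma hasSum_mellin_truncatedPole {u : ℂ} (h2 : u.re < 2) :
    HasSum (fun n : ℕ => ((n : ℂ) + 1) * (1 / 2) ^ n / (n + 2 - u)) (mellin truncatedPole u) := by
  have hre : ∀ n : ℕ, (u - n - 3).re < -1 := fun n => by
    have : (0 : ℝ) ≤ n := Nat.cast_nonneg n
    simp
    linarith
  have key := hasSum_integral_of_summable_integral_norm (μ := volume.restrict (Set.Ioi (1 : ℝ)))
    (F := fun (n : ℕ) (t : ℝ) => ((n : ℂ) + 1) * (1 / 2) ^ n * (t : ℂ) ^ (u - n - 3))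
    (fun n => (integrableOn_Ioi_cpow_of_lt (hre n) one_pos).const_mul _) ?_
  · have e1 : mellin truncatedPole u = ∫ t in Set.Ioi (1 : ℝ),
        ∑' n : ℕ, ((n : ℂ) + 1) * (1 / 2) ^ n * (t : ℂ) ^ (u - n - 3) := by
      have : ∀ t : ℝ, (t : ℂ) ^ (u - 1) • truncatedPole t = (Set.Ioi (1 : ℝ)).indicator
          (fun t : ℝ => (t : ℂ) ^ (u - 1) • (1 / ((t : ℂ) - 1 / 2) ^ 2)) t := fun t => by
        rw [truncatedPole, Set.indicator_smul_apply]
      simp only [mellin, this]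
      rw [setIntegral_indicator measurableSet_Ioi, Set.Ioi_inter_Ioi, max_eq_right zero_le_one]
      refine setIntegral_congr_fun measurableSet_Ioi fun t (ht : 1 < t) => ?_
      have hs := (hasSum_ofReal.2 (hasSum_succ_mul_half_pow (t := t) (by linarith))).mul_left
        ((t : ℂ) ^ (u - 1))
      have ht0 : (t : ℂ) ≠ 0 := by exact_mod_cast (by linarith : t ≠ 0)
      have e2 : ∀ n : ℕ, ((n : ℂ) + 1) * (1 / 2) ^ n * (t : ℂ) ^ (u - n - 3) = (t : ℂ) ^ (u - 1) *
          (((n : ℝ) + 1) * (1 / 2) ^ n * t ^ (-(n : ℝ) - 2) : ℝ) := fun n => by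
        rw [ofReal_mul, ofReal_cpow (by linarith)]
        rw [show u - n - 3 = (u - 1) + ((-(n : ℝ) - 2 : ℝ) : ℂ) by push_cast; ring,
          cpow_add _ _ ht0]
        push_cast
        ring
      simp only [e2]
      rw [hs.tsum_eq, smul_eq_mul]
      push_cast
      rfl
    rw [e1]
    refine key.congr_fun fun n => ?_
    have hn : (n : ℂ) + 2 - u ≠ 0 := by
      intro h
      have := congrArg re h
      have h3 := hre n
      simp at this h3
      linarith
    have hn' : u - n - 3 + 1 ≠ 0 := fun h => hn (by linear_combination -h)
    rw [integral_const_mul, integral_Ioi_cpow_of_lt (hre n) one_pos, ofReal_one, one_cpow,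
      mul_div_assoc']
    rw [div_eq_div_iff hn hn']
    ring
  · have hu : 0 < 2 - u.re := by linarith
    refine (summable_succ_mul_half_pow.mul_right (1 / (2 - u.re))).of_nonneg_of_le
      (fun n => integral_nonneg fun _ => norm_nonneg _) fun n => ?_
    have e : Set.EqOn (fun t : ℝ => ‖((n : ℂ) + 1) * (1 / 2) ^ n * (t : ℂ) ^ (u - n - 3)‖)
        (fun t : ℝ => ((n : ℝ) + 1) * (1 / 2) ^ n * t ^ (u.re - n - 3)) (Set.Ioi 1) := by
      intro t (ht : 1 < t)
      simp only
      rw [norm_mul, norm_mul, norm_cpow_eq_rpow_re_of_pos (by linarith), norm_pow,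
        ← Nat.cast_add_one, Complex.norm_natCast]
      simp
    rw [setIntegral_congr_fun measurableSet_Ioi e, integral_const_mul,
      integral_Ioi_rpow_of_lt (by simpa using hre n) one_pos, Real.one_rpow]
    refine mul_le_mul_of_nonneg_left ?_ (by positivity)
    rw [← neg_div_neg_eq, neg_neg]
    have : (0 : ℝ) ≤ n := Nat.cast_nonneg n
    exact one_div_le_one_div_of_le hu (by linarith)

/-- `(ξ'/ξ)'(1/2 + t)` minus its slowly decaying parts. -/
noncomputable def xiRemainder (t : ℝ) : ℂ :=
  deriv (logDeriv riemannXi) (1 / 2 + t) - shadowPoles t + truncatedPole t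

lemma continuous_deriv_logDeriv_riemannXi :
    Continuous fun t : ℝ => deriv (logDeriv riemannXi) (1 / 2 + t) := by
  refine continuous_iff_continuousAt.2 fun t => ?_
  have h0 : riemannXi (1 / 2 + t) ≠ 0 := by
    have := riemannXi_ofReal_ne_zero (1 / 2 + t)
    push_cast at this
    exact this
  have ha := (differentiable_riemannXi.analyticAt (1 / 2 + t))
  have hc : ContinuousAt (deriv (logDeriv riemannXi)) (1 / 2 + t) :=
    (ha.deriv.div ha h0).deriv.continuousAt
  exact ContinuousAt.comp (f := fun t : ℝ => (1 / 2 + t : ℂ)) hc (by fun_prop)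

lemma locallyIntegrableOn_xiRemainder : LocallyIntegrableOn xiRemainder (Set.Ioi 0) :=
  (((continuous_deriv_logDeriv_riemannXi.continuousOn).locallyIntegrableOn measurableSet_Ioi).sub
    (continuousOn_shadowPoles.locallyIntegrableOn measurableSet_Ioi)).add
    locallyIntegrableOn_truncatedPole

/-- Boundedness of the first part near `t = 0` rests on `ξ` having no real zeros, here at `1/2`. -/
lemma xiRemainder_isBigO_zero : xiRemainder =O[𝓝[>] 0] fun t : ℝ => t ^ (-(0 : ℝ)) := by
  refine (Asymptotics.IsBigO.sub ?_ shadowPoles_isBigO_zero).add truncatedPole_isBigO_zero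
  have := (continuous_deriv_logDeriv_riemannXi.tendsto 0).isBigO_one ℝ
  simp only [neg_zero, Real.rpow_zero]
  exact this.mono nhdsWithin_le_nhds

/-- For `t > 1` everything cancels except `(ζ'/ζ)'(1/2 + t)`, which decays exponentially. The Mellin
transform of the remainder is thus holomorphic for all `Re u > 0`. -/
lemma xiRemainder_isBigO_atTop (a : ℝ) : xiRemainder =O[atTop] fun t : ℝ => t ^ (-a) := by
  have h1 := isBigO_deriv_logDeriv_riemannZeta.comp_tendsto
    (tendsto_atTop_add_const_left atTop (1 / 2 : ℝ) tendsto_id)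
  have e : xiRemainder =ᶠ[atTop]
      ((fun x : ℝ => deriv (logDeriv riemannZeta) x) ∘ fun t : ℝ => 1 / 2 + id t) := by
    filter_upwards [eventually_gt_atTop 1] with t ht
    rw [xiRemainder, deriv_logDeriv_riemannXi (by linarith), truncatedPole,
      Set.indicator_of_mem (Set.mem_Ioi.2 ht), shadowPoles]
    simp only [Function.comp, id]
    push_cast
    ring
  refine e.trans_isBigO (h1.trans ?_)
  have h2 : (fun t : ℝ => (2 : ℝ) ^ (-(1 / 2 + t))) =O[atTop]
      fun t : ℝ => Real.exp (-Real.log 2 * t) := by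
    refine Asymptotics.IsBigO.of_bound 1 (Eventually.of_forall fun t => ?_)
    rw [one_mul, Real.norm_of_nonneg (by positivity), Real.norm_of_nonneg (by positivity),
      Real.rpow_def_of_pos two_pos]
    have := Real.log_pos one_lt_two
    refine Real.exp_le_exp.2 ?_
    nlinarith
  exact h2.trans (isLittleO_exp_neg_mul_rpow_atTop (Real.log_pos one_lt_two) _).isBigO

lemma mellinConvergent_xiRemainder {u : ℂ} (h0 : 0 < u.re) : MellinConvergent xiRemainder u :=
  mellinConvergent_of_isBigO_rpow locallyIntegrableOn_xiRemainder (xiRemainder_isBigO_atTop _)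
    (lt_add_one _) xiRemainder_isBigO_zero h0

lemma differentiableAt_mellin_xiRemainder {u : ℂ} (h0 : 0 < u.re) :
    DifferentiableAt ℂ (mellin xiRemainder) u :=
  mellin_differentiableAt_of_isBigO_rpow locallyIntegrableOn_xiRemainder
    (xiRemainder_isBigO_atTop _) (lt_add_one _) xiRemainder_isBigO_zero h0

/-! ### The series over the Riemann zeros and its Mellin representation. -/

/-- The zeros of `ξ(1/2 - z)`. -/
noncomputable def xiPole : upperZetaZeros ⊕ upperZetaZeros → ℂ :=
  Sum.elim (fun ρ => 1 / 2 - ρ) (fun ρ => ρ - 1 / 2)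

/-- The multiplicities of the zeros `xiPole`. -/
noncomputable def xiMult : upperZetaZeros ⊕ upperZetaZeros → ℕ :=
  Sum.elim (fun ρ => analyticOrderNatAt riemannZeta ρ) (fun ρ => analyticOrderNatAt riemannZeta ρ)

lemma xiPole_injective : Function.Injective xiPole := by
  have h : ∀ ρ ρ' : upperZetaZeros, (1 / 2 - ρ : ℂ) ≠ ρ' - 1 / 2 := by
    intro ρ ρ' h
    have := congrArg im h
    have h1 := ρ.2.2.2.2
    have h2 := ρ'.2.2.2.2
    norm_num at this
    linarith
  rintro (ρ | ρ) (ρ' | ρ') hh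
  · simpa [xiPole, Subtype.ext_iff] using hh
  · exact absurd hh (h ρ ρ')
  · exact absurd hh.symm (h ρ' ρ)
  · simpa [xiPole, Subtype.ext_iff] using hh

lemma xiPole_im_ne_zero (i : upperZetaZeros ⊕ upperZetaZeros) : (xiPole i).im ≠ 0 := by
  rcases i with ρ | ρ
  · have := ρ.2.2.2.2
    norm_num [xiPole]
    exact this.ne'
  · have := ρ.2.2.2.2
    norm_num [xiPole]
    exact this.ne'

lemma abs_xiPole_re_lt (i : upperZetaZeros ⊕ upperZetaZeros) : |(xiPole i).re| < 1 / 2 := by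
  rcases i with ρ | ρ <;>
  · have h1 := ρ.2.2.1
    have h2 := ρ.2.2.2.1
    rw [abs_lt]
    constructor <;> norm_num [xiPole] <;> linarith

lemma analyticOrderNatAt_riemannXi_half_add (z : ℂ) :
    analyticOrderNatAt (fun z => riemannXi (1 / 2 + z)) z = analyticOrderNatAt riemannXi (1 / 2 + z) := by
  have hd : HasDerivAt (fun z : ℂ => 1 / 2 + z) 1 z := (hasDerivAt_id z).const_add _
  have := analyticOrderAt_comp_of_deriv_ne_zero (f := riemannXi) (g := fun z : ℂ => 1 / 2 + z)
    (z₀ := z) (by fun_prop) (by rw [hd.deriv]; exact one_ne_zero)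
  exact congrArg ENat.toNat this

lemma analyticOrderNatAt_riemannXi_one_sub (z : ℂ) :
    analyticOrderNatAt riemannXi (1 - z) = analyticOrderNatAt riemannXi z := by
  have hd : HasDerivAt (fun z : ℂ => 1 - z) (-1) z := (hasDerivAt_id z).const_sub _
  have := analyticOrderAt_comp_of_deriv_ne_zero (f := riemannXi) (g := fun z : ℂ => 1 - z)
    (z₀ := z) (by fun_prop) (by rw [hd.deriv]; norm_num)
  have e : riemannXi ∘ (fun z : ℂ => 1 - z) = riemannXi := funext riemannXi_one_sub
  rw [e] at this
  exact congrArg ENat.toNat this.symm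

lemma analyticOrderNatAt_neg_xiPole (i : upperZetaZeros ⊕ upperZetaZeros) :
    analyticOrderNatAt (fun z => riemannXi (1 / 2 + z)) (-xiPole i) = xiMult i := by
  rw [analyticOrderNatAt_riemannXi_half_add]
  have key : ∀ ρ : upperZetaZeros, analyticOrderNatAt riemannXi (ρ : ℂ) =
      analyticOrderNatAt riemannZeta (ρ : ℂ) := fun ρ =>
    analyticOrderNatAt_riemannXi ρ.2.2.1 (fun h => by
      have := ρ.2.2.2.1
      rw [h] at this
      simp at this)
  rcases i with ρ | ρ
  · rw [show 1 / 2 + -xiPole (Sum.inl ρ) = ρ by simp only [xiPole, Sum.elim_inl]; ring, key]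
    rfl
  · rw [show 1 / 2 + -xiPole (Sum.inr ρ) = 1 - ρ by simp only [xiPole, Sum.elim_inr]; ring,
      analyticOrderNatAt_riemannXi_one_sub, key]
    rfl

lemma differentiable_riemannXi_half_add : Differentiable ℂ fun z => riemannXi (1 / 2 + z) := by
  fun_prop

lemma riemannXi_half_add_zero_ne : riemannXi (1 / 2 + 0) ≠ 0 := by
  have := riemannXi_ofReal_ne_zero (1 / 2)
  push_cast at this
  rwa [add_zero]

/-- A zero of `ξ` lies above the real axis, or below it and is then reflected by `s ↦ 1 - s`; real
zeros are excluded. -/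
lemma mem_range_neg_xiPole {a : ℂ} (h : riemannXi (1 / 2 + a) = 0) :
    a ∈ Set.range fun i => -xiPole i := by
  have hz := riemannXi_eq_zero_iff.1 h
  rcases lt_trichotomy (1 / 2 + a).im 0 with him | him | him
  · have h' : riemannXi (1 - (1 / 2 + a)) = 0 := by rw [riemannXi_one_sub, h]
    have hz' := riemannXi_eq_zero_iff.1 h'
    refine ⟨Sum.inr ⟨1 - (1 / 2 + a), hz'.1, hz'.2.1, hz'.2.2, ?_⟩, ?_⟩
    · rw [sub_im, one_im]; linarith
    · simp only [xiPole, Sum.elim_inr]; ring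
  · exfalso
    refine riemannXi_ofReal_ne_zero (1 / 2 + a).re ?_
    rw [show (((1 / 2 + a).re : ℝ) : ℂ) = 1 / 2 + a from Complex.ext (by simp) (by simpa using him.symm)]
    exact h
  · exact ⟨Sum.inl ⟨1 / 2 + a, hz.1, hz.2.1, hz.2.2, him⟩, by simp only [xiPole, Sum.elim_inl]; ring⟩

lemma order_eq_zero_of_notMem_range {a : ℂ} (h : a ∉ Set.range fun i => -xiPole i) :
    analyticOrderNatAt (fun z => riemannXi (1 / 2 + z)) a = 0 := by
  rw [differentiable_riemannXi_half_add.analyticOrderNatAt_eq_zero_iff riemannXi_half_add_zero_ne]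
  exact fun h0 => h (mem_range_neg_xiPole h0)

lemma neg_xiPole_injective : Function.Injective fun i => -xiPole i :=
  neg_injective.comp xiPole_injective

lemma finite_norm_xiPole_le (R : ℝ) : {i | ‖xiPole i‖ ≤ R}.Finite := by
  refine ((differentiable_riemannXi_half_add.finite_zeros_closedBall
    riemannXi_half_add_zero_ne R).preimage (neg_xiPole_injective.injOn)).subset fun i hi => ?_
  refine ⟨?_, by simpa using hi⟩
  have key : ∀ ρ : upperZetaZeros, riemannXi ρ = 0 := fun ρ =>
    riemannXi_eq_zero_iff.2 ⟨ρ.2.1, ρ.2.2.1, ρ.2.2.2.1⟩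
  rcases i with ρ | ρ
  · rw [show 1 / 2 + -xiPole (Sum.inl ρ) = ρ by simp only [xiPole, Sum.elim_inl]; ring, key]
  · rw [show 1 / 2 + -xiPole (Sum.inr ρ) = 1 - ρ by simp only [xiPole, Sum.elim_inr]; ring,
      riemannXi_one_sub, key]

instance countable_upperZetaZeros : Countable upperZetaZeros := by
  have : (⋃ n : ℕ, {i | ‖xiPole i‖ ≤ n}) = Set.univ :=
    Set.eq_univ_of_forall fun i => Set.mem_iUnion.2 (exists_nat_ge ‖xiPole i‖)
  have h : (Set.univ : Set (upperZetaZeros ⊕ upperZetaZeros)).Countable :=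
    this ▸ Set.countable_iUnion fun n => (finite_norm_xiPole_le n).countable
  have := Set.countable_univ_iff.1 h
  exact (Sum.inl_injective (α := upperZetaZeros) (β := upperZetaZeros)).countable

lemma summable_xiMult_mul_rpow {α : ℝ} (hα : 1 < α) :
    Summable fun i => (xiMult i : ℝ) * ‖xiPole i‖ ^ (-α) := by
  -- The midpoint lies strictly between the order `1` and the exponent `α`.
  obtain ⟨C, hC⟩ := exists_norm_riemannXi_le (β := (1 + α) / 2) (by linarith)
  have h := differentiable_riemannXi_half_add.summable_order_mul_rpow riemannXi_half_add_zero_ne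
    (by linarith) hC (α := α) (by linarith)
  have := h.comp_injective neg_xiPole_injective
  refine this.congr fun i => ?_
  simp only [Function.comp]
  rw [analyticOrderNatAt_neg_xiPole, norm_neg]

/-- The general expansion for order below `2`, with the sum over all of `ℂ` reindexed by the actual
zeros `-xiPole i`; the multiplicity vanishes elsewhere. -/
lemma hasSum_xiMult_div_sq (t : ℝ) :
    HasSum (fun i => (xiMult i : ℂ) / ((t : ℂ) + xiPole i) ^ 2)
      (-deriv (logDeriv riemannXi) (1 / 2 + t)) := by
  obtain ⟨C, hC⟩ := exists_norm_riemannXi_le (β := 3 / 2) (by norm_num)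
  have ht : riemannXi (1 / 2 + t) ≠ 0 := by
    have := riemannXi_ofReal_ne_zero (1 / 2 + t)
    push_cast at this
    exact this
  have h := hasSum_order_div_sub_sq differentiable_riemannXi_half_add riemannXi_half_add_zero_ne
    (by norm_num) hC (by norm_num) ht
  rw [← neg_xiPole_injective.hasSum_iff (fun a ha => by
    rw [order_eq_zero_of_notMem_range ha, Nat.cast_zero, zero_div])] at h
  have e : logDeriv (fun z => riemannXi (1 / 2 + z)) = fun z => logDeriv riemannXi (1 / 2 + z) := by
    funext z
    rw [logDeriv_apply, logDeriv_apply, deriv_comp_const_add]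
  rw [e, deriv_comp_const_add] at h
  refine h.congr_fun fun i => ?_
  simp only [Function.comp]
  rw [analyticOrderNatAt_neg_xiPole, sub_neg_eq_add]

lemma norm_zeroParam (ρ : ℂ) : ‖zeroParam ρ‖ = ‖ρ - 1 / 2‖ := by simp [zeroParam]

lemma zeroParam_re (ρ : ℂ) : (zeroParam ρ).re = ρ.im := by
  rw [zeroParam, div_I]; norm_num

lemma zeroParam_mul_I (ρ : ℂ) : I * zeroParam ρ = ρ - 1 / 2 := by
  rw [zeroParam, mul_div_cancel₀ _ I_ne_zero]

lemma summable_order_mul_norm_zeroParam {α : ℝ} (hα : 1 < α) :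
    Summable fun ρ : upperZetaZeros =>
      (analyticOrderNatAt riemannZeta (ρ : ℂ) : ℝ) * ‖zeroParam ρ‖ ^ (-α) := by
  refine ((summable_xiMult_mul_rpow hα).comp_injective Sum.inr_injective).congr fun ρ => ?_
  rw [norm_zeroParam]
  rfl

lemma norm_zeroTerm_le (σ : ℂ) (ρ : upperZetaZeros) :
    ‖zeroTerm σ ρ‖ ≤ (analyticOrderNatAt riemannZeta (ρ : ℂ) : ℝ) *
      ‖zeroParam ρ‖ ^ (-(2 * σ.re)) * Real.exp (2 * Real.pi * |σ.im|) := by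
  have h0 : zeroParam ρ ≠ 0 := by
    intro h
    have h1 := ρ.2.2.2.2
    rw [← zeroParam_re, h] at h1
    simp at h1
  rw [zeroTerm, norm_mul, Complex.norm_natCast, mul_assoc]
  gcongr
  rw [norm_cpow_of_ne_zero h0, div_eq_mul_inv, ← Real.exp_neg]
  have e1 : (-2 * σ).re = -(2 * σ.re) := by simp
  have e2 : (-2 * σ).im = -2 * σ.im := by simp
  rw [e1, e2]
  refine mul_le_mul_of_nonneg_left (Real.exp_le_exp.2 ?_) (by positivity)
  calc -((zeroParam ρ).arg * (-2 * σ.im)) = 2 * ((zeroParam ρ).arg * σ.im) := by ring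
    _ ≤ 2 * (Real.pi * |σ.im|) := by
      refine mul_le_mul_of_nonneg_left ((le_abs_self _).trans ?_) zero_le_two
      rw [abs_mul]
      exact mul_le_mul_of_nonneg_right (abs_arg_le_pi _) (abs_nonneg _)
    _ = _ := by ring

lemma summable_zeroTerm {σ : ℂ} (hσ : 1 / 2 < σ.re) : Summable (zeroTerm σ) :=
  ((summable_order_mul_norm_zeroParam (α := 2 * σ.re) (by linarith)).mul_right _).of_norm_bounded
    fun ρ => norm_zeroTerm_le σ ρ

lemma differentiableOn_zeroSeries : DifferentiableOn ℂ zeroSeries {σ : ℂ | 1 / 2 < σ.re} := by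
  intro σ (hσ : 1 / 2 < σ.re)
  refine DifferentiableAt.differentiableWithinAt ?_
  obtain ⟨a, ha, haσ⟩ := exists_between hσ
  set U : Set ℂ := {z | a < z.re ∧ z.re < σ.re + 1 ∧ |z.im| < |σ.im| + 1} with hU
  have hUo : IsOpen U := by
    refine (isOpen_lt continuous_const continuous_re).inter
      ((isOpen_lt continuous_re continuous_const).inter ?_)
    exact isOpen_lt (continuous_abs.comp continuous_im) continuous_const
  have hmem : σ ∈ U := ⟨haσ, by linarith, by linarith⟩
  -- Two exponents, one for each end of the range of `re z`, cover the cases `‖τ‖ ≥ 1` and `‖τ‖ ≤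
  -- 1`.
  have hs : Summable fun ρ : upperZetaZeros => ((analyticOrderNatAt riemannZeta (ρ : ℂ) : ℝ) *
      ‖zeroParam ρ‖ ^ (-(2 * a)) + (analyticOrderNatAt riemannZeta (ρ : ℂ) : ℝ) *
      ‖zeroParam ρ‖ ^ (-(2 * (σ.re + 1)))) * Real.exp (2 * Real.pi * (|σ.im| + 1)) :=
    ((summable_order_mul_norm_zeroParam (by linarith)).add
      (summable_order_mul_norm_zeroParam (by linarith))).mul_right _
  refine (differentiableOn_tsum_of_summable_norm hs (fun ρ => ?_) hUo fun ρ z hz => ?_).differentiableAt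
    (hUo.mem_nhds hmem)
  · intro z _
    have h0 : zeroParam ρ ≠ 0 := by
      intro h
      have h1 := ρ.2.2.2.2
      rw [← zeroParam_re, h] at h1
      simp at h1
    unfold zeroTerm
    refine DifferentiableAt.differentiableWithinAt (DifferentiableAt.const_mul ?_ _)
    exact DifferentiableAt.const_cpow (by fun_prop) (Or.inl h0)
  · obtain ⟨h1, h2, h3⟩ := hz
    refine (norm_zeroTerm_le z ρ).trans ?_
    rw [← mul_add]
    have hp := Real.pi_pos
    have hpow : ‖zeroParam ρ‖ ^ (-(2 * z.re)) ≤
        ‖zeroParam ρ‖ ^ (-(2 * a)) + ‖zeroParam ρ‖ ^ (-(2 * (σ.re + 1))) := by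
      have hpos : 0 < ‖zeroParam ρ‖ := by
        have h1 := ρ.2.2.2.2
        rw [← zeroParam_re] at h1
        exact h1.trans_le (re_le_norm _)
      rcases le_total 1 ‖zeroParam ρ‖ with h | h
      · refine (Real.rpow_le_rpow_of_exponent_le h (y := -(2 * z.re)) (z := -(2 * a))
          (by linarith)).trans (le_add_of_nonneg_right (by positivity))
      · refine (Real.rpow_le_rpow_of_exponent_ge hpos h (by linarith)).trans
          (le_add_of_nonneg_left (by positivity))
    gcongr

/-- The zeros pair up to give the cosine factor. -/
lemma xiPole_cpow_add (σ : ℂ) (ρ : upperZetaZeros) :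
    xiPole (Sum.inl ρ) ^ (-2 * σ) + xiPole (Sum.inr ρ) ^ (-2 * σ) =
      2 * cos (Real.pi * σ) * zeroParam ρ ^ (-2 * σ) := by
  have hre : 0 < (zeroParam ρ).re := by rw [zeroParam_re]; exact ρ.2.2.2.2
  have h0 : zeroParam ρ ≠ 0 := by
    intro h
    rw [h] at hre
    simp at hre
  have harg := abs_lt.1 (abs_arg_lt_pi_div_two_iff.2 (Or.inl hre))
  have hp := Real.pi_pos
  have e1 : xiPole (Sum.inl ρ) = -I * zeroParam ρ := by
    rw [neg_mul, zeroParam_mul_I]; simp [xiPole]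
  have e2 : xiPole (Sum.inr ρ) = I * zeroParam ρ := by rw [zeroParam_mul_I]; simp [xiPole]
  -- Since `Re τ > 0`, `arg τ` lies in `(-π/2, π/2)`. Adding `±π/2` stays inside the principal
  -- range, so the logarithms add.
  have l1 : log (-I * zeroParam ρ) = log (-I) + log (zeroParam ρ) := by
    refine (log_mul_eq_add_log_iff (neg_ne_zero.2 I_ne_zero) h0).2 ?_
    rw [arg_neg_I]
    exact ⟨by linarith, by linarith⟩
  have l2 : log (I * zeroParam ρ) = log I + log (zeroParam ρ) := by
    refine (log_mul_eq_add_log_iff I_ne_zero h0).2 ?_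
    rw [arg_I]
    exact ⟨by linarith, by linarith⟩
  rw [e1, e2, cpow_def_of_ne_zero (mul_ne_zero (neg_ne_zero.2 I_ne_zero) h0),
    cpow_def_of_ne_zero (mul_ne_zero I_ne_zero h0), cpow_def_of_ne_zero h0, l1, l2, log_I, log_neg_I,
    cos, add_mul, exp_add, add_mul, exp_add,
    show -(Real.pi / 2 : ℂ) * I * (-2 * σ) = Real.pi * σ * I by ring,
    show (Real.pi / 2 : ℂ) * I * (-2 * σ) = -(Real.pi * σ) * I by ring]
  ring

lemma xiMult_mul_norm (u : ℂ) (h1 : u.re < 1) :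
    Summable fun i => (xiMult i : ℝ) * ‖xiPole i‖ ^ (u.re - 2) := by
  simpa using summable_xiMult_mul_rpow (α := 2 - u.re) (by linarith)

/-- The strip is `0 < Re u < 1` for `u = 2 - 2σ`, where the sum over zeros converges absolutely and
may be transformed term by term. The poles `±iτ` are then combined in pairs. -/
lemma mellin_deriv_logDeriv_riemannXi {σ : ℂ} (h1 : 1 / 2 < σ.re) (h2 : σ.re < 1) :
    mellin (fun t : ℝ => deriv (logDeriv riemannXi) (1 / 2 + t)) (2 - 2 * σ) =
      -(2 * cos (Real.pi * σ) * zeroSeries σ * (Gamma (2 - 2 * σ) * Gamma (2 * σ))) := by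
  have hre : (2 - 2 * σ).re = 2 - 2 * σ.re := by simp
  have h := hasSum_mellin_one_div_add_sq (u := 2 - 2 * σ) (a := xiPole) (m := xiMult)
    (by rw [hre]; linarith) (by rw [hre]; linarith)
    (fun i => Or.inr (xiPole_im_ne_zero i)) (by
      -- All poles have real part above `-1/2`, so the sector condition can fail only for `‖a‖ ≤ 1`.
      refine (finite_norm_xiPole_le 1).subset fun i hi => ?_
      by_contra hlt
      have hlt : ¬ ‖xiPole i‖ ≤ 1 := hlt
      refine hi ?_
      have := (abs_lt.1 (abs_xiPole_re_lt i)).1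
      show -‖xiPole i‖ / 2 ≤ (xiPole i).re
      linarith [not_le.1 hlt]) (xiMult_mul_norm _ (by rw [hre]; linarith))
  have e : (fun t : ℝ => ∑' i, (xiMult i : ℂ) / ((t : ℂ) + xiPole i) ^ 2) =
      fun t : ℝ => (-1 : ℂ) • deriv (logDeriv riemannXi) (1 / 2 + t) := by
    funext t
    rw [(hasSum_xiMult_div_sq t).tsum_eq, smul_eq_mul, neg_one_mul]
  rw [e, mellin_const_smul, show 2 - 2 * σ - 2 = -2 * σ by ring,
    show 2 - (2 - 2 * σ) = 2 * σ by ring] at h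
  have hinl := (h.summable.comp_injective Sum.inl_injective).hasSum
  have hinr := (h.summable.comp_injective Sum.inr_injective).hasSum
  have hz := (summable_zeroTerm h1).hasSum.mul_left
    (2 * cos (Real.pi * σ) * (Gamma (2 - 2 * σ) * Gamma (2 * σ)))
  have hadd := hinl.add hinr
  have e2 := hadd.unique (hz.congr_fun fun ρ => by
    simp only [Function.comp]
    have := xiPole_cpow_add σ ρ
    simp only [zeroTerm, xiMult, Sum.elim_inl, Sum.elim_inr]
    linear_combination (analyticOrderNatAt riemannZeta (ρ : ℂ) : ℂ) *
      (Gamma (2 - 2 * σ) * Gamma (2 * σ)) * this)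
  have e3 := (hinl.sum hinr).unique h
  rw [e2] at e3
  rw [smul_eq_mul, neg_one_mul] at e3
  rw [← neg_eq_iff_eq_neg, ← e3, zeroSeries]
  ring

/-! ### The formula continuing the zero series to `Re σ < 1`. -/

/-- One term of the Mellin transform of `truncatedPole`. -/
noncomputable def poleTerm (n : ℕ) (σ : ℂ) : ℂ := ((n : ℂ) + 1) * (1 / 2) ^ n / (n + 2 * σ)

/-- The Mellin transform of `truncatedPole` at `2 - 2σ`. -/
noncomputable def poleSeries (σ : ℂ) : ℂ := ∑' n : ℕ, poleTerm n σ

/-- The Dirichlet series over the trivial zeros in terms of the Hurwitz zeta function. -/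
noncomputable def shadowZeta (s : ℂ) : ℂ :=
  2 ^ (-s) * (HurwitzZeta.hurwitzZeta ((1 / 4 : ℝ) : UnitAddCircle) s - 4 ^ s)

/-- Here `1/2 + 2(k+1) = 2(k + 1 + 1/4)`: the Hurwitz series at `1/4`, scaled by `2`, with its first
term `(1/4)^(-s) = 4^s` removed. -/
lemma hasSum_shadowTerm {s : ℂ} (hs : 1 < s.re) : HasSum (shadowTerm s) (shadowZeta s) := by
  have h := HurwitzZeta.hasSum_hurwitzZeta_of_one_lt_re (a := 1 / 4) (by norm_num) hs
  have h1 := ((hasSum_nat_add_iff' 1).2 h).mul_left ((2 : ℂ) ^ (-s))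
  have h4 : 1 / ((1 / 4 : ℝ) : ℂ) ^ s = 4 ^ s := by
    have harg : arg 4 ≠ Real.pi := by
      rw [show (4 : ℂ) = ((4 : ℝ) : ℂ) by norm_num, arg_ofReal_of_nonneg (by norm_num)]
      exact Real.pi_pos.ne
    rw [ofReal_div, ofReal_one, ofReal_ofNat, one_div (4 : ℂ), inv_cpow _ _ harg, one_div, inv_inv]
  have e : (2 : ℂ) ^ (-s) * (HurwitzZeta.hurwitzZeta ((1 / 4 : ℝ) : UnitAddCircle) s -
      ∑ i ∈ Finset.range 1, 1 / ((i : ℂ) + ((1 / 4 : ℝ) : ℂ)) ^ s) = shadowZeta s := by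
    rw [shadowZeta, Finset.sum_range_one, Nat.cast_zero, zero_add, h4]
  rw [e] at h1
  refine h1.congr_fun fun k => ?_
  rw [shadowTerm, show 1 / 2 + 2 * ((k : ℂ) + 1) = ((2 : ℝ) : ℂ) * ((k + 1 + 1 / 4 : ℝ) : ℂ) by
    push_cast; ring, mul_cpow_ofReal_nonneg (by norm_num) (by positivity), one_div (_ ^ s), ← cpow_neg,
    ofReal_ofNat]
  push_cast
  rfl

lemma mellin_shadowPoles {σ : ℂ} (h1 : 1 / 2 < σ.re) (h2 : σ.re < 1) :
    mellin shadowPoles (2 - 2 * σ) = shadowZeta (2 * σ) * (Gamma (2 - 2 * σ) * Gamma (2 * σ)) := by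
  have hre : (2 - 2 * σ).re = 2 - 2 * σ.re := by simp
  have hpos : ∀ k : ℕ, (1 / 2 + 2 * ((k : ℂ) + 1)) = ((1 / 2 + 2 * ((k : ℝ) + 1) : ℝ) : ℂ) := fun k => by
    push_cast; rfl
  have hpos' : ∀ k : ℕ, (0 : ℝ) < 1 / 2 + 2 * ((k : ℝ) + 1) := fun k => by positivity
  have h2σ : 1 < (2 * σ).re := by simp; linarith
  have hs := hasSum_shadowTerm h2σ
  have h := hasSum_mellin_one_div_add_sq (u := 2 - 2 * σ) (a := fun k : ℕ => 1 / 2 + 2 * ((k : ℂ) + 1))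
    (m := fun _ => 1)
    (by rw [hre]; linarith) (by rw [hre]; linarith)
    (fun k => by simp only [hpos k]; exact ofReal_mem_slitPlane.2 (hpos' k))
    (Eventually.of_forall fun k => by
      simp only [hpos k, norm_real, ofReal_re, Real.norm_of_nonneg (hpos' k).le]
      linarith [hpos' k])
    (hs.summable.norm.congr fun k => by
      rw [shadowTerm, hpos, norm_cpow_eq_rpow_re_of_pos (hpos' k), norm_real,
        Real.norm_of_nonneg (hpos' k).le, hre]
      simp)
  simp only [Nat.cast_one, one_mul] at h
  rw [show 2 - 2 * σ - 2 = -(2 * σ) by ring, show 2 - (2 - 2 * σ) = 2 * σ by ring] at h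
  exact h.unique (hs.mul_right _)

lemma mellin_truncatedPole {σ : ℂ} (h0 : 0 < σ.re) :
    mellin truncatedPole (2 - 2 * σ) = poleSeries σ := by
  have h := hasSum_mellin_truncatedPole (u := 2 - 2 * σ) (by simpa using h0)
  rw [← h.tsum_eq, poleSeries]
  refine tsum_congr fun n => ?_
  rw [poleTerm]
  congr 1
  ring

/-- The continuation of the series over the zeros to `Re σ < 1`. -/
noncomputable def zeroContinuation (σ : ℂ) : ℂ :=
  -shadowZeta (2 * σ) / (2 * cos (Real.pi * σ)) +
    sin (Real.pi * σ) * (poleSeries σ - mellin xiRemainder (2 - 2 * σ)) / (Real.pi * (1 - 2 * σ))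

/-- The two evaluations of the Mellin transform of `(ξ'/ξ)'(1/2 + t)` are compared and solved for
the zero series. By reflection `Γ(2-2σ) Γ(2σ) = (1-2σ) π / sin(2πσ)`, and the cosine of the zero
side cancels half of `sin(2πσ)`. -/
theorem zeroSeries_eq_zeroContinuation {σ : ℂ} (h1 : 1 / 2 < σ.re) (h2 : σ.re < 1) :
    zeroSeries σ = zeroContinuation σ := by
  have hre : (2 - 2 * σ).re = 2 - 2 * σ.re := by simp
  have hE := mellinConvergent_xiRemainder (u := 2 - 2 * σ) (by rw [hre]; linarith)
  have hS := mellinConvergent_shadowPoles (u := 2 - 2 * σ) (by rw [hre]; linarith)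
    (by rw [hre]; linarith)
  have hT := mellinConvergent_truncatedPole (u := 2 - 2 * σ) (by rw [hre]; linarith)
    (by rw [hre]; linarith)
  have hES := hasMellin_add hE hS
  have hD := (hasMellin_sub hES.1 hT).2
  have e : (fun t => xiRemainder t + shadowPoles t - truncatedPole t) =
      fun t : ℝ => deriv (logDeriv riemannXi) (1 / 2 + t) := by
    funext t
    rw [xiRemainder]
    ring
  rw [e, hES.2, mellin_deriv_logDeriv_riemannXi h1 h2, mellin_shadowPoles h1 h2,
    mellin_truncatedPole (by linarith)] at hD
  have hπ : (Real.pi : ℂ) ≠ 0 := by exact_mod_cast Real.pi_ne_zero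
  have h12 : 1 - 2 * σ ≠ 0 := by
    intro h
    have := congrArg re h
    simp at this
    linarith
  have hsin2 : sin (Real.pi * (2 * σ)) ≠ 0 := by
    intro h
    obtain ⟨k, hk⟩ := sin_eq_zero_iff.1 h
    have hk' : 2 * σ = k := mul_left_cancel₀ hπ (by rw [hk]; ring)
    have := congrArg re hk'
    simp at this
    have a1 : (1 : ℝ) < k := by linarith
    have a2 : (k : ℝ) < 2 := by linarith
    have b1 : (1 : ℤ) < k := by exact_mod_cast a1
    have b2 : k < (2 : ℤ) := by exact_mod_cast a2
    omega
  have hK : Gamma (2 - 2 * σ) * Gamma (2 * σ) =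
      (1 - 2 * σ) * (Real.pi / sin (Real.pi * (2 * σ))) := by
    rw [← Gamma_mul_Gamma_one_sub, show 2 - 2 * σ = (1 - 2 * σ) + 1 by ring, Gamma_add_one _ h12]
    ring
  have hs2 : sin (Real.pi * (2 * σ)) = 2 * sin (Real.pi * σ) * cos (Real.pi * σ) := by
    rw [← sin_two_mul]
    congr 1
    ring
  rw [hs2] at hsin2
  rw [hK, hs2] at hD
  have hc : cos (Real.pi * σ) ≠ 0 := right_ne_zero_of_mul hsin2
  have hsn : sin (Real.pi * σ) ≠ 0 := right_ne_zero_of_mul (left_ne_zero_of_mul hsin2)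
  rw [zeroContinuation]
  generalize mellin xiRemainder (2 - 2 * σ) = M at hD ⊢
  generalize shadowZeta (2 * σ) = S at hD ⊢
  generalize cos (Real.pi * σ) = c at *
  generalize sin (Real.pi * σ) = s at *
  generalize poleSeries σ = P at *
  generalize hw : 1 - 2 * σ = w at *
  field_simp at hD ⊢
  linear_combination -hD

/-! ### Local behaviour of the pole series. -/

lemma norm_poleTerm_le {n : ℕ} {σ : ℂ} (h : 1 ≤ ‖(n : ℂ) + 2 * σ‖) :
    ‖poleTerm n σ‖ ≤ ((n : ℝ) + 1) * (1 / 2) ^ n := by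
  rw [poleTerm, norm_div, norm_mul, norm_pow, ← Nat.cast_add_one, Complex.norm_natCast]
  have : ‖(1 / 2 : ℂ)‖ = 1 / 2 := by simp
  rw [this]
  push_cast
  exact div_le_self (by positivity) h

lemma one_le_norm_natCast_add {n : ℕ} {z σ : ℂ} (hn : 2 * ‖z‖ + 3 ≤ n) (hσ : σ ∈ Metric.ball z 1) :
    1 ≤ ‖(n : ℂ) + 2 * σ‖ := by
  have h1 : ‖σ - z‖ < 1 := by simpa [dist_eq_norm] using hσ
  have h2 : ‖σ‖ ≤ ‖σ - z‖ + ‖z‖ := by simpa using norm_add_le (σ - z) z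
  have h3 := norm_sub_le ((n : ℂ) + 2 * σ) (2 * σ)
  rw [add_sub_cancel_right, Complex.norm_natCast, norm_mul, Complex.norm_ofNat] at h3
  linarith

/-- Near a given point only finitely many terms can be singular; the tail is dominated by `(n+1)
2^(-n)`. The parameter `M` lets a chosen index be forced into the finite part. -/
lemma exists_poleSeries_eq (z : ℂ) (M : ℕ) : ∃ N : ℕ, M ≤ N ∧ ∃ g : ℂ → ℂ, AnalyticAt ℂ g z ∧
    ∀ᶠ σ in 𝓝 z, poleSeries σ = ∑ n ∈ Finset.range N, poleTerm n σ + g σ := by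
  obtain ⟨N', hN'⟩ := exists_nat_ge (2 * ‖z‖ + 3)
  obtain ⟨N, hN, hMN⟩ : ∃ N : ℕ, 2 * ‖z‖ + 3 ≤ N ∧ M ≤ N :=
    ⟨max N' M, hN'.trans (by exact_mod_cast le_max_left _ _), le_max_right _ _⟩
  have hle : ∀ n : ℕ, 2 * ‖z‖ + 3 ≤ (n + N : ℕ) := fun n => by
    push_cast
    linarith [(Nat.cast_nonneg n : (0 : ℝ) ≤ n)]
  have hs : Summable fun n : ℕ => (((n + N : ℕ) : ℝ) + 1) * (1 / 2) ^ (n + N) :=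
    (summable_nat_add_iff N).2 summable_succ_mul_half_pow
  have hb : ∀ (n : ℕ) (σ : ℂ), σ ∈ Metric.ball z 1 →
      ‖poleTerm (n + N) σ‖ ≤ (((n + N : ℕ) : ℝ) + 1) * (1 / 2) ^ (n + N) := fun n σ hσ =>
    norm_poleTerm_le (one_le_norm_natCast_add (hle n) hσ)
  refine ⟨N, hMN, fun σ => ∑' n : ℕ, poleTerm (n + N) σ, ?_, ?_⟩
  · refine (differentiableOn_tsum_of_summable_norm hs (fun n σ hσ => ?_) Metric.isOpen_ball
      hb).analyticAt (Metric.ball_mem_nhds z one_pos)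
    have h0 : ((n + N : ℕ) : ℂ) + 2 * σ ≠ 0 := norm_pos_iff.1
      (one_pos.trans_le (one_le_norm_natCast_add (hle n) hσ))
    have hd : DifferentiableAt ℂ (fun σ : ℂ => ((n + N : ℕ) : ℂ) + 2 * σ) σ := by fun_prop
    unfold poleTerm
    exact ((differentiableAt_const _).fun_div hd h0).differentiableWithinAt
  · filter_upwards [Metric.ball_mem_nhds z one_pos] with σ hσ
    have h1 : Summable fun n => poleTerm (n + N) σ := hs.of_norm_bounded fun n => hb n σ hσ
    have h2 : Summable fun n => poleTerm n σ :=
      (summable_nat_add_iff (f := fun n => poleTerm n σ) N).1 h1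
    exact (h2.sum_add_tsum_nat_add N).symm

lemma meromorphicAt_poleSeries (z : ℂ) : MeromorphicAt poleSeries z := by
  obtain ⟨N, -, g, hg, h⟩ := exists_poleSeries_eq z 0
  have hm : MeromorphicAt (fun σ => ∑ n ∈ Finset.range N, poleTerm n σ + g σ) z := by
    refine MeromorphicAt.fun_add (MeromorphicAt.fun_sum fun n _ => ?_) hg.meromorphicAt
    unfold poleTerm
    fun_prop
  exact hm.congr ((h.filter_mono nhdsWithin_le_nhds).mono fun _ h => h.symm)

lemma tendsto_sin_div (m : ℕ) :
    Tendsto (fun σ : ℂ => sin (Real.pi * σ) / (σ + m)) (𝓝[≠] (-(m : ℂ)))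
      (𝓝 (Real.pi * (-1) ^ m)) := by
  have hd : HasDerivAt (fun σ : ℂ => sin (Real.pi * σ)) (cos (Real.pi * (-(m : ℂ))) * Real.pi)
      (-(m : ℂ)) := by
    have := (hasDerivAt_id (-(m : ℂ))).const_mul (Real.pi : ℂ)
    simpa using this.csin
  have hs : sin (Real.pi * (-(m : ℂ))) = 0 := by
    rw [mul_neg, Complex.sin_neg, mul_comm, sin_nat_mul_pi, neg_zero]
  have hc : cos (Real.pi * (-(m : ℂ))) = (-1) ^ m := by
    rw [mul_neg, Complex.cos_neg, mul_comm]
    exact_mod_cast congrArg ofReal (Real.cos_nat_mul_pi m)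
  have h := hasDerivAt_iff_tendsto_slope.1 hd
  rw [hc, mul_comm] at h
  refine h.congr fun σ => ?_
  rw [slope_def_field, hs, sub_zero, sub_neg_eq_add]

/-- Only `n = 2m` is singular at `-m`. There `n + 2σ = 2(σ + m)`, which accounts for the final
factor `1/2`; the sine annihilates the other terms. -/
lemma tendsto_sin_mul_poleSeries (m : ℕ) :
    Tendsto (fun σ : ℂ => sin (Real.pi * σ) * poleSeries σ) (𝓝[≠] (-(m : ℂ)))
      (𝓝 (Real.pi * (-1) ^ m * ((2 * m + 1) * (1 / 2) ^ (2 * m) / 2))) := by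
  obtain ⟨N, hN, g, hg, h⟩ := exists_poleSeries_eq (-(m : ℂ)) (2 * m + 1)
  have hs : sin (Real.pi * (-(m : ℂ))) = 0 := by
    rw [mul_neg, Complex.sin_neg, mul_comm, sin_nat_mul_pi, neg_zero]
  have hs0 : Tendsto (fun σ : ℂ => sin (Real.pi * σ)) (𝓝[≠] (-(m : ℂ))) (𝓝 0) := by
    have hc : Continuous fun σ : ℂ => sin (Real.pi * σ) := by fun_prop
    rw [← hs]
    exact hc.continuousAt.tendsto.mono_left nhdsWithin_le_nhds
  have hterm : ∀ n ∈ Finset.range N, Tendsto (fun σ : ℂ => sin (Real.pi * σ) * poleTerm n σ)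
      (𝓝[≠] (-(m : ℂ))) (𝓝 (if n = 2 * m then
        Real.pi * (-1) ^ m * ((2 * m + 1) * (1 / 2) ^ (2 * m) / 2) else 0)) := by
    intro n _
    split_ifs with hn
    · refine ((tendsto_sin_div m).mul_const _).congr fun σ => ?_
      rw [poleTerm, hn, Nat.cast_mul, Nat.cast_ofNat, ← mul_add, add_comm (m : ℂ) σ, mul_comm 2 (σ + m),
        ← div_div]
      ring
    · have hne : (n : ℂ) + 2 * (-(m : ℂ)) ≠ 0 := by
        intro h
        apply hn
        have : (n : ℂ) = 2 * m := by linear_combination h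
        exact_mod_cast this
      have hc : ContinuousAt (poleTerm n) (-(m : ℂ)) := by
        unfold poleTerm
        exact continuousAt_const.div (by fun_prop) hne
      have := hs0.mul (hc.tendsto.mono_left nhdsWithin_le_nhds)
      rwa [zero_mul] at this
  have hsum := (tendsto_finsetSum _ hterm).add
    (hs0.mul (hg.continuousAt.tendsto.mono_left nhdsWithin_le_nhds))
  rw [Finset.sum_ite_eq' , if_pos (Finset.mem_range.2 (by omega)), zero_mul, add_zero] at hsum
  refine hsum.congr' ?_
  filter_upwards [h.filter_mono nhdsWithin_le_nhds] with σ hσ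
  rw [hσ, mul_add, Finset.mul_sum]

/-! ### Meromorphic continuation: existence, uniqueness, values. -/

lemma differentiableAt_shadowZeta {s : ℂ} (hs : s ≠ 1) : DifferentiableAt ℂ shadowZeta s := by
  have := HurwitzZeta.differentiableAt_hurwitzZeta ((1 / 4 : ℝ) : UnitAddCircle) hs
  unfold shadowZeta
  exact (DifferentiableAt.const_cpow (by fun_prop) (Or.inl two_ne_zero)).fun_mul
    (this.fun_sub (DifferentiableAt.const_cpow (by fun_prop) (Or.inl (by norm_num))))

lemma analyticAt_shadowZeta {s : ℂ} (hs : s ≠ 1) : AnalyticAt ℂ shadowZeta s :=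
  DifferentiableOn.analyticAt (s := {1}ᶜ) (fun z hz =>
    (differentiableAt_shadowZeta (s := z) hz).differentiableWithinAt) (isOpen_compl_singleton.mem_nhds hs)

lemma meromorphicAt_hurwitzZeta_one (a : UnitAddCircle) :
    MeromorphicAt (HurwitzZeta.hurwitzZeta a) 1 := by
  have hr := HurwitzZeta.hurwitzZeta_residue_one a
  have h : AnalyticAt ℂ (Function.update (fun s => (s - 1) * HurwitzZeta.hurwitzZeta a s) 1 1) 1 := by
    refine analyticAt_of_differentiable_on_punctured_nhds_of_continuousAt ?_
      (continuousAt_update_same.2 hr)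
    filter_upwards [self_mem_nhdsWithin] with s hs
    have hs : s ≠ 1 := hs
    have hd : DifferentiableAt ℂ (fun s => (s - 1) * HurwitzZeta.hurwitzZeta a s) s :=
      DifferentiableAt.fun_mul (by fun_prop) (HurwitzZeta.differentiableAt_hurwitzZeta a hs)
    refine hd.congr_of_eventuallyEq ?_
    filter_upwards [isOpen_ne.mem_nhds hs] with z hz
    rw [Function.update_of_ne hz]
  have hm : MeromorphicAt (fun s : ℂ => (s - 1)⁻¹ *
      Function.update (fun s => (s - 1) * HurwitzZeta.hurwitzZeta a s) 1 1 s) 1 :=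
    MeromorphicAt.fun_mul (by fun_prop) h.meromorphicAt
  refine hm.congr ?_
  filter_upwards [self_mem_nhdsWithin] with s hs
  have hs : s ≠ 1 := hs
  rw [Function.update_of_ne hs, inv_mul_cancel_left₀ (sub_ne_zero.2 hs)]

lemma meromorphicAt_shadowZeta (s : ℂ) : MeromorphicAt shadowZeta s := by
  rcases eq_or_ne s 1 with rfl | hs
  · have h2 : Differentiable ℂ fun s : ℂ => (2 : ℂ) ^ (-s) := fun s =>
      DifferentiableAt.const_cpow (by fun_prop) (Or.inl two_ne_zero)
    have h4 : Differentiable ℂ fun s : ℂ => (4 : ℂ) ^ s := fun s =>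
      DifferentiableAt.const_cpow (by fun_prop) (Or.inl (by norm_num))
    exact (h2.analyticAt 1).meromorphicAt.fun_mul
      ((meromorphicAt_hurwitzZeta_one _).fun_sub (h4.analyticAt 1).meromorphicAt)
  · exact (analyticAt_shadowZeta hs).meromorphicAt

lemma eventuallyEq_nhdsNE_of_eqOn {F G : ℂ → ℂ} (hF : ∀ z, MeromorphicAt F z)
    (hG : ∀ z, MeromorphicAt G z) {U : Set ℂ} (hU : IsOpen U) (hne : U.Nonempty)
    (h : Set.EqOn F G U) (z : ℂ) : F =ᶠ[𝓝[≠] z] G := by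
  obtain ⟨w, hw⟩ := hne
  have hm : MeromorphicOn (F - G) Set.univ := fun x _ => (hF x).sub (hG x)
  have hconn : IsPreconnected (Set.univ : Set ℂ) := isPreconnected_univ
  have htop : meromorphicOrderAt (F - G) w = ⊤ := by
    rw [meromorphicOrderAt_eq_top_iff]
    filter_upwards [(hU.mem_nhds hw : U ∈ 𝓝 w) |> mem_nhdsWithin_of_mem_nhds] with x hx
    rw [Pi.sub_apply, h hx, sub_self]
  have hz : meromorphicOrderAt (F - G) z = ⊤ := by
    by_contra hne
    exact hm.meromorphicOrderAt_ne_top_of_isPreconnected hconn (Set.mem_univ z) (Set.mem_univ w)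
      hne htop
  rw [meromorphicOrderAt_eq_top_iff] at hz
  filter_upwards [hz] with x hx using sub_eq_zero.1 hx

/-- The identity theorem gives equality on punctured neighbourhoods only; the normal form fixes the
value at the centre as well. -/
lemma IsMeromorphicContinuation.unique {f F G : ℂ → ℂ} {U : Set ℂ} (hU : IsOpen U)
    (hne : U.Nonempty) (hF : IsMeromorphicContinuation f U F)
    (hG : IsMeromorphicContinuation f U G) : F = G := by
  funext z
  have h := eventuallyEq_nhdsNE_of_eqOn (fun z => (hF.1 (Set.mem_univ z)).meromorphicAt)
    (fun z => (hG.1 (Set.mem_univ z)).meromorphicAt) hU hne (hF.2.trans hG.2.symm) z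
  exact (((hF.1 (Set.mem_univ z)).eventuallyEq_nhdsNE_iff_eventuallyEq_nhds
    (hG.1 (Set.mem_univ z))).1 h).eq_of_nhds

lemma existsUnique_isMeromorphicContinuation {f W : ℂ → ℂ} {U : Set ℂ} (hU : IsOpen U)
    (hne : U.Nonempty) (hf : DifferentiableOn ℂ f U) (hW : ∀ z, MeromorphicAt W z)
    (h : Set.EqOn W f U) : ∃! F, IsMeromorphicContinuation f U F := by
  have hm : MeromorphicOn W Set.univ := fun z _ => hW z
  have hF : IsMeromorphicContinuation f U (toMeromorphicNFOn W Set.univ) := by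
    refine ⟨meromorphicNFOn_toMeromorphicNFOn W Set.univ, fun z hz => ?_⟩
    have ha : AnalyticAt ℂ W z :=
      (hf.analyticAt (hU.mem_nhds hz)).congr
        (Filter.eventuallyEq_of_mem (hU.mem_nhds hz) h.symm)
    rw [toMeromorphicNFOn_eq_toMeromorphicNFAt hm (Set.mem_univ z),
      toMeromorphicNFAt_eq_self.2 ha.meromorphicNFAt, h hz]
  exact ⟨_, hF, fun G hG => hG.unique hU hne hF⟩

/-- Any meromorphic representative `W` may be used, whatever its value at `a`: its punctured limit
decides both regularity and the value of the normal form. -/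
lemma IsMeromorphicContinuation.analyticAt_of_tendsto {f F W : ℂ → ℂ} {U : Set ℂ} (hU : IsOpen U)
    (hne : U.Nonempty) (hF : IsMeromorphicContinuation f U F) (hW : ∀ z, MeromorphicAt W z)
    (h : Set.EqOn W f U) {a c : ℂ} (hc : Tendsto W (𝓝[≠] a) (𝓝 c)) :
    AnalyticAt ℂ F a ∧ F a = c := by
  have hNF := hF.1 (Set.mem_univ a)
  have he := eventuallyEq_nhdsNE_of_eqOn (fun z => (hF.1 (Set.mem_univ z)).meromorphicAt) hW hU hne
    (hF.2.trans h.symm) a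
  have ht := hc.congr' he.symm
  have ha : AnalyticAt ℂ F a := hNF.meromorphicOrderAt_nonneg_iff_analyticAt.1
    ((tendsto_nhds_iff_meromorphicOrderAt_nonneg hNF.meromorphicAt).1 ⟨c, ht⟩)
  exact ⟨ha, tendsto_nhds_unique (ha.continuousAt.tendsto.mono_left nhdsWithin_le_nhds) ht⟩

/-- The series over the zeros, extended by its continuation. -/
noncomputable def zeroExtension (σ : ℂ) : ℂ :=
  if 1 / 2 < σ.re then zeroSeries σ else zeroContinuation σ

lemma isOpen_half_lt_re : IsOpen {σ : ℂ | 1 / 2 < σ.re} := isOpen_lt continuous_const continuous_re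

lemma zeroExtension_eq_zeroSeries : Set.EqOn zeroExtension zeroSeries {σ : ℂ | 1 / 2 < σ.re} :=
  fun _ hσ => if_pos hσ

lemma zeroExtension_eq_zeroContinuation {σ : ℂ} (h : σ.re < 1) :
    zeroExtension σ = zeroContinuation σ := by
  unfold zeroExtension
  split_ifs with h1
  · exact zeroSeries_eq_zeroContinuation h1 h
  · rfl

lemma analyticAt_mellin_xiRemainder {σ : ℂ} (h : σ.re < 1) :
    AnalyticAt ℂ (fun σ => mellin xiRemainder (2 - 2 * σ)) σ := by
  refine DifferentiableOn.analyticAt (s := {σ : ℂ | σ.re < 1}) (fun z hz => ?_)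
    ((isOpen_lt continuous_re continuous_const).mem_nhds h)
  have hz : z.re < 1 := hz
  refine DifferentiableAt.differentiableWithinAt (DifferentiableAt.comp
    (f := fun σ : ℂ => 2 - 2 * σ) z (differentiableAt_mellin_xiRemainder ?_) (by fun_prop))
  simp
  linarith

lemma meromorphicAt_zeroContinuation {σ : ℂ} (h : σ.re < 1) : MeromorphicAt zeroContinuation σ := by
  have h1 : MeromorphicAt (fun σ : ℂ => shadowZeta (2 * σ)) σ :=
    MeromorphicAt.comp_analyticAt (f := shadowZeta) (g := fun σ : ℂ => 2 * σ)
      (meromorphicAt_shadowZeta _) (by fun_prop)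
  have h2 : MeromorphicAt (fun σ : ℂ => cos (Real.pi * σ)) σ :=
    (Differentiable.analyticAt (by fun_prop) _).meromorphicAt
  have h3 : MeromorphicAt (fun σ : ℂ => sin (Real.pi * σ)) σ :=
    (Differentiable.analyticAt (by fun_prop) _).meromorphicAt
  have h4 := meromorphicAt_poleSeries σ
  have h5 := (analyticAt_mellin_xiRemainder h).meromorphicAt
  have h6 : MeromorphicAt (fun σ : ℂ => (Real.pi : ℂ) * (1 - 2 * σ)) σ :=
    (Differentiable.analyticAt (by fun_prop) _).meromorphicAt
  exact (h1.fun_neg.fun_div ((MeromorphicAt.const 2 σ).fun_mul h2)).fun_add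
    ((h3.fun_mul (h4.fun_sub h5)).fun_div h6)

lemma meromorphicAt_zeroExtension (σ : ℂ) : MeromorphicAt zeroExtension σ := by
  rcases lt_or_ge σ.re 1 with h | h
  · refine (meromorphicAt_zeroContinuation h).congr (Filter.EventuallyEq.filter_mono ?_
      nhdsWithin_le_nhds)
    filter_upwards [(isOpen_lt continuous_re continuous_const).mem_nhds h] with z hz
    exact (zeroExtension_eq_zeroContinuation hz).symm
  · have hm : {σ : ℂ | 1 / 2 < σ.re} ∈ 𝓝 σ :=
      isOpen_half_lt_re.mem_nhds (by show (1 / 2 : ℝ) < σ.re; linarith)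
    exact ((differentiableOn_zeroSeries.analyticAt hm).congr
      (Filter.eventuallyEq_of_mem hm zeroExtension_eq_zeroSeries.symm)).meromorphicAt

/-- The transform of the remainder is regular at `-m` and is killed by the sine. In the pole
contribution the factor `2m + 1` cancels `1 - 2σ = 1 + 2m`, leaving `(-1)^m 2^(-2m) / 2`. -/
lemma tendsto_zeroExtension (m : ℕ) :
    Tendsto zeroExtension (𝓝[≠] (-(m : ℂ)))
      (𝓝 ((-1) ^ m / 2 * (-shadowZeta (-2 * (m : ℂ)) + 2 ^ (-2 * (m : ℤ))))) := by
  have hre : (-(m : ℂ)).re < 1 := by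
    have : (0 : ℝ) ≤ m := Nat.cast_nonneg m
    simp
    linarith
  have hs : sin (Real.pi * (-(m : ℂ))) = 0 := by
    rw [mul_neg, Complex.sin_neg, mul_comm, sin_nat_mul_pi, neg_zero]
  have hc : cos (Real.pi * (-(m : ℂ))) = (-1) ^ m := by
    rw [mul_neg, Complex.cos_neg, mul_comm]
    exact_mod_cast congrArg ofReal (Real.cos_nat_mul_pi m)
  have hπ : (Real.pi : ℂ) ≠ 0 := by exact_mod_cast Real.pi_ne_zero
  have hm0 : (1 : ℂ) + 2 * m ≠ 0 := by exact_mod_cast (by omega : 1 + 2 * m ≠ 0)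
  have hne1 : 2 * -(m : ℂ) ≠ 1 := by
    intro h
    have := congrArg re h
    simp at this
    have h2 : (0 : ℝ) ≤ m := Nat.cast_nonneg m
    linarith
  have hle : 𝓝[≠] (-(m : ℂ)) ≤ 𝓝 (-(m : ℂ)) := nhdsWithin_le_nhds
  have t1 : Tendsto (fun σ : ℂ => -shadowZeta (2 * σ) / (2 * cos (Real.pi * σ))) (𝓝[≠] (-(m : ℂ)))
      (𝓝 (-shadowZeta (2 * -(m : ℂ)) / (2 * cos (Real.pi * -(m : ℂ))))) := by
    have hd : ContinuousAt (fun σ : ℂ => shadowZeta (2 * σ)) (-(m : ℂ)) :=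
      ContinuousAt.comp (f := fun σ : ℂ => 2 * σ) (differentiableAt_shadowZeta hne1).continuousAt
        (by fun_prop)
    refine ContinuousAt.tendsto (hd.neg.div ?_ ?_) |>.mono_left hle
    · exact Continuous.continuousAt (by fun_prop)
    · rw [hc]
      exact mul_ne_zero two_ne_zero (pow_ne_zero _ (by norm_num))
  have t2 : Tendsto (fun σ : ℂ => sin (Real.pi * σ) * mellin xiRemainder (2 - 2 * σ))
      (𝓝[≠] (-(m : ℂ))) (𝓝 0) := by
    have hsc : ContinuousAt (fun σ : ℂ => sin (Real.pi * σ)) (-(m : ℂ)) :=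
      Continuous.continuousAt (by fun_prop)
    have := (hsc.fun_mul (analyticAt_mellin_xiRemainder hre).continuousAt).tendsto.mono_left hle
    rwa [hs, zero_mul] at this
  have t3 : Tendsto (fun σ : ℂ => (Real.pi : ℂ) * (1 - 2 * σ)) (𝓝[≠] (-(m : ℂ)))
      (𝓝 (Real.pi * (1 - 2 * -(m : ℂ)))) := by
    refine Tendsto.mono_left (Continuous.tendsto ?_ _) hle
    fun_prop
  have t := t1.add (((tendsto_sin_mul_poleSeries m).sub t2).div t3
    (mul_ne_zero hπ (by rw [mul_neg, sub_neg_eq_add]; exact hm0)))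
  have hval : -shadowZeta (2 * -(m : ℂ)) / (2 * cos (Real.pi * -(m : ℂ))) +
      (Real.pi * (-1) ^ m * ((2 * m + 1) * (1 / 2) ^ (2 * m) / 2) - 0) /
        (Real.pi * (1 - 2 * -(m : ℂ))) =
      (-1) ^ m / 2 * (-shadowZeta (-2 * (m : ℂ)) + 2 ^ (-2 * (m : ℤ))) := by
    have h2 : (2 : ℂ) ^ (-2 * (m : ℤ)) = (1 / 2) ^ (2 * m) := by
      rw [neg_mul, zpow_neg, one_div, inv_pow]
      norm_cast
    have hsq : ((-1 : ℂ) ^ m)⁻¹ = (-1) ^ m := by rw [← inv_pow]; norm_num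
    rw [h2, hc, show 2 * -(m : ℂ) = -2 * m by ring, div_eq_mul_inv _ (2 * (-1 : ℂ) ^ m), mul_inv,
      hsq, show (1 : ℂ) - -2 * m = 1 + 2 * m by ring]
    field_simp
    ring
  rw [hval] at t
  refine t.congr' (Filter.EventuallyEq.filter_mono ?_ hle)
  filter_upwards [(isOpen_lt continuous_re continuous_const).mem_nhds hre] with σ hσ
  rw [zeroExtension_eq_zeroContinuation hσ, zeroContinuation, mul_sub, Pi.div_apply]

/-! ### Euler numbers and the values of the Hurwitz zeta function at `1/4`. -/

lemma two_mul_rescale_coshSeries_mul (a : ℚ) :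
    2 * PowerSeries.rescale a coshSeries * PowerSeries.rescale a (PowerSeries.exp ℚ) =
      PowerSeries.rescale a (PowerSeries.exp ℚ) ^ 2 + 1 := by
  have h : 2 * PowerSeries.rescale a coshSeries =
      PowerSeries.rescale a (PowerSeries.exp ℚ) + PowerSeries.rescale (-a) (PowerSeries.exp ℚ) := by
    ext n
    rw [two_mul, map_add, map_add, PowerSeries.coeff_rescale, PowerSeries.coeff_rescale,
      PowerSeries.coeff_rescale, coshSeries, PowerSeries.coeff_mk, PowerSeries.coeff_exp,
      Algebra.algebraMap_self_apply]
    split_ifs with hn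
    · rw [hn.neg_pow]
    · rw [(Nat.not_even_iff_odd.1 hn).neg_pow]
      ring
  rw [h, add_mul, ← sq, PowerSeries.exp_mul_exp_eq_exp_add, neg_add_cancel]
  simp

lemma coshSeries_mul_inv : coshSeries * coshSeries⁻¹ = 1 :=
  PowerSeries.mul_inv_cancel _ (by
    rw [← PowerSeries.coeff_zero_eq_constantCoeff_apply, coshSeries, PowerSeries.coeff_mk]
    simp)

/-- Bernoulli polynomials of odd degree at `1/4` are Euler numbers. -/
lemma bernoulli_eval_quarter (m : ℕ) :
    (Polynomial.bernoulli (2 * m + 1)).eval (1 / 4 : ℚ) =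
      -(2 * m + 1) * (1 / 4) ^ (2 * m + 1) * eulerNumber (2 * m) := by
  let G : ℚ → PowerSeries ℚ := fun t =>
    PowerSeries.mk fun n => Polynomial.aeval t ((1 / n.factorial : ℚ) • Polynomial.bernoulli n)
  have hG : ∀ t, G t * (PowerSeries.exp ℚ - 1) =
      PowerSeries.X * PowerSeries.rescale t (PowerSeries.exp ℚ) := fun t =>
    Polynomial.bernoulli_generating_function t
  set e := PowerSeries.rescale (1 / 4 : ℚ) (PowerSeries.exp ℚ) with he
  have he2 : e ^ 2 = PowerSeries.rescale (1 / 2 : ℚ) (PowerSeries.exp ℚ) := by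
    rw [sq, he, PowerSeries.exp_mul_exp_eq_exp_add]; norm_num
  have he3 : PowerSeries.rescale (3 / 4 : ℚ) (PowerSeries.exp ℚ) = e ^ 3 := by
    rw [pow_succ, he2, he, PowerSeries.exp_mul_exp_eq_exp_add]; norm_num
  have he4 : PowerSeries.exp ℚ = e ^ 4 := by
    rw [show e ^ 4 = e ^ 2 * e ^ 2 by ring, he2, PowerSeries.exp_mul_exp_eq_exp_add]; norm_num
  have hne : e ^ 2 - 1 ≠ 0 := by
    intro h
    have := congrArg (PowerSeries.coeff 1) h
    rw [he2, map_sub, PowerSeries.coeff_rescale, PowerSeries.coeff_exp] at this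
    simp [PowerSeries.coeff_one] at this
  have hne' : e ≠ 0 := by
    intro h
    have := congrArg (PowerSeries.coeff 1) h
    rw [he, PowerSeries.coeff_rescale, PowerSeries.coeff_exp] at this
    simp at this
  -- With `e = exp(t/4)` this difference is `t (e - e³) / (e⁴ - 1) = -t e / (e² + 1) = -t / (2
  -- cosh(t/4))`. The symmetry `x ↦ 1 - x` doubles the odd-degree coefficients.
  set D := G (1 / 4) - G (3 / 4) with hD
  have h1 : D * (e ^ 4 - 1) = PowerSeries.X * (e - e ^ 3) := by
    have a1 := hG (1 / 4)
    have a2 := hG (3 / 4)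
    rw [he3] at a2
    rw [← he4, hD]
    linear_combination a1 - a2
  have h2 : D * (e ^ 2 + 1) = -(PowerSeries.X * e) := by
    refine mul_right_cancel₀ hne ?_
    linear_combination h1
  rw [← two_mul_rescale_coshSeries_mul] at h2
  have h3 : D * (2 * PowerSeries.rescale (1 / 4 : ℚ) coshSeries) = -PowerSeries.X := by
    refine mul_right_cancel₀ hne' ?_
    linear_combination h2
  have h4 : PowerSeries.rescale (1 / 4 : ℚ) coshSeries * PowerSeries.rescale (1 / 4) coshSeries⁻¹ = 1 := by
    rw [← map_mul, coshSeries_mul_inv, map_one]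
  have h5 : 2 * D = -(PowerSeries.X * PowerSeries.rescale (1 / 4 : ℚ) coshSeries⁻¹) := by
    linear_combination PowerSeries.rescale (1 / 4 : ℚ) coshSeries⁻¹ * h3 - 2 * D * h4
  have h6 := congrArg (PowerSeries.coeff (2 * m + 1)) h5
  have hsymm : (Polynomial.bernoulli (2 * m + 1)).eval (3 / 4 : ℚ) =
      -(Polynomial.bernoulli (2 * m + 1)).eval (1 / 4 : ℚ) := by
    have := Polynomial.bernoulli_eval_one_sub (2 * m + 1) (1 / 4)
    rw [Odd.neg_one_pow ⟨m, rfl⟩] at this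
    norm_num at this
    norm_num
    exact this
  rw [two_mul D, map_add, map_neg, PowerSeries.coeff_succ_X_mul, PowerSeries.coeff_rescale, hD, map_sub,
    PowerSeries.coeff_mk, PowerSeries.coeff_mk, map_smul, map_smul, Polynomial.coe_aeval_eq_eval,
    Polynomial.coe_aeval_eq_eval, hsymm] at h6
  have hf : ((2 * m + 1).factorial : ℚ) = (2 * m + 1) * (2 * m).factorial := by
    rw [Nat.factorial_succ]; push_cast; ring
  have hf0 : ((2 * m).factorial : ℚ) ≠ 0 := by exact_mod_cast Nat.factorial_ne_zero _
  have hm0 : (2 * (m : ℚ) + 1) ≠ 0 := by positivity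
  rw [eulerNumber]
  simp only [smul_eq_mul, hf] at h6
  generalize Polynomial.eval (1 / 4 : ℚ) (Polynomial.bernoulli (2 * m + 1)) = B at *
  generalize PowerSeries.coeff (2 * m) coshSeries⁻¹ = c at *
  generalize ((2 * m).factorial : ℚ) = f at *
  rw [pow_succ]
  generalize (1 / 4 : ℚ) ^ (2 * m) = q at *
  field_simp at h6
  linarith

open HurwitzZeta

lemma sin_two_pi_quarter_odd (k : ℕ) :
    Real.sin (2 * Real.pi * (1 / 4) * ((2 * k + 1 : ℕ) : ℝ)) = (-1) ^ k := by
  rw [show 2 * Real.pi * (1 / 4) * ((2 * k + 1 : ℕ) : ℝ) = Real.pi / 2 + k * Real.pi by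
    push_cast; ring, Real.sin_add_nat_mul_pi, Real.sin_pi_div_two, mul_one]

lemma hasSum_sinZeta_quarter {s : ℝ} (hs : 1 < s) :
    HasSum (fun k : ℕ => (((-1) ^ k * (2 * (k : ℝ) + 1) ^ (-s) : ℝ) : ℂ))
      (sinZeta ((1 / 4 : ℝ) : UnitAddCircle) s) := by
  have h := hasSum_nat_sinZeta (1 / 4) (s := s) (by simpa using hs)
  have hinj : Function.Injective fun k : ℕ => 2 * k + 1 := fun a b h => by
    simp only at h; omega
  rw [← hinj.hasSum_iff] at h
  · refine h.congr_fun fun k => ?_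
    simp only [Function.comp]
    rw [sin_two_pi_quarter_odd, Real.rpow_neg (by positivity), ofReal_mul, ofReal_inv,
      ofReal_cpow (by positivity), div_eq_mul_inv]
    push_cast
    rfl
  · intro n hn
    have : ¬ Odd n := fun ⟨k, hk⟩ => hn ⟨k, hk.symm⟩
    obtain ⟨k, hk⟩ := (Nat.not_odd_iff_even.1 this).two_dvd
    rw [show 2 * Real.pi * (1 / 4) * (n : ℝ) = k * Real.pi by rw [hk]; push_cast; ring,
      Real.sin_nat_mul_pi, ofReal_zero, zero_div]

/-- At `s = 1` absolute convergence fails. For `s > 1` the alternating series is enclosed by its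
partial sums; letting `s → 1` in each inequality encloses the value by the partial sums of Leibniz's
series for `π/4`. -/
lemma sinZeta_quarter_one : sinZeta ((1 / 4 : ℝ) : UnitAddCircle) 1 = Real.pi / 4 := by
  set L : ℝ → ℂ := fun s => sinZeta ((1 / 4 : ℝ) : UnitAddCircle) s with hL
  have hc : Continuous L :=
    (differentiableAt_sinZeta ((1 / 4 : ℝ) : UnitAddCircle)).continuous.comp continuous_ofReal
  have hre : ∀ s : ℝ, 1 < s → HasSum (fun k : ℕ => (-1 : ℝ) ^ k * (2 * (k : ℝ) + 1) ^ (-s)) (L s).re :=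
    fun s hs => (hasSum_re (hasSum_sinZeta_quarter hs)).congr_fun fun _ => (ofReal_re _).symm
  have him : ∀ s : ℝ, 1 < s → (L s).im = 0 := fun s hs => by
    have := hasSum_im (hasSum_sinZeta_quarter hs)
    simp only [ofReal_im] at this
    exact this.unique hasSum_zero
  have hanti : ∀ s : ℝ, 1 < s → Antitone fun k : ℕ => (2 * (k : ℝ) + 1) ^ (-s) := fun s hs a b hab => by
    have : (a : ℝ) ≤ b := by exact_mod_cast hab
    exact Real.rpow_le_rpow_of_nonpos (by positivity) (by linarith) (by linarith)
  have hpart : ∀ n : ℕ, Tendsto (fun s : ℝ => ∑ i ∈ Finset.range n, (-1 : ℝ) ^ i * (2 * (i : ℝ) + 1) ^ (-s))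
      (𝓝[>] 1) (𝓝 (∑ i ∈ Finset.range n, (-1 : ℝ) ^ i / (2 * i + 1))) := fun n => by
    have hcont : Continuous fun s : ℝ => ∑ i ∈ Finset.range n, (-1 : ℝ) ^ i * (2 * (i : ℝ) + 1) ^ (-s) := by
      refine continuous_finsetSum _ fun i _ => continuous_const.mul ?_
      exact (Real.continuous_const_rpow (by positivity)).comp continuous_neg
    have := (hcont.tendsto 1).mono_left (nhdsWithin_le_nhds (s := Set.Ioi 1))
    simpa only [Real.rpow_neg_one, ← div_eq_mul_inv] using this
  have hLre : Tendsto (fun s : ℝ => (L s).re) (𝓝[>] 1) (𝓝 (L 1).re) :=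
    ((continuous_re.comp hc).tendsto 1).mono_left nhdsWithin_le_nhds
  have hLim : Tendsto (fun s : ℝ => (L s).im) (𝓝[>] 1) (𝓝 (L 1).im) :=
    ((continuous_im.comp hc).tendsto 1).mono_left nhdsWithin_le_nhds
  have him1 : (L 1).im = 0 := by
    refine tendsto_nhds_unique hLim (tendsto_const_nhds.congr' ?_)
    filter_upwards [self_mem_nhdsWithin] with s hs using (him s hs).symm
  have hlow : ∀ k : ℕ, ∑ i ∈ Finset.range (2 * k), (-1 : ℝ) ^ i / (2 * i + 1) ≤ (L 1).re := fun k => by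
    refine le_of_tendsto_of_tendsto (hpart _) hLre ?_
    filter_upwards [self_mem_nhdsWithin] with s hs
    exact (hanti s hs).alternating_series_le_tendsto (hre s hs).tendsto_sum_nat k
  have hup : ∀ k : ℕ, (L 1).re ≤ ∑ i ∈ Finset.range (2 * k + 1), (-1 : ℝ) ^ i / (2 * i + 1) := fun k => by
    refine le_of_tendsto_of_tendsto hLre (hpart _) ?_
    filter_upwards [self_mem_nhdsWithin] with s hs
    exact (hanti s hs).tendsto_le_alternating_series (hre s hs).tendsto_sum_nat k
  have hpi := Real.tendsto_sum_pi_div_four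
  have hre1 : (L 1).re = Real.pi / 4 := by
    have t1 : Tendsto (fun k : ℕ => 2 * k + 1) atTop atTop :=
      tendsto_atTop_mono (fun k => by simp only [id]; omega) tendsto_id
    have t2 : Tendsto (fun k : ℕ => 2 * k) atTop atTop :=
      tendsto_atTop_mono (fun k => by simp only [id]; omega) tendsto_id
    exact le_antisymm (ge_of_tendsto' (hpi.comp t1) hup) (le_of_tendsto' (hpi.comp t2) hlow)
  have : L 1 = ((Real.pi / 4 : ℝ) : ℂ) := Complex.ext (by rw [hre1, ofReal_re]) (by rw [him1, ofReal_im])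
  simpa [hL] using this

/-- The case `m = 0` of the special values. The even part vanishes at `0` since `1/4` is not an
integer; the odd part comes from `sinZeta` at `1` by the functional equation. -/
lemma hurwitzZeta_quarter_zero : hurwitzZeta ((1 / 4 : ℝ) : UnitAddCircle) 0 = 1 / 4 := by
  have hne : ((1 / 4 : ℝ) : UnitAddCircle) ≠ 0 := by
    intro h
    obtain ⟨n, hn⟩ := (AddCircle.coe_eq_zero_iff (1 : ℝ)).1 h
    have h1 : ((4 * n : ℤ) : ℝ) = ((1 : ℤ) : ℝ) := by
      push_cast
      simp at hn
      rw [hn]; norm_num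
    have := Int.cast_injective h1
    omega
  have h := hurwitzZetaOdd_one_sub ((1 / 4 : ℝ) : UnitAddCircle) (s := 1) (fun n h => by
    have := congrArg re h
    simp at this
    linarith [(Nat.cast_nonneg n : (0 : ℝ) ≤ n)])
  have hπ : (Real.pi : ℂ) ≠ 0 := by exact_mod_cast Real.pi_ne_zero
  rw [sub_self, Gamma_one, mul_one (Real.pi : ℂ), Complex.sin_pi_div_two, sinZeta_quarter_one,
    cpow_neg_one] at h
  rw [hurwitzZeta, hurwitzZetaEven_apply_zero, if_neg hne, h]
  field_simp
  norm_num

lemma hurwitzZeta_quarter_neg_two_mul (m : ℕ) :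
    hurwitzZeta ((1 / 4 : ℝ) : UnitAddCircle) (-2 * (m : ℂ)) =
      (1 / 4) ^ (2 * m + 1) * (eulerNumber (2 * m) : ℂ) := by
  have hB : ((Polynomial.bernoulli (2 * m + 1)).map (algebraMap ℚ ℂ)).eval ((1 / 4 : ℝ) : ℂ) =
      -(2 * m + 1) * (1 / 4) ^ (2 * m + 1) * (eulerNumber (2 * m) : ℂ) := by
    have := congrArg (fun q : ℚ => (q : ℂ)) (bernoulli_eval_quarter m)
    push_cast at this
    rw [← this, show ((1 / 4 : ℝ) : ℂ) = algebraMap ℚ ℂ (1 / 4) by simp, Polynomial.eval_map_apply]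
    simp
  have hm0 : (2 * (m : ℂ) + 1) ≠ 0 := by exact_mod_cast (by omega : 2 * m + 1 ≠ 0)
  rcases eq_or_ne m 0 with rfl | hm
  · have h1 := bernoulli_eval_quarter 0
    simp [Polynomial.bernoulli_one] at h1
    have h2 : eulerNumber 0 = 1 := by linarith
    simp [h2]
    simpa using hurwitzZeta_quarter_zero
  · have h := hurwitzZeta_neg_nat (k := 2 * m) (x := 1 / 4) (by omega) (by norm_num)
    rw [hB] at h
    push_cast at h
    rw [show -2 * (m : ℂ) = -(2 * m) by ring, h]
    field_simp

lemma shadowZeta_neg_two_mul (m : ℕ) :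
    shadowZeta (-2 * (m : ℂ)) = 2 ^ (-2 * (m : ℤ)) * ((eulerNumber (2 * m) : ℂ) / 4 - 1) := by
  have h2 : (2 : ℂ) ^ (-(-2 * (m : ℂ))) = 2 ^ (2 * m) := by
    rw [show -(-2 * (m : ℂ)) = ((2 * m : ℕ) : ℂ) by push_cast; ring, cpow_natCast]
  have h4 : (4 : ℂ) ^ (-2 * (m : ℂ)) = (1 / 4) ^ (2 * m) := by
    rw [show -2 * (m : ℂ) = -((2 * m : ℕ) : ℂ) by push_cast; ring, cpow_neg, cpow_natCast, one_div,
      inv_pow]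
  have h3 : (2 : ℂ) ^ (-2 * (m : ℤ)) = (1 / 2) ^ (2 * m) := by
    rw [neg_mul, zpow_neg, one_div, inv_pow]
    norm_cast
  have h5 : (2 : ℂ) ^ (2 * m) * (1 / 4) ^ (2 * m) = (1 / 2) ^ (2 * m) := by
    rw [← mul_pow]; norm_num
  rw [shadowZeta, hurwitzZeta_quarter_neg_two_mul, h2, h4, h3, ← h5]
  ring

end

theorem mainTheorem3 :
    (∀ σ : ℂ, 1 / 2 < σ.re → Summable (zeroTerm σ)) ∧
    (∀ s : ℂ, 1 < s.re → Summable (shadowTerm s)) ∧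
    (∃! Z : ℂ → ℂ, IsMeromorphicContinuation zeroSeries {σ : ℂ | 1 / 2 < σ.re} Z) ∧
    (∃! S : ℂ → ℂ, IsMeromorphicContinuation shadowSeries {s : ℂ | 1 < s.re} S) ∧
    ∀ Z S : ℂ → ℂ,
      IsMeromorphicContinuation zeroSeries {σ : ℂ | 1 / 2 < σ.re} Z →
      IsMeromorphicContinuation shadowSeries {s : ℂ | 1 < s.re} S →
      ∀ m : ℕ,
        AnalyticAt ℂ Z (-(m : ℂ)) ∧ AnalyticAt ℂ S (-2 * (m : ℂ)) ∧
        Z (-(m : ℂ)) =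
          (-1 : ℂ) ^ m / 2 * (-S (-2 * (m : ℂ)) + (2 : ℂ) ^ (-2 * (m : ℤ))) ∧
        (-1 : ℂ) ^ m / 2 * (-S (-2 * (m : ℂ)) + (2 : ℂ) ^ (-2 * (m : ℤ))) =
          (-1 : ℂ) ^ m * (2 : ℂ) ^ (-2 * (m : ℤ)) * (1 - (eulerNumber (2 * m) : ℂ) / 8) := by
  have hSeq : Set.EqOn shadowZeta shadowSeries {s : ℂ | 1 < s.re} := fun s hs =>
    (hasSum_shadowTerm hs).tsum_eq.symm
  have hSo : IsOpen {s : ℂ | 1 < s.re} := isOpen_lt continuous_const continuous_re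
  have hSne : {s : ℂ | 1 < s.re}.Nonempty := ⟨2, by simp⟩
  have hZne : {σ : ℂ | 1 / 2 < σ.re}.Nonempty := ⟨1, by norm_num⟩
  have hSd : DifferentiableOn ℂ shadowSeries {s : ℂ | 1 < s.re} := by
    refine DifferentiableOn.congr (fun s hs => ?_) fun s hs => (hSeq hs).symm
    refine (differentiableAt_shadowZeta ?_).differentiableWithinAt
    rintro rfl
    simp at hs
  refine ⟨fun σ hσ => summable_zeroTerm hσ, fun s hs => (hasSum_shadowTerm hs).summable,
    existsUnique_isMeromorphicContinuation isOpen_half_lt_re hZne differentiableOn_zeroSeries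
      meromorphicAt_zeroExtension zeroExtension_eq_zeroSeries,
    existsUnique_isMeromorphicContinuation hSo hSne hSd meromorphicAt_shadowZeta hSeq,
    fun Z S hZ hS m => ?_⟩
  have hne1 : -2 * (m : ℂ) ≠ 1 := by
    intro h
    have := congrArg re h
    simp at this
    linarith [(Nat.cast_nonneg m : (0 : ℝ) ≤ m)]
  -- Both continuations are read off from explicit representatives through their punctured limits.
  have hZm := hZ.analyticAt_of_tendsto isOpen_half_lt_re hZne meromorphicAt_zeroExtension
    zeroExtension_eq_zeroSeries (tendsto_zeroExtension m)
  have hSm := hS.analyticAt_of_tendsto hSo hSne meromorphicAt_shadowZeta hSeq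
    ((differentiableAt_shadowZeta hne1).continuousAt.tendsto.mono_left nhdsWithin_le_nhds)
  refine ⟨hZm.1, hSm.1, ?_, ?_⟩
  · rw [hZm.2, hSm.2]
  · rw [hSm.2, shadowZeta_neg_two_mul]
    ring
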